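/- Let $\gamma_1$ be the standard Gaussian measure on $\mathbb R$ and $\gamma_2=\gamma_1\otimes\gamma_1$ the standard Gaussian measure on $\mathbb R^2$. For $-\infty\le\alpha<\beta\le\infty$ put $$\mu_1(\alpha,\beta)=\min\left\{\frac{\int_\alpha^\beta (z')^2\,d\gamma_1}{\int_\alpha^\beta z^2\,d\gamma_1}\ :\ z\in H^1((\alpha,\beta),\gamma_1),\ z\neq 0,\ \int_\alpha^\beta z\,d\gamma_1=0\right\},$$ the first nontrivial Neumann eigenvalue of $-v''+xv'=\mu v$ on $(\alpha,\beta)$. For a domain $\Omega\subset\mathbb R^2$ symmetric with respect to the $y$-axis, let $\mu_1^{odd}(\Omega)$ be the lowest $\mu\in\mathbb R$ for which there is a nonzero $u\in H^1(\Omega,\gamma_2)$, odd with respect to the $y$-axis ($u(-x,y)=-u(x,y)$), with $$\int_\Omega \nabla u\cdot\nabla\varphi\,d\gamma_2=\mu\int_\Omega u\,\varphi\,d\gamma_2\qquad\text{for all }\varphi\in H^1(\Omega,\gamma_2),$$ that is, the lowest Neumann eigenvalue of the Hermite operator $-\Delta u+(x,y)\cdot\nabla u$ on $\Omega$ that has an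 odd eigenfunction. **Theorem.** Let $\Omega\subset\mathbb R^2$ be a convex unbounded domain with $C^2$ boundary, symmetric with respect to the $y$-axis, and suppose that $$\Omega=\{(x,y)\in\mathbb R^2:\ -a<x<a,\ y<p(x)\}$$ with $a\in(0,+\infty]$ and $p:(-a,a)\to\mathbb R$ concave, even and of class $C^2$. Assume that $\Omega$ satisfies a uniform interior sphere condition: there is $r>0$ such that every point of $\partial\Omega$ lies on the boundary of an open disk of radius $r$ contained in $\Omega$. Then the two minima $\mu_1(-a,a)$ and $\mu_1^{odd}(\Omega)$ exist and $$\mu_1^{odd}(\Omega)\ \ge\ \mu_1(-a,a).$$ Moreover, for every $a\in(0,+\infty]$ and $b\in\mathbb R$, both minima also exist for the half-strip $(-a,a)\times(-\infty,b)$, and $$\mu_1^{odd}\big((-a,a)\times(-\infty,b)\big)=\mu_1(-a,a).$$ -/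

import Mathlib

open MeasureTheory ProbabilityTheory Set Filter
open scoped Topology ContDiff

/-! ### Domains in the plane

The plane is `ℝ × ℝ` with coordinates `(x, y)`.  Euclidean disks are written out explicitly, since
the norm of `ℝ × ℝ` is the sup norm. -/

/-- The open interval `(α, β)` of the real line, with possibly infinite end points. -/
def openInterval (α β : EReal) : Set ℝ := {x : ℝ | α < (x : EReal) ∧ (x : EReal) < β}

/-- The region `{(x, y) : -a < x < a, y < p x}`. -/
def regionBelow (a : EReal) (p : ℝ → ℝ) : Set (ℝ × ℝ) :=
  {q : ℝ × ℝ | q.1 ∈ openInterval (-a) a ∧ q.2 < p q.1}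

/-- The half-strip `(-a, a) × (-∞, b)`. -/
def halfStrip (a : EReal) (b : ℝ) : Set (ℝ × ℝ) := openInterval (-a) a ×ˢ Iio b

/-- A domain: a nonempty connected open set. -/
def IsDomainSet (Ω : Set (ℝ × ℝ)) : Prop := IsOpen Ω ∧ IsConnected Ω

/-- Symmetry with respect to the `y`-axis. -/
def SymmYAxis (Ω : Set (ℝ × ℝ)) : Prop := ∀ q ∈ Ω, (-q.1, q.2) ∈ Ω

/-- `C²` boundary: near every boundary point, `Ω` is the sublevel set `{ψ < 0}` of a `C²` function
`ψ` whose differential does not vanish at that point. -/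
def HasC2Boundary (Ω : Set (ℝ × ℝ)) : Prop :=
  ∀ P ∈ frontier Ω, ∃ ψ : ℝ × ℝ → ℝ, ContDiffAt ℝ 2 ψ P ∧ fderiv ℝ ψ P ≠ 0 ∧
    ∀ᶠ q in 𝓝 P, (q ∈ Ω ↔ ψ q < 0)

/-- The open Euclidean disk with centre `c` and radius `r`. -/
def openDisk (c : ℝ × ℝ) (r : ℝ) : Set (ℝ × ℝ) :=
  {q : ℝ × ℝ | (q.1 - c.1) ^ 2 + (q.2 - c.2) ^ 2 < r ^ 2}

/-- Uniform interior sphere condition: for one radius `r > 0`, every boundary point of `Ω` lies on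
the boundary circle of an open disk of radius `r` contained in `Ω`. -/
def UniformInteriorSphere (Ω : Set (ℝ × ℝ)) : Prop :=
  ∃ r : ℝ, 0 < r ∧ ∀ P ∈ frontier Ω, ∃ c : ℝ × ℝ,
    openDisk c r ⊆ Ω ∧ (P.1 - c.1) ^ 2 + (P.2 - c.2) ^ 2 = r ^ 2

/-! ### Gaussian Sobolev spaces -/

/-- `g` is the weak derivative of `u` on the open set `U` in the direction `v`
(with respect to Lebesgue measure, tested against smooth functions compactly supported in `U`). -/
structure HasWeakDeriv {E : Type*} [NormedAddCommGroup E] [NormedSpace ℝ E] [MeasureSpace E]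
    (U : Set E) (v : E) (u g : E → ℝ) : Prop where
  locInt : LocallyIntegrableOn u U volume
  locInt_deriv : LocallyIntegrableOn g U volume
  integral_eq : ∀ φ : E → ℝ, ContDiff ℝ ∞ φ → HasCompactSupport φ → tsupport φ ⊆ U →
    ∫ x in U, u x * fderiv ℝ φ x v = - ∫ x in U, g x * φ x

/-- The standard Gaussian measure `γ_x` on the line. -/
noncomputable def gauss1 : Measure ℝ := gaussianReal 0 1

/-- The standard Gaussian measure `γ₂ = γ_x ⊗ γ_y` on the plane. -/
noncomputable def gauss2 : Measure (ℝ × ℝ) := gauss1.prod gauss1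

/-- `z` belongs to `H¹(I, γ_x)`, with weak derivative `dz`. -/
structure MemH1Line (I : Set ℝ) (z dz : ℝ → ℝ) : Prop where
  memLp : MemLp z 2 (gauss1.restrict I)
  memLp_deriv : MemLp dz 2 (gauss1.restrict I)
  weakDeriv : HasWeakDeriv I (1 : ℝ) z dz

/-- `u` belongs to `H¹(Ω, γ₂)`, with weak gradient `(ux, uy)`. -/
structure MemH1Plane (Ω : Set (ℝ × ℝ)) (u ux uy : ℝ × ℝ → ℝ) : Prop where
  memLp : MemLp u 2 (gauss2.restrict Ω)
  memLp_dx : MemLp ux 2 (gauss2.restrict Ω)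
  memLp_dy : MemLp uy 2 (gauss2.restrict Ω)
  weakDeriv_dx : HasWeakDeriv Ω ((1, 0) : ℝ × ℝ) u ux
  weakDeriv_dy : HasWeakDeriv Ω ((0, 1) : ℝ × ℝ) u uy

/-! ### The eigenvalues -/

/-- The Rayleigh quotients `∫ (z')² dγ_x / ∫ z² dγ_x` of the nonzero `z ∈ H¹((α, β), γ_x)` with
`∫ z dγ_x = 0`. -/
def rayleighQuotients (α β : EReal) : Set ℝ :=
  {R : ℝ | ∃ z dz : ℝ → ℝ, MemH1Line (openInterval α β) z dz ∧
    ¬ (z =ᵐ[volume.restrict (openInterval α β)] 0) ∧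
    ∫ x in openInterval α β, z x ∂gauss1 = 0 ∧
    R = (∫ x in openInterval α β, dz x ^ 2 ∂gauss1) / ∫ x in openInterval α β, z x ^ 2 ∂gauss1}

/-- `μ₁(α, β)`, the first nontrivial Neumann eigenvalue of `-v'' + x v' = μ v` on `(α, β)`, given by
its variational characterization. -/
noncomputable def mu1 (α β : EReal) : ℝ := sInf (rayleighQuotients α β)

/-- `u`, with weak gradient `(ux, uy)`, is a Neumann eigenfunction of the Hermite operator
on `Ω` for the eigenvalue `m`: a nonzero element of `H¹(Ω, γ₂)` with
`∫_Ω ∇u · ∇φ dγ₂ = m ∫_Ω u φ dγ₂` for all `φ ∈ H¹(Ω, γ₂)`. -/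
structure IsNeumannEigenfunction (Ω : Set (ℝ × ℝ)) (m : ℝ) (u ux uy : ℝ × ℝ → ℝ) : Prop where
  memH1 : MemH1Plane Ω u ux uy
  ne_zero : ¬ (u =ᵐ[volume.restrict Ω] 0)
  weak_eq : ∀ φ φx φy : ℝ × ℝ → ℝ, MemH1Plane Ω φ φx φy →
    ∫ q in Ω, (ux q * φx q + uy q * φy q) ∂gauss2 = m * ∫ q in Ω, u q * φ q ∂gauss2

/-- The Neumann eigenvalues on `Ω` that have an eigenfunction odd with respect to the `y`-axis. -/
def oddNeumannEigenvalues (Ω : Set (ℝ × ℝ)) : Set ℝ :=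
  {m : ℝ | ∃ u ux uy : ℝ × ℝ → ℝ, IsNeumannEigenfunction Ω m u ux uy ∧
    ∀ᵐ q ∂(volume.restrict Ω), u (-q.1, q.2) = - u q}

/-- `μ₁^odd(Ω)`, the lowest Neumann eigenvalue with an odd eigenfunction. -/
noncomputable def mu1Odd (Ω : Set (ℝ × ℝ)) : ℝ := sInf (oddNeumannEigenvalues Ω)

/-! Estimate: slice horizontally. As `p` is even and concave, it decreases in |x|, so each slice S_y
= {x : (x, y) ∈ Ω} is empty or an open interval in (-a, a) symmetric about 0. For almost every y, an
odd u restricts to the odd function x ↦ ∫₀ˣ uₓ(t, y) dt on S_y. Extend uₓ(·, y) by zero: the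
primitive becomes constant on each side of S_y, stays odd, hence has mean zero on (-a, a); its
Dirichlet energy is unchanged and its L² norm does not decrease. So μ₁(-a, a) ∫ u² ≤ ∫ uₓ² on S_y
(`mu1_mul_lintegral_primitive_le`). Integrating in y gives μ₁ ∫ u² ≤ ∫ uₓ² ≤ ∫ |∇u|², and the last
integral is m ∫ u² for an eigenfunction (`IsRegionProfile.mu1_le`).

Existence of the lowest odd eigenvalue: odd H¹ functions with their gradients form a closed subspace
of L²(Ω, γ₂; ℝ³). Let J keep only the function. Then ‖f‖² = ‖Jf‖² + Dirichlet energy, so a maximiser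
of ‖Jf‖ on the unit sphere is an eigenfunction for 1/‖J‖² - 1. The norm is attained because ‖Jf‖² ≤
ε‖f‖² + finitely many squared functionals (`IsRegionProfile.exists_finite_control`). This comes from
Poincaré inequalities on small squares in a compact core, together with tail estimates for |x| near
a, for y → -∞ and for the layer below the graph of p; the unbounded tails use a Gaussian Hardy
inequality.

Half-strip: functions of x alone are admissible, so the lowest odd eigenvalue m bounds the quotient
of every odd function of x. A mean-zero z is handled by writing z = k + F with F(0) = 0 and
reflecting the two halves of F into two odd functions; adding their inequalities gives the one for
F, and ∫ z² ≤ ∫ F² because z has mean zero (`le_rayleighQuotient`). Hence m ≤ μ₁, and equality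
holds. The one-dimensional minimum is read off from the plane: for an eigenfunction with m = μ₁ the
slicing inequality is an equality on almost every slice, so a nonzero slice is a minimiser
(`isLeast_rayleighQuotients`). -/

/-! ### Weak derivatives, and the fundamental theorem of calculus on segments and slices. -/

section WeakDeriv

set_option linter.unusedSectionVars false

variable {E : Type*} [NormedAddCommGroup E] [NormedSpace ℝ E] [MeasureSpace E]
  [BorelSpace E] [FiniteDimensional ℝ E] [(volume : Measure E).IsAddHaarMeasure]

theorem HasWeakDeriv.congr_ae {U : Set E} {v : E} {u g u' g' : E → ℝ} (h : HasWeakDeriv U v u g)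
    (hu : u =ᵐ[volume.restrict U] u') (hg : g =ᵐ[volume.restrict U] g') :
    HasWeakDeriv U v u' g' where
  locInt := h.locInt.congr hu
  locInt_deriv := h.locInt_deriv.congr hg
  integral_eq φ h1 h2 h3 := by
    have e1 : ∫ x in U, u' x * fderiv ℝ φ x v = ∫ x in U, u x * fderiv ℝ φ x v := by
      apply integral_congr_ae
      filter_upwards [hu] with x hx
      rw [hx]
    have e2 : ∫ x in U, g' x * φ x = ∫ x in U, g x * φ x := by
      apply integral_congr_ae
      filter_upwards [hg] with x hx
      rw [hx]
    rw [e1, e2]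
    exact h.integral_eq φ h1 h2 h3

theorem HasWeakDeriv.smul_dir {U : Set E} {v : E} {u g : E → ℝ} (h : HasWeakDeriv U v u g)
    (c : ℝ) : HasWeakDeriv U (c • v) u (fun x => c * g x) where
  locInt := h.locInt
  locInt_deriv := h.locInt_deriv.smul c
  integral_eq φ h1 h2 h3 := by
    have := h.integral_eq φ h1 h2 h3
    simp only [map_smul, smul_eq_mul]
    have e1 : ∀ x, u x * (c * fderiv ℝ φ x v) = c * (u x * fderiv ℝ φ x v) := fun x => by ring
    have e2 : ∀ x, c * g x * φ x = c * (g x * φ x) := fun x => by ring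
    simp only [e1, e2, integral_const_mul, this]
    ring

/-- Fundamental lemma of the calculus of variations. It is what transfers the symmetry of a function
to its weak gradient. -/
theorem HasWeakDeriv.unique {U : Set E} (hU : IsOpen U) {v : E} {u g g' : E → ℝ}
    (h : HasWeakDeriv U v u g) (h' : HasWeakDeriv U v u g') : g =ᵐ[volume.restrict U] g' := by
  have key := hU.ae_eq_zero_of_integral_contDiff_smul_eq_zero (μ := volume)
    (h.locInt_deriv.sub h'.locInt_deriv) (by
      intro φ h1 h2 h3
      have i1 := h.integral_eq φ h1 h2 h3
      have i2 := h'.integral_eq φ h1 h2 h3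
      have hs : ∀ x, x ∉ U → φ x = 0 := fun x hx =>
        image_eq_zero_of_notMem_tsupport fun h => hx (h3 h)
      have e : ∫ x, φ x • ((g - g') x) = ∫ x in U, φ x • ((g - g') x) := by
        rw [setIntegral_eq_integral_of_forall_compl_eq_zero]
        intro x hx
        simp [hs x hx]
      have hint : ∀ k : E → ℝ, LocallyIntegrableOn k U volume →
          IntegrableOn (fun x => k x * φ x) U volume := by
        intro k hk
        have hK : IntegrableOn k (tsupport φ) volume :=
          hk.integrableOn_compact_subset h3 h2
        have : IntegrableOn (fun x => k x * φ x) (tsupport φ) volume :=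
          hK.mul_continuousOn h1.continuous.continuousOn h2
        have := this.integrable_of_forall_notMem_eq_zero (f := fun x => k x * φ x) (by
          intro x hx
          simp [image_eq_zero_of_notMem_tsupport hx])
        exact this.integrableOn
      rw [e]
      have : ∀ x, φ x • ((g - g') x) = g x * φ x - g' x * φ x := fun x => by
        simp only [Pi.sub_apply, smul_eq_mul]; ring
      simp only [this]
      rw [integral_sub (hint g h.locInt_deriv) (hint g' h'.locInt_deriv)]
      linarith)
  rw [Filter.EventuallyEq, ae_restrict_iff' hU.measurableSet]
  filter_upwards [key] with x hx hxU
  have := hx hxU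
  simp only [Pi.sub_apply] at this
  linarith

theorem locallyIntegrableOn_comp_continuousLinearEquiv {F : Type*} [NormedAddCommGroup F]
    [NormedSpace ℝ F] [MeasureSpace F] [BorelSpace F] [FiniteDimensional ℝ F]
    {U : Set F} (hU : IsOpen U) (L : E ≃L[ℝ] F) (hL : MeasurePreserving L volume volume)
    {u : F → ℝ} (hu : LocallyIntegrableOn u U volume) :
    LocallyIntegrableOn (u ∘ L) (L ⁻¹' U) volume := by
  have hme : MeasurableEmbedding L := L.toHomeomorph.measurableEmbedding
  have : ProperSpace E := FiniteDimensional.proper ℝ E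
  rw [locallyIntegrableOn_iff (hU.preimage L.continuous).isLocallyClosed]
  intro K hKU hK
  have h1 : IntegrableOn u (L '' K) volume :=
    hu.integrableOn_compact_subset (by simpa using hKU) (hK.image L.continuous)
  have h2 := (hL.integrableOn_comp_preimage hme (s := L '' K)).2 h1
  rwa [preimage_image_eq _ L.injective] at h2

theorem HasWeakDeriv.comp_continuousLinearEquiv {F : Type*} [NormedAddCommGroup F]
    [NormedSpace ℝ F] [MeasureSpace F] [BorelSpace F] [FiniteDimensional ℝ F]
    {U : Set F} (hU : IsOpen U) {v : F} {u g : F → ℝ} (h : HasWeakDeriv U v u g)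
    (L : E ≃L[ℝ] F) (hL : MeasurePreserving L volume volume) :
    HasWeakDeriv (L ⁻¹' U) (L.symm v) (u ∘ L) (g ∘ L) where
  locInt := locallyIntegrableOn_comp_continuousLinearEquiv hU L hL h.locInt
  locInt_deriv := locallyIntegrableOn_comp_continuousLinearEquiv hU L hL h.locInt_deriv
  integral_eq φ h1 h2 h3 := by
    have hme : MeasurableEmbedding L := L.toHomeomorph.measurableEmbedding
    have c1 : ContDiff ℝ ∞ (φ ∘ L.symm) := h1.comp L.symm.contDiff
    have c2 : HasCompactSupport (φ ∘ L.symm) := h2.comp_homeomorph L.symm.toHomeomorph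
    have c3 : tsupport (φ ∘ L.symm) ⊆ U := by
      have := tsupport_comp_eq_preimage φ L.symm.toHomeomorph
      change tsupport (φ ∘ L.symm) = L.symm ⁻¹' tsupport φ at this
      rw [this]
      intro y hy
      simpa using h3 hy
    have key := h.integral_eq _ c1 c2 c3
    rw [← hL.setIntegral_preimage_emb hme, ← hL.setIntegral_preimage_emb hme] at key
    have hd : ∀ x, fderiv ℝ (φ ∘ L.symm) (L x) v = fderiv ℝ φ x (L.symm v) := by
      intro x
      rw [L.symm.comp_right_fderiv]
      simp
    simpa only [hd, Function.comp_apply, L.symm_apply_apply] using key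

/-- The shear (t, q) ↦ (t, q + t v) preserves the product measure. -/
theorem integrable_comp_add_smul {g : E → ℝ} (hg : Integrable g volume) (v : E) :
    Integrable (fun p : ℝ × E => g (p.2 + p.1 • v))
      ((volume.restrict (Ioc (0 : ℝ) 1)).prod volume) := by
  have hmp : MeasurePreserving (fun p : ℝ × E => (p.1, p.2 + p.1 • v))
      ((volume.restrict (Ioc (0 : ℝ) 1)).prod volume)
      ((volume.restrict (Ioc (0 : ℝ) 1)).prod volume) := by
    refine (MeasurePreserving.id _).skew_product (g := fun (t : ℝ) (q : E) => q + t • v) ?_ ?_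
    · exact (by fun_prop : Continuous fun p : ℝ × E => p.2 + p.1 • v).measurable
    · exact Eventually.of_forall fun t => map_add_right_eq_self _ _
  have h2 : Integrable (fun p : ℝ × E => g p.2)
      ((volume.restrict (Ioc (0 : ℝ) 1)).prod volume) := hg.comp_snd _
  exact hmp.integrable_comp_of_integrable h2

/-- Duality: tested against φ, both sides agree after the translations are moved onto φ, because
φ(q) - φ(q - v) is the integral over t of the v-derivative of φ at q - t v. The hypothesis is the
weak equation for all translates φ(· - t v). -/
theorem ae_sub_eq_integral_of_integrable {B : Set E} (hB : IsOpen B) {v : E} {u g : E → ℝ}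
    (hu : Integrable u volume) (hg : Integrable g volume)
    (h : ∀ φ : E → ℝ, ContDiff ℝ ∞ φ → HasCompactSupport φ → tsupport φ ⊆ B →
      ∀ t ∈ Ioc (0 : ℝ) 1,
        ∫ x, u x * fderiv ℝ φ (x - t • v) v = - ∫ x, g x * φ (x - t • v)) :
    ∀ᵐ q, q ∈ B → u (q + v) - u q = ∫ t in Ioc (0 : ℝ) 1, g (q + t • v) := by
  have hgi := integrable_comp_add_smul hg v
  have huv : Integrable (fun q => u (q + v)) volume := hu.comp_add_right v
  have hG : Integrable (fun q => ∫ t in Ioc (0 : ℝ) 1, g (q + t • v)) volume :=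
    hgi.integral_prod_right
  have key := hB.ae_eq_zero_of_integral_contDiff_smul_eq_zero (μ := volume)
    (f := fun q => u (q + v) - u q - ∫ t in Ioc (0 : ℝ) 1, g (q + t • v))
    (((huv.sub hu).sub hG).locallyIntegrable.locallyIntegrableOn B) (by
      intro φ h1 h2 h3
      obtain ⟨C, hC⟩ := h2.exists_bound_of_continuous h1.continuous
      have hφ : ∀ f : E → ℝ, Integrable f volume → Integrable (fun q => φ q * f q) volume :=
        fun f hf => hf.bdd_mul h1.continuous.aestronglyMeasurable (Eventually.of_forall hC)
      have hφ1 := hφ _ huv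
      have hφ2 := hφ _ hu
      have hφ3 := hφ _ hG
      have e1 : ∫ q, φ q * u (q + v) = ∫ q, φ (q - v) * u q := by
        rw [← integral_sub_right_eq_self (fun q => φ q * u (q + v)) v]
        simp
      have h2' : HasCompactSupport (fderiv ℝ φ) := h2.fderiv (𝕜 := ℝ)
      have hc' : Continuous (fderiv ℝ φ) := h1.continuous_fderiv (by simp)
      obtain ⟨D, hD⟩ := h2'.exists_bound_of_continuous hc'
      have e3 : ∫ q, φ q * ∫ t in Ioc (0 : ℝ) 1, g (q + t • v)
          = - ∫ q, u q * (φ q - φ (q - v)) := by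
        have i1 : Integrable (fun p : ℝ × E => φ p.2 * g (p.2 + p.1 • v))
            ((volume.restrict (Ioc (0 : ℝ) 1)).prod volume) :=
          hgi.bdd_mul (h1.continuous.comp continuous_snd).aestronglyMeasurable
            (Eventually.of_forall fun p => hC p.2)
        have i2 : Integrable (fun p : ℝ × E => u p.2 * fderiv ℝ φ (p.2 - p.1 • v) v)
            ((volume.restrict (Ioc (0 : ℝ) 1)).prod volume) := by
          refine Integrable.mul_bdd (c := D * ‖v‖) (hu.comp_snd _) ?_ ?_
          · have : Continuous fun p : ℝ × E => fderiv ℝ φ (p.2 - p.1 • v) v :=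
              (hc'.comp (by fun_prop)).clm_apply continuous_const
            exact this.aestronglyMeasurable
          · refine Eventually.of_forall fun p => ?_
            exact (ContinuousLinearMap.le_opNorm _ _).trans
              (mul_le_mul_of_nonneg_right (hD _) (norm_nonneg _))
        calc ∫ q, φ q * ∫ t in Ioc (0 : ℝ) 1, g (q + t • v)
            = ∫ q, ∫ t in Ioc (0 : ℝ) 1, φ q * g (q + t • v) := by
              simp only [integral_const_mul]
          _ = ∫ t in Ioc (0 : ℝ) 1, ∫ q, φ q * g (q + t • v) :=
              integral_integral_swap i1.swap
          _ = ∫ t in Ioc (0 : ℝ) 1, - ∫ q, u q * fderiv ℝ φ (q - t • v) v := by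
              refine setIntegral_congr_fun measurableSet_Ioc fun t ht => ?_
              rw [h φ h1 h2 h3 t ht, neg_neg,
                ← integral_sub_right_eq_self (fun q => φ q * g (q + t • v)) (t • v)]
              simp [mul_comm]
          _ = - ∫ q, ∫ t in Ioc (0 : ℝ) 1, u q * fderiv ℝ φ (q - t • v) v := by
              rw [integral_neg, integral_integral_swap i2]
          _ = - ∫ q, u q * (φ q - φ (q - v)) := by
              congr 1
              refine integral_congr_ae (Eventually.of_forall fun q => ?_)
              simp only
              rw [integral_const_mul, ← intervalIntegral.integral_of_le zero_le_one]
              congr 1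
              have hder : ∀ t : ℝ, HasDerivAt (fun t : ℝ => φ (q - t • v))
                  (fderiv ℝ φ (q - t • v) (-v)) t := by
                intro t
                have hd : HasDerivAt (fun t : ℝ => q - t • v) (-v) t := by
                  simpa using ((hasDerivAt_id t).smul_const v).const_sub q
                exact ((h1.differentiable (by simp)) _).hasFDerivAt.comp_hasDerivAt t hd
              have := intervalIntegral.integral_eq_sub_of_hasDerivAt
                (f := fun t : ℝ => φ (q - t • v)) (a := 0) (b := 1)
                (fun t _ => hder t) (by
                  refine Continuous.intervalIntegrable ?_ _ _
                  exact (hc'.comp (by fun_prop)).clm_apply continuous_const)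
              simp only [map_neg, intervalIntegral.integral_neg, one_smul, zero_smul,
                sub_zero] at this
              linarith
      have e4 : ∫ q, u q * (φ q - φ (q - v)) = (∫ q, φ q * u q) - ∫ q, φ (q - v) * u q := by
        have hφs : Integrable (fun q => φ (q - v) * u q) volume :=
          hu.bdd_mul (h1.continuous.comp (by fun_prop)).aestronglyMeasurable
            (Eventually.of_forall fun q => hC (q - v))
        rw [← integral_sub hφ2 hφs]
        congr 1; ext q; ring
      calc ∫ q, φ q • (u (q + v) - u q - ∫ t in Ioc (0 : ℝ) 1, g (q + t • v))
          = ∫ q, (φ q * u (q + v) - φ q * u q) - φ q * ∫ t in Ioc (0 : ℝ) 1, g (q + t • v) := by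
            congr 1; ext q; rw [smul_eq_mul]; ring
        _ = 0 := by
            have hφ12 : Integrable (fun q => φ q * u (q + v) - φ q * u q) volume := hφ1.sub hφ2
            rw [integral_sub hφ12 hφ3, integral_sub hφ1 hφ2, e1, e3, e4]
            ring)
  filter_upwards [key] with q hq hqB
  linarith [hq hqB]

/-- A function with a weak derivative in direction `v` satisfies the fundamental theorem of
calculus along almost every segment `[q, q + v]`. -/
theorem HasWeakDeriv.ae_sub_eq_integral {U V : Set E} {v : E}
    {u g : E → ℝ} (h : HasWeakDeriv U v u g) (hV : IsOpen V)
    (hVU : ∀ q ∈ V, ∀ t ∈ Icc (0 : ℝ) 1, q + t • v ∈ U) :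
    ∀ᵐ q, q ∈ V → u (q + v) - u q = ∫ t in Ioc (0 : ℝ) 1, g (q + t • v) := by
  have : ProperSpace E := FiniteDimensional.proper ℝ E
  rw [ae_iff]
  apply measure_null_of_locally_null
  intro q0 hq0
  simp only [Classical.not_imp, mem_ofPred_eq] at hq0
  obtain ⟨r, hr, hrV⟩ := Metric.nhds_basis_closedBall.mem_iff.1 (hV.mem_nhds hq0.1)
  refine ⟨_, inter_mem_nhdsWithin _ (Metric.ball_mem_nhds q0 hr), ?_⟩
  -- `K` is swept out by the segments that start in a small closed ball. Cutting `u` and `g` off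
  -- outside `K` makes them integrable on the whole space and changes nothing along these segments.
  set K : Set E := (fun p : ℝ × E => p.2 + p.1 • v) '' (Icc (0 : ℝ) 1 ×ˢ Metric.closedBall q0 r)
    with hKdef
  have hK : IsCompact K :=
    (isCompact_Icc.prod (isCompact_closedBall q0 r)).image (by fun_prop)
  have hKU : K ⊆ U := by
    rintro _ ⟨⟨t, q⟩, ⟨ht, hq⟩, rfl⟩
    exact hVU q (hrV hq) t ht
  have hmem : ∀ q ∈ Metric.closedBall q0 r, ∀ t ∈ Icc (0 : ℝ) 1, q + t • v ∈ K :=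
    fun q hq t ht => ⟨(t, q), ⟨ht, hq⟩, rfl⟩
  have hu : Integrable (K.indicator u) volume :=
    (integrable_indicator_iff hK.measurableSet).2 (h.locInt.integrableOn_compact_subset hKU hK)
  have hg : Integrable (K.indicator g) volume :=
    (integrable_indicator_iff hK.measurableSet).2
      (h.locInt_deriv.integrableOn_compact_subset hKU hK)
  have main := ae_sub_eq_integral_of_integrable (v := v) Metric.isOpen_ball hu hg (B := Metric.ball q0 r) (by
    intro φ h1 h2 h3 t ht
    have ht' : t ∈ Icc (0 : ℝ) 1 := Ioc_subset_Icc_self ht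
    have c1 : ContDiff ℝ ∞ (fun x => φ (x - t • v)) := h1.comp (by fun_prop)
    have c2 : HasCompactSupport (fun x => φ (x - t • v)) :=
      h2.comp_homeomorph (Homeomorph.subRight (t • v))
    have hts : tsupport (fun x => φ (x - t • v)) = (fun x => x - t • v) ⁻¹' tsupport φ :=
      tsupport_comp_eq_preimage φ (Homeomorph.subRight (t • v))
    have c3K : tsupport (fun x => φ (x - t • v)) ⊆ K := by
      rw [hts]
      intro x hx
      have := hmem _ (Metric.ball_subset_closedBall (h3 hx)) t ht'
      simpa using this
    have key := h.integral_eq _ c1 c2 (c3K.trans hKU)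
    have hfd : ∀ x, fderiv ℝ (fun x => φ (x - t • v)) x = fderiv ℝ φ (x - t • v) :=
      fun x => fderiv_comp_sub (t • v)
    simp only [hfd] at key
    have z1 : ∀ x, x ∉ K → φ (x - t • v) = 0 := fun x hx =>
      image_eq_zero_of_notMem_tsupport (f := fun x => φ (x - t • v)) fun h => hx (c3K h)
    have z2 : ∀ x, x ∉ K → fderiv ℝ φ (x - t • v) = 0 := by
      intro x hx
      rw [← hfd x]
      exact image_eq_zero_of_notMem_tsupport fun h => hx (c3K (tsupport_fderiv_subset ℝ h))
    rw [setIntegral_eq_integral_of_forall_compl_eq_zero (fun x hx => by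
        rw [z2 x fun h => hx (hKU h)]; simp),
      setIntegral_eq_integral_of_forall_compl_eq_zero (fun x hx => by
        rw [z1 x fun h => hx (hKU h)]; simp)] at key
    have e1 : ∀ x, K.indicator u x * fderiv ℝ φ (x - t • v) v = u x * fderiv ℝ φ (x - t • v) v := by
      intro x
      by_cases hx : x ∈ K
      · simp [hx]
      · simp [hx, z2 x hx]
    have e2 : ∀ x, K.indicator g x * φ (x - t • v) = g x * φ (x - t • v) := by
      intro x
      by_cases hx : x ∈ K
      · simp [hx]
      · simp [hx, z1 x hx]
    simpa only [e1, e2] using key)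
  rw [ae_iff] at main
  refine measure_mono_null ?_ main
  rintro q ⟨hq1, hq2⟩
  simp only [Classical.not_imp, mem_ofPred_eq] at hq1 ⊢
  refine ⟨hq2, fun heq => hq1.2 ?_⟩
  have hqc := Metric.ball_subset_closedBall hq2
  have k1 : q + v ∈ K := by simpa using hmem q hqc 1 (by simp)
  have k0 : q ∈ K := by simpa using hmem q hqc 0 (by simp)
  rw [indicator_of_mem k1, indicator_of_mem k0] at heq
  rw [heq]
  refine setIntegral_congr_fun measurableSet_Ioc fun t ht => ?_
  exact indicator_of_mem (hmem q hqc t (Ioc_subset_Icc_self ht)) g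

end WeakDeriv

/-- A function on the plane with a weak `x`-derivative satisfies the fundamental theorem of
calculus on almost every horizontal slice. -/
theorem HasWeakDeriv.ae_slice {U : Set (ℝ × ℝ)} (hU : IsOpen U)
    (hc : ∀ y, OrdConnected {x | (x, y) ∈ U}) {u g : ℝ × ℝ → ℝ} (hum : Measurable u)
    (hgm : Measurable g) (h : HasWeakDeriv U ((1, 0) : ℝ × ℝ) u g) :
    ∀ᵐ y : ℝ, ∀ᵐ x₁ : ℝ, (x₁, y) ∈ U → ∀ᵐ x₂ : ℝ, (x₂, y) ∈ U →
      u (x₂, y) - u (x₁, y) = ∫ t in x₁..x₂, g (t, y) := by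
  have hint : ∀ s x y : ℝ, ∫ t in Ioc (0 : ℝ) 1, s * g (x + s * t, y)
      = ∫ t in x..(x + s), g (t, y) := by
    intro s x y
    rw [← intervalIntegral.integral_of_le zero_le_one, intervalIntegral.integral_const_mul,
      intervalIntegral.mul_integral_comp_add_mul (f := fun t => g (t, y))]
    simp
  -- For a fixed increment s the exceptional set of q may depend on s. Fubini exchanges the two
  -- quantifiers, after which s = x₂ - x₁ varies over almost all increments; this is why joint
  -- measurability is needed.
  have step1 : ∀ s : ℝ, ∀ᵐ q : ℝ × ℝ, q ∈ U → (q.1 + s, q.2) ∈ U →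
      u (q.1 + s, q.2) - u q = ∫ t in Ioc (0 : ℝ) 1, s * g (q.1 + s * t, q.2) := by
    intro s
    have hV : IsOpen (U ∩ (fun q : ℝ × ℝ => (q.1 + s, q.2)) ⁻¹' U) :=
      hU.inter (hU.preimage (by fun_prop))
    have key := (h.smul_dir s).ae_sub_eq_integral hV (by
      rintro ⟨x, y⟩ ⟨hq1, hq2⟩ t ht
      have hx1 : x ∈ {x | (x, y) ∈ U} := hq1
      have hx2 : x + s ∈ {x | (x, y) ∈ U} := hq2
      have hm : x + t * s ∈ {x | (x, y) ∈ U} := by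
        refine (hc y).uIcc_subset hx1 hx2 ?_
        rw [mem_uIcc]
        rcases le_total 0 s with hs | hs
        · left; constructor <;> nlinarith [ht.1, ht.2]
        · right; constructor <;> nlinarith [ht.1, ht.2]
      simpa using hm)
    filter_upwards [key] with q hq h1 h2
    have := hq ⟨h1, h2⟩
    have e0 : q + s • ((1, 0) : ℝ × ℝ) = (q.1 + s, q.2) := by ext <;> simp
    have e1 : ∀ t : ℝ, q + t • s • ((1, 0) : ℝ × ℝ) = (q.1 + s * t, q.2) := by
      intro t; ext <;> simp [mul_comm]
    simpa only [e0, e1] using this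
  have hgp : Measurable fun p : (ℝ × ℝ × ℝ) × ℝ => p.1.1 * g (p.1.2.1 + p.1.1 * p.2, p.1.2.2) :=
    Measurable.mul (by fun_prop) (hgm.comp (by fun_prop))
  have hmI : Measurable fun p : ℝ × ℝ × ℝ =>
      ∫ t in Ioc (0 : ℝ) 1, p.1 * g (p.2.1 + p.1 * t, p.2.2) :=
    (hgp.stronglyMeasurable.integral_prod_right' (ν := volume.restrict (Ioc (0 : ℝ) 1))).measurable
  have hB : MeasurableSet {p : ℝ × ℝ × ℝ | p.2 ∈ U → (p.2.1 + p.1, p.2.2) ∈ U →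
      u (p.2.1 + p.1, p.2.2) - u p.2 = ∫ t in Ioc (0 : ℝ) 1, p.1 * g (p.2.1 + p.1 * t, p.2.2)} := by
    refine MeasurableSet.imp (hU.measurableSet.preimage measurable_snd)
      (MeasurableSet.imp (hU.measurableSet.preimage (by fun_prop)) (measurableSet_eq_fun ?_ hmI))
    exact (hum.comp (by fun_prop)).sub (hum.comp measurable_snd)
  have step2 := (Measure.ae_ae_comm (μ := (volume : Measure ℝ)) (ν := (volume : Measure (ℝ × ℝ)))
    (p := fun s q => q ∈ U → (q.1 + s, q.2) ∈ U →
      u (q.1 + s, q.2) - u q = ∫ t in Ioc (0 : ℝ) 1, s * g (q.1 + s * t, q.2)) hB).1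
    (Eventually.of_forall step1)
  have step3 : ∀ᵐ q : ℝ × ℝ, q.swap.swap ∈ U → ∀ᵐ s : ℝ, (q.1 + s, q.2) ∈ U →
      u (q.1 + s, q.2) - u q = ∫ t in Ioc (0 : ℝ) 1, s * g (q.1 + s * t, q.2) := by
    filter_upwards [step2] with q hq hqU
    filter_upwards [hq] with s hs
    exact hs hqU
  have step4 := Measure.ae_ae_of_ae_prod
    ((Measure.measurePreserving_swap (μ := (volume : Measure ℝ))
      (ν := (volume : Measure ℝ))).quasiMeasurePreserving.ae step3)
  filter_upwards [step4] with y hy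
  filter_upwards [hy] with x₁ hx₁ hU₁
  have h1 := hx₁ hU₁
  have h2 := (measurePreserving_sub_right (volume : Measure ℝ) x₁).quasiMeasurePreserving.ae h1
  filter_upwards [h2] with x₂ hx₂ hU₂
  simp only [Prod.fst_swap, Prod.snd_swap, hint] at hx₂
  simpa using hx₂ (by simpa using hU₂)

/-- On almost every horizontal slice, a function with weak `x`-derivative `g` agrees with a
primitive of `g`. -/
theorem HasWeakDeriv.ae_slice_eq_primitive {U : Set (ℝ × ℝ)} (hU : IsOpen U)
    (hc : ∀ y, OrdConnected {x | (x, y) ∈ U}) {u g : ℝ × ℝ → ℝ} (hum : Measurable u)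
    (hgm : Measurable g) (h : HasWeakDeriv U ((1, 0) : ℝ × ℝ) u g) :
    ∀ᵐ y : ℝ, {x | (x, y) ∈ U}.Nonempty → ∃ x₀, (x₀, y) ∈ U ∧ ∃ k : ℝ, ∀ᵐ x : ℝ, (x, y) ∈ U →
      u (x, y) = k + ∫ t in x₀..x, g (t, y) := by
  filter_upwards [h.ae_slice hU hc hum hgm] with y hy hne
  have hopen : IsOpen {x : ℝ | (x, y) ∈ U} := hU.preimage (by fun_prop)
  have hpos : volume {x : ℝ | (x, y) ∈ U} ≠ 0 := (hopen.measure_pos volume hne).ne'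
  -- A nonempty open slice has positive measure, so it contains a good base point.
  obtain ⟨x₀, hx₀, hP⟩ : ∃ x₀, (x₀, y) ∈ U ∧ ∀ᵐ x₂ : ℝ, (x₂, y) ∈ U →
      u (x₂, y) - u (x₀, y) = ∫ t in x₀..x₂, g (t, y) := by
    by_contra hcon
    apply hpos
    rw [ae_iff] at hy
    refine measure_mono_null (fun x hx => ?_) hy
    simp only [mem_ofPred_eq, Classical.not_imp]
    exact ⟨hx, fun h => hcon ⟨x, hx, h⟩⟩
  refine ⟨x₀, hx₀, u (x₀, y), ?_⟩
  filter_upwards [hP] with x hx hxU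
  linarith [hx hxU]

/-! ### Gaussian densities and comparison with Lebesgue measure. -/

section Gaussian

/-- The density of the standard Gaussian measure on the line. -/
noncomputable def gaussDensity (x : ℝ) : ℝ := gaussianPDFReal 0 1 x

/-- The density of the standard Gaussian measure on the plane. -/
noncomputable def gaussDensity2 (q : ℝ × ℝ) : ℝ := gaussDensity q.1 * gaussDensity q.2

theorem gaussDensity_eq (x : ℝ) :
    gaussDensity x = (√(2 * Real.pi))⁻¹ * Real.exp (-x ^ 2 / 2) := by
  simp [gaussDensity, gaussianPDFReal]

theorem gaussDensity_pos (x : ℝ) : 0 < gaussDensity x :=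
  gaussianPDFReal_pos 0 1 x one_ne_zero

theorem hasDerivAt_gaussDensity (x : ℝ) : HasDerivAt gaussDensity (-x * gaussDensity x) x := by
  have h1 : HasDerivAt (fun x : ℝ => -x ^ 2 / 2) (-x) x := by
    have := ((hasDerivAt_pow 2 x).neg).div_const 2
    convert! this using 1
    simp only [Nat.cast_ofNat, Nat.add_one_sub_one, pow_one]
    ring
  have h2 := (h1.exp).const_mul (√(2 * Real.pi))⁻¹
  have e : gaussDensity = fun x => (√(2 * Real.pi))⁻¹ * Real.exp (-x ^ 2 / 2) :=
    funext gaussDensity_eq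
  rw [e]
  convert! h2 using 1
  simp only
  ring

theorem continuous_gaussDensity : Continuous gaussDensity :=
  continuous_iff_continuousAt.2 fun x => (hasDerivAt_gaussDensity x).continuousAt

theorem gaussDensity_le_of_abs_le {x t : ℝ} (h : |t| ≤ |x|) : gaussDensity x ≤ gaussDensity t := by
  rw [gaussDensity_eq, gaussDensity_eq]
  have := sq_le_sq.2 h
  gcongr

theorem gaussDensity_le_one (x : ℝ) : gaussDensity x ≤ 1 := by
  rw [gaussDensity_eq]
  have h1 : (√(2 * Real.pi))⁻¹ ≤ 1 := by
    apply inv_le_one_of_one_le₀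
    rw [Real.one_le_sqrt]
    nlinarith [Real.pi_gt_three]
  have h2 : Real.exp (-x ^ 2 / 2) ≤ 1 := by
    rw [Real.exp_le_one_iff]
    nlinarith [sq_nonneg x]
  exact mul_le_one₀ h1 (Real.exp_nonneg _) h2

theorem gaussDensity2_pos (q : ℝ × ℝ) : 0 < gaussDensity2 q :=
  mul_pos (gaussDensity_pos _) (gaussDensity_pos _)

theorem continuous_gaussDensity2 : Continuous gaussDensity2 :=
  (continuous_gaussDensity.comp continuous_fst).mul (continuous_gaussDensity.comp continuous_snd)

theorem gaussDensity2_le_one (q : ℝ × ℝ) : gaussDensity2 q ≤ 1 :=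
  mul_le_one₀ (gaussDensity_le_one _) (gaussDensity_pos _).le (gaussDensity_le_one _)

theorem gauss1_eq_withDensity :
    gauss1 = volume.withDensity fun x => ENNReal.ofReal (gaussDensity x) :=
  gaussianReal_of_var_ne_zero 0 one_ne_zero

instance : IsProbabilityMeasure gauss1 := by unfold gauss1; infer_instance

instance : IsProbabilityMeasure gauss2 := by unfold gauss2; infer_instance

theorem gauss2_eq_withDensity :
    gauss2 = volume.withDensity fun q => ENNReal.ofReal (gaussDensity2 q) := by
  have hm : Measurable fun x => ENNReal.ofReal (gaussDensity x) :=
    continuous_gaussDensity.measurable.ennreal_ofReal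
  have hs : SFinite (volume.withDensity fun x => ENNReal.ofReal (gaussDensity x)) := by
    rw [← gauss1_eq_withDensity]; infer_instance
  rw [gauss2, gauss1_eq_withDensity, prod_withDensity hm hm]
  congr 1
  ext q
  rw [gaussDensity2, ENNReal.ofReal_mul (gaussDensity_pos _).le]

theorem gauss1_absolutelyContinuous : gauss1 ≪ volume :=
  gaussianReal_absolutelyContinuous 0 one_ne_zero

theorem volume_absolutelyContinuous_gauss1 : volume ≪ gauss1 :=
  gaussianReal_absolutelyContinuous' 0 one_ne_zero

theorem gauss2_absolutelyContinuous : gauss2 ≪ volume :=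
  gauss1_absolutelyContinuous.prod gauss1_absolutelyContinuous

theorem volume_absolutelyContinuous_gauss2 : volume ≪ gauss2 :=
  volume_absolutelyContinuous_gauss1.prod volume_absolutelyContinuous_gauss1

theorem restrict_le_smul_withDensity {α : Type*} [MeasurableSpace α] {μ : Measure α}
    {ρ : α → ℝ} (hρ : Measurable ρ) {s : Set α} (hs : MeasurableSet s) {c : ℝ} (hc : 0 < c)
    (h : ∀ x ∈ s, c ≤ ρ x) :
    μ.restrict s ≤ ENNReal.ofReal c⁻¹ •
      (μ.withDensity fun x => ENNReal.ofReal (ρ x)).restrict s := by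
  refine Measure.le_iff.2 fun A hA => ?_
  rw [Measure.smul_apply, Measure.restrict_apply hA, Measure.restrict_apply hA,
    withDensity_apply _ (hA.inter hs), smul_eq_mul,
    ← lintegral_const_mul _ hρ.ennreal_ofReal, ← setLIntegral_one]
  refine setLIntegral_mono (by fun_prop) fun x hx => ?_
  rw [← ENNReal.ofReal_mul (by positivity), ENNReal.one_le_ofReal, inv_mul_eq_div, one_le_div hc]
  exact h x hx.2

/-- Near x the weight exceeds half of its value at x, so weighted integrability gives Lebesgue
integrability there. -/
theorem MemLp.locallyIntegrableOn_of_withDensity {E : Type*} [NormedAddCommGroup E]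
    [MeasureSpace E] [BorelSpace E] {ρ : E → ℝ} (hρ : Continuous ρ) (hpos : ∀ x, 0 < ρ x)
    [IsFiniteMeasure ((volume : Measure E).withDensity fun x => ENNReal.ofReal (ρ x))]
    {U : Set E} (hU : IsOpen U) {u : E → ℝ}
    (hu : MemLp u 2 (((volume : Measure E).withDensity
      fun x => ENNReal.ofReal (ρ x)).restrict U)) :
    LocallyIntegrableOn u U volume := by
  intro x hx
  have hopen : IsOpen {y | ρ x / 2 < ρ y} := isOpen_lt continuous_const hρ
  refine ⟨U ∩ {y | ρ x / 2 < ρ y}, inter_mem_nhdsWithin _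
    (hopen.mem_nhds (by simp [half_lt_self (hpos x)])), ?_⟩
  have hi : Integrable u (((volume : Measure E).withDensity
      fun x => ENNReal.ofReal (ρ x)).restrict U) := hu.integrable (by norm_num)
  have hi2 : IntegrableOn u (U ∩ {y | ρ x / 2 < ρ y}) ((volume : Measure E).withDensity
      fun x => ENNReal.ofReal (ρ x)) := IntegrableOn.mono_set hi inter_subset_left
  exact Integrable.of_measure_le_smul ENNReal.ofReal_ne_top
    (restrict_le_smul_withDensity hρ.measurable (hU.inter hopen).measurableSet
      (half_pos (hpos x)) fun y hy => le_of_lt hy.2) hi2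

theorem locallyIntegrableOn_of_memLp_gauss1 {U : Set ℝ} (hU : IsOpen U) {u : ℝ → ℝ}
    (hu : MemLp u 2 (gauss1.restrict U)) : LocallyIntegrableOn u U volume := by
  have : IsFiniteMeasure ((volume : Measure ℝ).withDensity
      fun x => ENNReal.ofReal (gaussDensity x)) := by
    rw [← gauss1_eq_withDensity]; infer_instance
  rw [gauss1_eq_withDensity] at hu
  exact MemLp.locallyIntegrableOn_of_withDensity continuous_gaussDensity gaussDensity_pos hU hu

theorem locallyIntegrableOn_of_memLp_gauss2 {U : Set (ℝ × ℝ)} (hU : IsOpen U) {u : ℝ × ℝ → ℝ}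
    (hu : MemLp u 2 (gauss2.restrict U)) : LocallyIntegrableOn u U volume := by
  have : IsFiniteMeasure ((volume : Measure (ℝ × ℝ)).withDensity
      fun x => ENNReal.ofReal (gaussDensity2 x)) := by
    rw [← gauss2_eq_withDensity]; infer_instance
  rw [gauss2_eq_withDensity] at hu
  exact MemLp.locallyIntegrableOn_of_withDensity continuous_gaussDensity2 gaussDensity2_pos hU hu

end Gaussian

/-! ### Cauchy–Schwarz bounds with values in `[0, ∞]`. -/

section Enorm

theorem enorm_sq_eq_ofReal (x : ℝ) : ‖x‖ₑ ^ 2 = ENNReal.ofReal (x ^ 2) := by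
  rw [Real.enorm_eq_ofReal_abs, ← ENNReal.ofReal_pow (abs_nonneg x), sq_abs]

theorem enorm_add_sq_le (a b : ℝ) : ‖a + b‖ₑ ^ 2 ≤ 2 * (‖a‖ₑ ^ 2 + ‖b‖ₑ ^ 2) := by
  simp only [enorm_sq_eq_ofReal]
  rw [← ENNReal.ofReal_add (sq_nonneg _) (sq_nonneg _),
    show (2 : ENNReal) = ENNReal.ofReal 2 by simp, ← ENNReal.ofReal_mul (by norm_num)]
  exact ENNReal.ofReal_le_ofReal (by nlinarith [sq_nonneg (a - b)])

theorem enorm_integral_sq_le {α : Type*} [MeasurableSpace α] {μ : Measure α} {h : α → ℝ}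
    (hh : AEMeasurable h μ) : ‖∫ x, h x ∂μ‖ₑ ^ 2 ≤ μ univ * ∫⁻ x, ‖h x‖ₑ ^ 2 ∂μ := by
  have h1 : ‖∫ x, h x ∂μ‖ₑ ≤ ∫⁻ x, 1 * ‖h x‖ₑ ∂μ := by
    simpa using enorm_integral_le_lintegral_enorm h
  have h2 := ENNReal.lintegral_mul_le_Lp_mul_Lq μ Real.HolderConjugate.two_two
    (f := fun _ => 1) (g := fun x => ‖h x‖ₑ) aemeasurable_const hh.enorm
  have h3 := h1.trans h2
  simp only [lintegral_const, one_pow, one_mul, ENNReal.rpow_ofNat] at h3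
  calc ‖∫ x, h x ∂μ‖ₑ ^ 2
      ≤ (μ univ ^ (1 / 2 : ℝ) * (∫⁻ x, ‖h x‖ₑ ^ 2 ∂μ) ^ (1 / 2 : ℝ)) ^ 2 := by gcongr
    _ = μ univ * ∫⁻ x, ‖h x‖ₑ ^ 2 ∂μ := by
      rw [mul_pow, ← ENNReal.rpow_natCast, ← ENNReal.rpow_natCast, ← ENNReal.rpow_mul,
        ← ENNReal.rpow_mul]
      norm_num

theorem enorm_intervalIntegral_sq_le {h : ℝ → ℝ} (hh : Measurable h) (a b : ℝ) :
    ‖∫ t in a..b, h t‖ₑ ^ 2 ≤ ENNReal.ofReal |b - a| * ∫⁻ t in uIoc a b, ‖h t‖ₑ ^ 2 := by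
  have h1 := enorm_integral_sq_le (μ := volume.restrict (uIoc a b)) hh.aemeasurable
  have h2 : ‖∫ t in a..b, h t‖ₑ = ‖∫ t in uIoc a b, h t‖ₑ := by
    rw [← ofReal_norm, ← ofReal_norm, intervalIntegral.norm_intervalIntegral_eq]
  rw [h2]
  refine h1.trans_eq ?_
  rw [Measure.restrict_apply_univ, Real.volume_uIoc]

end Enorm

/-! ### The Gaussian measure on the line and a Hardy inequality. -/

section GaussianLine

theorem setLIntegral_gauss1 {S : Set ℝ} (hS : MeasurableSet S) (F : ℝ → ENNReal) :
    ∫⁻ x in S, F x ∂gauss1 = ∫⁻ x in S, ENNReal.ofReal (gaussDensity x) * F x := by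
  rw [gauss1_eq_withDensity, setLIntegral_withDensity_eq_setLIntegral_mul_non_measurable _
    continuous_gaussDensity.measurable.ennreal_ofReal _ hS (by simp)]
  rfl

theorem setLIntegral_volume_le_gauss1 {s : Set ℝ} (hs : MeasurableSet s) {c : ℝ} (hc : 0 < c)
    (h : ∀ x ∈ s, c ≤ gaussDensity x) (F : ℝ → ENNReal) :
    ∫⁻ x in s, F x ≤ ENNReal.ofReal c⁻¹ * ∫⁻ x in s, F x ∂gauss1 := by
  rw [gauss1_eq_withDensity, ← smul_eq_mul, ← lintegral_smul_measure]
  exact lintegral_mono' (restrict_le_smul_withDensity continuous_gaussDensity.measurable hs hc h)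
    le_rfl

theorem withDensity_le_self {α : Type*} [MeasurableSpace α] {μ : Measure α}
    {ρ : α → ℝ} (h : ∀ x, ρ x ≤ 1) : μ.withDensity (fun x => ENNReal.ofReal (ρ x)) ≤ μ := by
  conv_rhs => rw [← withDensity_one (μ := μ)]
  exact withDensity_mono (Eventually.of_forall fun x => by simpa using h x)

theorem setLIntegral_gauss1_le_volume (s : Set ℝ) (F : ℝ → ENNReal) :
    ∫⁻ x in s, F x ∂gauss1 ≤ ∫⁻ x in s, F x := by
  rw [gauss1_eq_withDensity]
  exact lintegral_mono' (Measure.restrict_mono subset_rfl (withDensity_le_self gaussDensity_le_one))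
    le_rfl

theorem abs_le_max_of_mem_uIcc {a b t : ℝ} (ht : t ∈ uIcc a b) : |t| ≤ max |a| |b| := by
  rcases mem_uIcc.1 ht with h | h
  · exact abs_le_max_abs_abs h.1 h.2
  · rw [max_comm]; exact abs_le_max_abs_abs h.1 h.2

theorem memLp_uIcc_of_lintegral_gauss1 {S : Set ℝ} {h : ℝ → ℝ} (hh : Measurable h)
    (hfin : ∫⁻ x in S, ‖h x‖ₑ ^ 2 ∂gauss1 ≠ ⊤) {a b : ℝ} (hab : uIcc a b ⊆ S) :
    MemLp h 2 (volume.restrict (uIcc a b)) := by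
  refine ⟨hh.aestronglyMeasurable, ?_⟩
  rw [eLpNorm_lt_top_iff_lintegral_rpow_enorm_lt_top (by norm_num) (by norm_num)]
  simp only [ENNReal.toReal_ofNat, ENNReal.rpow_ofNat]
  refine (setLIntegral_volume_le_gauss1 measurableSet_uIcc
    (gaussDensity_pos (max |a| |b|)) (fun x hx => gaussDensity_le_of_abs_le ?_) _).trans_lt ?_
  · rw [abs_of_nonneg (le_max_of_le_left (abs_nonneg a))]
    exact abs_le_max_of_mem_uIcc hx
  · exact ENNReal.mul_lt_top ENNReal.ofReal_lt_top
      ((lintegral_mono_set hab).trans_lt (lt_top_iff_ne_top.2 hfin))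

theorem intervalIntegrable_of_memLp {h : ℝ → ℝ} {a b : ℝ}
    (hm : MemLp h 2 (volume.restrict (uIcc a b))) :
    IntervalIntegrable h volume a b ∧ IntervalIntegrable (fun x => h x ^ 2) volume a b := by
  have : IsFiniteMeasure (volume.restrict (uIcc a b)) :=
    isFiniteMeasure_restrict.2 isCompact_uIcc.measure_lt_top.ne
  have h1 : IntegrableOn h (uIcc a b) := hm.integrable (by norm_num)
  have h2 : IntegrableOn (fun x => h x ^ 2) (uIcc a b) := hm.integrable_sq
  exact ⟨h1.intervalIntegrable, h2.intervalIntegrable⟩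

/-- A Hardy type inequality for the Gaussian weight on an interval of the negative half-line. -/
theorem hardy_gauss {A P k : ℝ} (hP : 0 ≤ P) (hA : A ≤ -P) {h : ℝ → ℝ}
    (h1 : IntervalIntegrable h volume A (-P))
    (h2 : IntervalIntegrable (fun x => h x ^ 2) volume A (-P)) :
    ∫ x in A..-P, x * (x + P) * (k + ∫ t in -P..x, h t) ^ 2 * gaussDensity x
      ≤ ∫ x in A..-P, (2 * (k + ∫ t in -P..x, h t) ^ 2 + 4 * h x ^ 2) * gaussDensity x := by
  set F : ℝ → ℝ := fun x => k + ∫ t in -P..x, h t with hF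
  have hsub : Ioc A (-P) ⊆ uIcc A (-P) := by rw [uIcc_of_le hA]; exact Ioc_subset_Icc_self
  have acF : AbsolutelyContinuousOnInterval F A (-P) :=
    (contDiffOn_const (c := k)).absolutelyContinuousOnInterval.add
      (h1.absolutelyContinuousOnInterval_intervalIntegral right_mem_uIcc)
  have cF : ContinuousOn F (uIcc A (-P)) := acF.continuousOn
  have cG : ContinuousOn gaussDensity (uIcc A (-P)) := continuous_gaussDensity.continuousOn
  have hGd : ContDiff ℝ 1 gaussDensity := by
    have e : gaussDensity = fun x => (√(2 * Real.pi))⁻¹ * Real.exp (-x ^ 2 / 2) :=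
      funext gaussDensity_eq
    rw [e]; fun_prop
  -- This multiplier vanishes at -P, and its derivative is γ - x (x + P) γ; integrating (F² W)'
  -- therefore produces the left side of the inequality.
  set W : ℝ → ℝ := fun x => (x + P) * gaussDensity x with hW
  have acW : AbsolutelyContinuousOnInterval W A (-P) :=
    (((contDiff_id.add contDiff_const).mul hGd).contDiffOn).absolutelyContinuousOnInterval
  have key := (acF.fun_mul acF).integral_deriv_mul_eq_sub acW
  have hdF := h1.ae_hasDerivAt_integral
  have e1 : ∫ x in A..-P, deriv (fun x => F x * F x) x * W x + F x * F x * deriv W x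
      = ∫ x in A..-P, (2 * F x * h x * ((x + P) * gaussDensity x)
        + F x ^ 2 * gaussDensity x) - x * (x + P) * F x ^ 2 * gaussDensity x := by
    apply intervalIntegral.integral_congr_ae
    filter_upwards [hdF] with x hx hxm
    have hx' : x ∈ uIcc A (-P) := uIoc_subset_uIcc hxm
    have d1 : HasDerivAt F (h x) x := (hx hx' (-P) right_mem_uIcc).const_add k
    have d2 : HasDerivAt W (1 * gaussDensity x + (x + P) * (-x * gaussDensity x)) x :=
      ((hasDerivAt_id x).add_const P).mul (hasDerivAt_gaussDensity x)
    rw [(d1.fun_mul d1).deriv, d2.deriv]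
    simp only [hW]
    ring
  rw [e1] at key
  have c0 : ContinuousOn (fun x => x * (x + P) * F x ^ 2 * gaussDensity x) (uIcc A (-P)) := by
    fun_prop
  have i0 : IntervalIntegrable (fun x => x * (x + P) * F x ^ 2 * gaussDensity x)
      volume A (-P) := c0.intervalIntegrable
  have i1 : IntervalIntegrable (fun x => 2 * F x * h x * ((x + P) * gaussDensity x)
        + F x ^ 2 * gaussDensity x) volume A (-P) := by
    refine IntervalIntegrable.add ?_ (ContinuousOn.intervalIntegrable (by fun_prop))
    have : (fun x => 2 * F x * h x * ((x + P) * gaussDensity x))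
        = fun x => h x * (2 * F x * ((x + P) * gaussDensity x)) := by ext x; ring
    rw [this]
    exact h1.mul_continuousOn (by fun_prop)
  have i2 : IntervalIntegrable (fun x => (2 * F x ^ 2 + 4 * h x ^ 2) * gaussDensity x)
      volume A (-P) := by
    refine IntervalIntegrable.mul_continuousOn ?_ cG
    exact (ContinuousOn.intervalIntegrable (by fun_prop)).add (h2.const_mul 4)
  rw [intervalIntegral.integral_sub i1 i0] at key
  -- The boundary term has a favourable sign since W(-P) = 0 and W(A) ≤ 0; no decay of F is
  -- required.
  have hb : F (-P) * F (-P) * W (-P) - F A * F A * W A ≥ 0 := by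
    have hWP : W (-P) = 0 := by simp [hW]
    have hWA : W A ≤ 0 :=
      mul_nonpos_of_nonpos_of_nonneg (by linarith) (gaussDensity_pos A).le
    rw [hWP]
    nlinarith [mul_self_nonneg (F A)]
  -- Young's inequality 2 F h (x + P) ≤ (x + P)² F² / 2 + 2 h², combined with (x + P)² ≤ x (x + P)
  -- for x ≤ -P ≤ 0, lets half of the left side be absorbed.
  have hmono : ∫ x in A..-P, (2 * F x * h x * ((x + P) * gaussDensity x)
        + F x ^ 2 * gaussDensity x)
      ≤ ∫ x in A..-P, (1 / 2) * (x * (x + P) * F x ^ 2 * gaussDensity x)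
        + (1 / 2) * ((2 * F x ^ 2 + 4 * h x ^ 2) * gaussDensity x) := by
    refine intervalIntegral.integral_mono_on hA i1 ((i0.const_mul _).add (i2.const_mul _)) ?_
    intro x hx
    have hg := (gaussDensity_pos x).le
    have hw : x + P ≤ 0 := by linarith [hx.2]
    have h3 : (x + P) ^ 2 ≤ x * (x + P) := by nlinarith
    have h4 : 2 * F x * h x * (x + P) ≤ 1 / 2 * ((x + P) ^ 2 * F x ^ 2) + 2 * h x ^ 2 := by
      nlinarith [sq_nonneg ((x + P) * F x - 2 * h x)]
    have h5 : (x + P) ^ 2 * F x ^ 2 ≤ x * (x + P) * F x ^ 2 :=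
      mul_le_mul_of_nonneg_right h3 (sq_nonneg _)
    have h6 : 2 * F x * h x * (x + P) + F x ^ 2
      ≤ 1 / 2 * (x * (x + P) * F x ^ 2) + 1 / 2 * (2 * F x ^ 2 + 4 * h x ^ 2) := by linarith
    nlinarith [mul_le_mul_of_nonneg_right h6 hg]
  rw [intervalIntegral.integral_add (i0.const_mul _) (i2.const_mul _),
    intervalIntegral.integral_const_mul, intervalIntegral.integral_const_mul] at hmono
  linarith

end GaussianLine

/-! ### One-dimensional estimates near infinity and near end points. -/

section Tails

theorem lintegral_gauss1_eq_ofReal {A B : ℝ} (hAB : A ≤ B) {F : ℝ → ℝ} (hF0 : ∀ x, 0 ≤ F x)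
    (hF : IntervalIntegrable F volume A B) :
    ∫⁻ x in Ioc A B, ENNReal.ofReal (F x) ∂gauss1
      = ENNReal.ofReal (∫ x in A..B, F x * gaussDensity x) := by
  have hi : IntervalIntegrable (fun x => F x * gaussDensity x) volume A B :=
    hF.mul_continuousOn continuous_gaussDensity.continuousOn
  rw [intervalIntegral.integral_of_le hAB, ofReal_integral_eq_lintegral_ofReal
    ((intervalIntegrable_iff_integrableOn_Ioc_of_le hAB).1 hi)
    (Eventually.of_forall fun x => mul_nonneg (hF0 x) (gaussDensity_pos x).le),
    setLIntegral_gauss1 measurableSet_Ioc]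
  simp only [ENNReal.ofReal_mul (hF0 _), mul_comm]

/-- For x ≤ -M and 2P ≤ M the Hardy weight x (x + P) is at least M² / 2, which turns the Hardy
inequality into smallness of order M⁻² on the tail. -/
theorem setLIntegral_tail_le {S : Set ℝ} (hS : IsOpen S) (hc : OrdConnected S) {P M : ℝ}
    (hP : 0 ≤ P) (hM : 0 < M) (hPM : 2 * P ≤ M) (hPS : -P ∈ S) {f h : ℝ → ℝ} (hh : Measurable h)
    {k : ℝ} (hf : ∀ᵐ x, x ∈ S → f x = k + ∫ t in -P..x, h t) :
    ∫⁻ x in S ∩ Iic (-M), ‖f x‖ₑ ^ 2 ∂gauss1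
      ≤ ENNReal.ofReal (8 / M ^ 2) * ∫⁻ x in S, (‖f x‖ₑ ^ 2 + ‖h x‖ₑ ^ 2) ∂gauss1 := by
  -- With infinite energy the right side is ∞, its constant being positive.
  by_cases hfin : ∫⁻ x in S, ‖h x‖ₑ ^ 2 ∂gauss1 = ⊤
  · have : ∫⁻ x in S, (‖f x‖ₑ ^ 2 + ‖h x‖ₑ ^ 2) ∂gauss1 = ⊤ :=
      top_le_iff.1 (hfin ▸ lintegral_mono fun x => le_add_self)
    rw [this, ENNReal.mul_top]
    · exact le_top
    · simpa using by positivity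
  set F : ℝ → ℝ := fun x => k + ∫ t in -P..x, h t with hF
  have hf1 : ∀ᵐ x ∂gauss1, x ∈ S → f x = F x := gauss1_absolutelyContinuous.ae_le hf
  have hmS := hS.measurableSet
  have e1 : ∫⁻ x in S ∩ Iic (-M), ‖f x‖ₑ ^ 2 ∂gauss1
      = ∫⁻ x in S ∩ Iic (-M), ‖F x‖ₑ ^ 2 ∂gauss1 := by
    refine setLIntegral_congr_fun_ae (hmS.inter measurableSet_Iic) ?_
    filter_upwards [hf1] with x hx hxS
    rw [hx hxS.1]
  have e2 : ∫⁻ x in S, (‖f x‖ₑ ^ 2 + ‖h x‖ₑ ^ 2) ∂gauss1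
      = ∫⁻ x in S, (‖F x‖ₑ ^ 2 + ‖h x‖ₑ ^ 2) ∂gauss1 := by
    refine setLIntegral_congr_fun_ae hmS ?_
    filter_upwards [hf1] with x hx hxS
    rw [hx hxS]
  rw [e1, e2]
  have main : ∀ A ∈ S, A ≤ -M → ∫⁻ x in Ioc A (-M), ‖F x‖ₑ ^ 2 ∂gauss1
      ≤ ENNReal.ofReal (8 / M ^ 2) * ∫⁻ x in S, (‖F x‖ₑ ^ 2 + ‖h x‖ₑ ^ 2) ∂gauss1 := by
    intro A hA hAM
    have hAP : A ≤ -P := by linarith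
    have hMP : -M ≤ -P := by linarith
    have hsub : uIcc A (-P) ⊆ S := hc.uIcc_subset hA hPS
    obtain ⟨i1, i2⟩ := intervalIntegrable_of_memLp (memLp_uIcc_of_lintegral_gauss1 hh hfin hsub)
    have cF : ContinuousOn F (uIcc A (-P)) :=
      continuousOn_const.add (intervalIntegral.continuousOn_primitive_interval' i1 right_mem_uIcc)
    have iF : IntervalIntegrable (fun x => F x ^ 2) volume A (-P) :=
      ContinuousOn.intervalIntegrable (by fun_prop)
    have hsub2 : uIcc A (-M) ⊆ uIcc A (-P) := by
      rw [uIcc_of_le hAM, uIcc_of_le hAP]; exact Icc_subset_Icc_right hMP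
    have iF' := iF.mono_set hsub2
    have cG := continuous_gaussDensity
    have i3 : IntervalIntegrable (fun x => F x ^ 2 + h x ^ 2) volume A (-P) := iF.add i2
    have hH := hardy_gauss (k := k) hP hAP i1 i2
    have hlow : M ^ 2 / 2 * ∫ x in A..-M, F x ^ 2 * gaussDensity x
        ≤ ∫ x in A..-P, x * (x + P) * F x ^ 2 * gaussDensity x := by
      have j1 : IntervalIntegrable (fun x => x * (x + P) * F x ^ 2 * gaussDensity x)
          volume A (-P) := ContinuousOn.intervalIntegrable (by fun_prop)
      have j2 : IntervalIntegrable (fun x => F x ^ 2 * gaussDensity x) volume A (-M) :=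
        iF'.mul_continuousOn cG.continuousOn
      calc M ^ 2 / 2 * ∫ x in A..-M, F x ^ 2 * gaussDensity x
          = ∫ x in A..-M, M ^ 2 / 2 * (F x ^ 2 * gaussDensity x) := by
            rw [intervalIntegral.integral_const_mul]
        _ ≤ ∫ x in A..-M, x * (x + P) * F x ^ 2 * gaussDensity x := by
            refine intervalIntegral.integral_mono_on hAM (j2.const_mul _) (j1.mono_set hsub2) ?_
            intro x hx
            have hxM := hx.2
            have : M ^ 2 / 2 ≤ x * (x + P) := by nlinarith
            have h0 : 0 ≤ F x ^ 2 * gaussDensity x :=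
              mul_nonneg (sq_nonneg _) (gaussDensity_pos x).le
            nlinarith [mul_le_mul_of_nonneg_right this h0]
        _ ≤ ∫ x in A..-P, x * (x + P) * F x ^ 2 * gaussDensity x := by
            refine intervalIntegral.integral_mono_interval le_rfl hAM hMP ?_ j1
            refine (ae_restrict_iff' measurableSet_Ioc).2 (Eventually.of_forall fun x hx => ?_)
            have hx2 := hx.2
            have : 0 ≤ x * (x + P) :=
              mul_nonneg_of_nonpos_of_nonpos (by linarith) (by linarith)
            exact mul_nonneg (mul_nonneg this (sq_nonneg _)) (gaussDensity_pos x).le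
    have hup : ∫ x in A..-P, (2 * F x ^ 2 + 4 * h x ^ 2) * gaussDensity x
        ≤ 4 * ∫ x in A..-P, (F x ^ 2 + h x ^ 2) * gaussDensity x := by
      rw [← intervalIntegral.integral_const_mul]
      refine intervalIntegral.integral_mono_on hAP
        (((iF.const_mul 2).add (i2.const_mul 4)).mul_continuousOn cG.continuousOn)
        ((i3.mul_continuousOn cG.continuousOn).const_mul 4) fun x _ => ?_
      have := mul_nonneg (sq_nonneg (F x)) (gaussDensity_pos x).le
      nlinarith
    have hfinal : ∫ x in A..-M, F x ^ 2 * gaussDensity x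
        ≤ 8 / M ^ 2 * ∫ x in A..-P, (F x ^ 2 + h x ^ 2) * gaussDensity x := by
      rw [div_mul_eq_mul_div, le_div_iff₀ (by positivity)]
      linarith
    calc ∫⁻ x in Ioc A (-M), ‖F x‖ₑ ^ 2 ∂gauss1
        = ENNReal.ofReal (∫ x in A..-M, F x ^ 2 * gaussDensity x) := by
          simp only [enorm_sq_eq_ofReal]
          exact lintegral_gauss1_eq_ofReal hAM (fun x => sq_nonneg _) iF'
      _ ≤ ENNReal.ofReal (8 / M ^ 2 * ∫ x in A..-P, (F x ^ 2 + h x ^ 2) * gaussDensity x) :=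
          ENNReal.ofReal_le_ofReal hfinal
      _ = ENNReal.ofReal (8 / M ^ 2) * ∫⁻ x in Ioc A (-P), (‖F x‖ₑ ^ 2 + ‖h x‖ₑ ^ 2) ∂gauss1 := by
          rw [ENNReal.ofReal_mul (by positivity)]
          congr 1
          simp only [enorm_sq_eq_ofReal, ← ENNReal.ofReal_add (sq_nonneg _) (sq_nonneg _)]
          exact (lintegral_gauss1_eq_ofReal hAP
            (fun x => add_nonneg (sq_nonneg _) (sq_nonneg _)) i3).symm
      _ ≤ _ := by
          gcongr
          refine Ioc_subset_Icc_self.trans ?_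
          rw [← uIcc_of_le hAP]; exact hsub
  -- The bound on (A, -M] does not depend on A, so it passes to the directed union over rational A
  -- in `S`.
  have hU : S ∩ Iic (-M) ⊆ ⋃ q : {q : ℚ // (q : ℝ) ∈ S ∧ (q : ℝ) ≤ -M}, Ioc (q : ℝ) (-M) := by
    rintro x ⟨hxS, hxM⟩
    obtain ⟨ε, hε, hball⟩ := Metric.isOpen_iff.1 hS x hxS
    obtain ⟨q, hq1, hq2⟩ := exists_rat_btwn (sub_lt_self x hε)
    have hqS : (q : ℝ) ∈ S := hball (by
      rw [Metric.mem_ball, Real.dist_eq, abs_lt]; constructor <;> linarith)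
    exact mem_iUnion.2 ⟨⟨q, hqS, hq2.le.trans hxM⟩, hq2, hxM⟩
  refine (lintegral_mono_set hU).trans ?_
  rw [setLIntegral_iUnion_of_directed]
  · exact iSup_le fun q => main q q.2.1 q.2.2
  · intro q r
    rcases le_total (q : ℝ) r with hqr | hqr
    · exact ⟨q, subset_rfl, Ioc_subset_Ioc_left hqr⟩
    · exact ⟨r, Ioc_subset_Ioc_left hqr, subset_rfl⟩

/-- On the unit interval below b the Gaussian weight is bounded below in terms of P alone, so the H¹
norm controls f pointwise there; integrating over length δ gives the factor δ, uniformly in |b| ≤ P.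
-/
theorem setLIntegral_near_top_le {P b δ x₀ : ℝ} (hb : |b| ≤ P) (hδ : 0 ≤ δ) (hδ1 : δ ≤ 1)
    (hx₀ : x₀ < b) {f h : ℝ → ℝ} (hfm : Measurable f) (hh : Measurable h) {k : ℝ}
    (hf : ∀ᵐ x, x ∈ Iio b → f x = k + ∫ t in x₀..x, h t) :
    ∫⁻ x in Ioo (b - δ) b, ‖f x‖ₑ ^ 2 ∂gauss1
      ≤ ENNReal.ofReal (2 * (gaussDensity (P + 1))⁻¹ * δ) *
        ∫⁻ x in Iio b, (‖f x‖ₑ ^ 2 + ‖h x‖ₑ ^ 2) ∂gauss1 := by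
  rcases hδ.eq_or_lt with rfl | hδ0
  · simp
  have hGP := gaussDensity_pos (P + 1)
  by_cases hfin : ∫⁻ x in Iio b, ‖h x‖ₑ ^ 2 ∂gauss1 = ⊤
  · have : ∫⁻ x in Iio b, (‖f x‖ₑ ^ 2 + ‖h x‖ₑ ^ 2) ∂gauss1 = ⊤ :=
      top_le_iff.1 (hfin ▸ lintegral_mono fun x => le_add_self)
    rw [this, ENNReal.mul_top]
    · exact le_top
    · simpa using by positivity
  have hII : ∀ x y, x < b → y < b → IntervalIntegrable h volume x y := fun x y hx hy =>
    (intervalIntegrable_of_memLp (memLp_uIcc_of_lintegral_gauss1 hh hfin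
      (ordConnected_Iio.uIcc_subset hx hy))).1
  set J : ENNReal := ∫⁻ x in Ioo (b - 1) b, (‖f x‖ₑ ^ 2 + ‖h x‖ₑ ^ 2) with hJ
  have hJle : J ≤ ENNReal.ofReal (gaussDensity (P + 1))⁻¹ *
      ∫⁻ x in Iio b, (‖f x‖ₑ ^ 2 + ‖h x‖ₑ ^ 2) ∂gauss1 := by
    refine (setLIntegral_volume_le_gauss1 measurableSet_Ioo hGP (fun x hx => ?_) _).trans ?_
    · apply gaussDensity_le_of_abs_le
      have h1 := abs_le.1 hb
      rw [abs_of_nonneg (by linarith [h1.1, h1.2] : 0 ≤ P + 1), abs_le]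
      constructor <;> linarith [hx.1, hx.2]
    · gcongr
      exact Ioo_subset_Iio_self
  -- Write f(y) = f(s) + ∫ₛʸ h and average the squared bound over s in the unit interval (b - 1, b).
  have hpt : ∀ᵐ y, y ∈ Ioo (b - 1) b → ‖f y‖ₑ ^ 2 ≤ 2 * J := by
    filter_upwards [hf] with y hy hyI
    have h1 : ∀ᵐ s ∂volume.restrict (Ioo (b - 1) b), ‖f y‖ₑ ^ 2
        ≤ 2 * (‖f s‖ₑ ^ 2 + ∫⁻ t in Ioo (b - 1) b, ‖h t‖ₑ ^ 2) := by
      refine (ae_restrict_iff' measurableSet_Ioo).2 ?_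
      filter_upwards [hf] with s hs hsI
      have e : f y = f s + ∫ t in s..y, h t := by
        rw [hy hyI.2, hs hsI.2, add_assoc,
          intervalIntegral.integral_add_adjacent_intervals (hII _ _ hx₀ hsI.2)
            (hII _ _ hsI.2 hyI.2)]
      rw [e]
      refine (enorm_add_sq_le _ _).trans ?_
      gcongr
      refine (enorm_intervalIntegral_sq_le hh s y).trans ?_
      have hle : ENNReal.ofReal |y - s| ≤ 1 := by
        rw [ENNReal.ofReal_le_one, abs_le]
        constructor <;> linarith [hyI.1, hyI.2, hsI.1, hsI.2]
      refine (mul_le_mul' hle (lintegral_mono_set ?_)).trans (one_mul _).le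
      exact uIoc_subset_uIcc.trans (ordConnected_Ioo.uIcc_subset hsI hyI)
    have h2 := lintegral_mono_ae h1
    rw [lintegral_const_mul _ (by fun_prop), lintegral_add_right _ (by fun_prop)] at h2
    simp only [lintegral_const, Measure.restrict_apply_univ, Real.volume_Ioo, sub_sub_cancel,
      ENNReal.ofReal_one, mul_one] at h2
    rwa [hJ, lintegral_add_right _ (by fun_prop)]
  calc ∫⁻ x in Ioo (b - δ) b, ‖f x‖ₑ ^ 2 ∂gauss1
      ≤ ∫⁻ x in Ioo (b - δ) b, ‖f x‖ₑ ^ 2 := setLIntegral_gauss1_le_volume _ _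
    _ ≤ ∫⁻ x in Ioo (b - δ) b, 2 * J := by
        refine lintegral_mono_ae ((ae_restrict_iff' measurableSet_Ioo).2 ?_)
        filter_upwards [hpt] with x hx hxI
        exact hx ⟨by linarith [hxI.1], hxI.2⟩
    _ = ENNReal.ofReal δ * (2 * J) := by
        simp [mul_comm]
    _ ≤ ENNReal.ofReal δ * (2 * (ENNReal.ofReal (gaussDensity (P + 1))⁻¹ *
      ∫⁻ x in Iio b, (‖f x‖ₑ ^ 2 + ‖h x‖ₑ ^ 2) ∂gauss1)) := by gcongr
    _ = _ := by
        rw [ENNReal.ofReal_mul (by positivity), ENNReal.ofReal_mul (by positivity)]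
        simp only [ENNReal.ofReal_ofNat]
        ring

/-- As f is the primitive of h from 0 and the density decreases in |x|, Cauchy–Schwarz gives γ(x)
f(x)² ≤ a ∫ h² dγ. The set m < |x| < a has length 2 (a - m). -/
theorem setLIntegral_near_ends_le {S : Set ℝ} (hS : MeasurableSet S) (hc : OrdConnected S)
    (h0 : (0 : ℝ) ∈ S) {a m : ℝ} (hma : m ≤ a) (hSa : S ⊆ Ioo (-a) a) {f h : ℝ → ℝ}
    (hh : Measurable h) (hf : ∀ᵐ x, x ∈ S → f x = ∫ t in (0 : ℝ)..x, h t) :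
    ∫⁻ x in S ∩ {x | m < |x|}, ‖f x‖ₑ ^ 2 ∂gauss1
      ≤ ENNReal.ofReal (2 * (a - m) * a) * ∫⁻ x in S, ‖h x‖ₑ ^ 2 ∂gauss1 := by
  have hm1 : MeasurableSet {x : ℝ | m < |x|} := measurableSet_lt (by fun_prop) (by fun_prop)
  set J := ∫⁻ x in S, ‖h x‖ₑ ^ 2 ∂gauss1 with hJ
  have hpt : ∀ᵐ x, x ∈ S → ENNReal.ofReal (gaussDensity x) * ‖f x‖ₑ ^ 2
      ≤ ENNReal.ofReal a * J := by
    filter_upwards [hf] with x hx hxS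
    have hsub : uIoc 0 x ⊆ S := uIoc_subset_uIcc.trans (hc.uIcc_subset h0 hxS)
    rw [hx hxS]
    calc ENNReal.ofReal (gaussDensity x) * ‖∫ t in (0 : ℝ)..x, h t‖ₑ ^ 2
        ≤ ENNReal.ofReal (gaussDensity x) *
          (ENNReal.ofReal |x - 0| * ∫⁻ t in uIoc 0 x, ‖h t‖ₑ ^ 2) := by
          gcongr
          exact enorm_intervalIntegral_sq_le hh 0 x
      _ = ENNReal.ofReal |x| *
          ∫⁻ t in uIoc 0 x, ENNReal.ofReal (gaussDensity x) * ‖h t‖ₑ ^ 2 := by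
          rw [lintegral_const_mul _ (by fun_prop), sub_zero]
          ring
      _ ≤ ENNReal.ofReal a *
          ∫⁻ t in uIoc 0 x, ENNReal.ofReal (gaussDensity t) * ‖h t‖ₑ ^ 2 := by
          gcongr ?_ * ?_
          · exact ENNReal.ofReal_le_ofReal (abs_lt.2 (hSa hxS)).le
          · refine setLIntegral_mono' measurableSet_uIoc fun t ht => ?_
            gcongr
            apply gaussDensity_le_of_abs_le
            simpa using abs_le_max_of_mem_uIcc (uIoc_subset_uIcc ht)
      _ ≤ ENNReal.ofReal a * J := by
          rw [← setLIntegral_gauss1 measurableSet_uIoc]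
          gcongr
          exact lintegral_mono_set hsub
  have hvol : volume (S ∩ {x | m < |x|}) ≤ ENNReal.ofReal (2 * (a - m)) := by
    have : S ∩ {x | m < |x|} ⊆ Ioo (-a) (-m) ∪ Ioo m a := by
      rintro x ⟨hxS, hxm⟩
      have := hSa hxS
      have hxm' : m < |x| := hxm
      rcases lt_abs.1 hxm' with h | h
      · exact Or.inr ⟨h, this.2⟩
      · exact Or.inl ⟨this.1, by linarith⟩
    refine (measure_mono this).trans ((measure_union_le _ _).trans ?_)
    rw [Real.volume_Ioo, Real.volume_Ioo, ← ENNReal.ofReal_add (by linarith) (by linarith)]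
    exact ENNReal.ofReal_le_ofReal (by linarith)
  rw [setLIntegral_gauss1 (hS.inter hm1)]
  calc ∫⁻ x in S ∩ {x | m < |x|}, ENNReal.ofReal (gaussDensity x) * ‖f x‖ₑ ^ 2
      ≤ ∫⁻ x in S ∩ {x | m < |x|}, ENNReal.ofReal a * J := by
        refine lintegral_mono_ae ((ae_restrict_iff' (hS.inter hm1)).2 ?_)
        filter_upwards [hpt] with x hx hxS
        exact hx hxS.1
    _ = ENNReal.ofReal a * J * volume (S ∩ {x | m < |x|}) := setLIntegral_const _ _
    _ ≤ ENNReal.ofReal a * J * ENNReal.ofReal (2 * (a - m)) := by gcongr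
    _ = _ := by
        rw [ENNReal.ofReal_mul (by linarith : 0 ≤ 2 * (a - m))]
        ring

end Tails

/-- The primitive of a locally integrable function is continuous. -/
theorem continuousOn_primitive {S : Set ℝ} (hS : IsOpen S) (hc : OrdConnected S) {x₀ : ℝ}
    (h0 : x₀ ∈ S) {h : ℝ → ℝ} (hh : LocallyIntegrableOn h S volume) :
    ContinuousOn (fun x => ∫ t in x₀..x, h t) S := by
  have hII : ∀ x y, x ∈ S → y ∈ S → IntervalIntegrable h volume x y := fun x y hx hy =>
    (hh.integrableOn_compact_subset (hc.uIcc_subset hx hy) isCompact_uIcc).intervalIntegrable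
  intro x hx
  have hr : ∃ A ∈ S, A < x := by
    obtain ⟨ε, hε, hball⟩ := Metric.isOpen_iff.1 hS x hx
    exact ⟨x - ε / 2, hball (by
      rw [Metric.mem_ball, Real.dist_eq, abs_lt]; constructor <;> linarith), by linarith⟩
  have hl : ∃ B ∈ S, x < B := by
    obtain ⟨ε, hε, hball⟩ := Metric.isOpen_iff.1 hS x hx
    exact ⟨x + ε / 2, hball (by
      rw [Metric.mem_ball, Real.dist_eq, abs_lt]; constructor <;> linarith), by linarith⟩
  obtain ⟨A, hA, hAx⟩ := hr
  obtain ⟨B, hB, hBx⟩ := hl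
  have h1 : ContinuousOn (fun x => ∫ t in A..x, h t) (uIcc A B) :=
    intervalIntegral.continuousOn_primitive_interval' (hII A B hA hB) left_mem_uIcc
  have h2 : ContinuousAt (fun x => ∫ t in A..x, h t) x :=
    h1.continuousAt (by rw [uIcc_of_le (by linarith)]; exact Icc_mem_nhds hAx hBx)
  have h3 : (fun x => ∫ t in x₀..x, h t) =ᶠ[𝓝 x]
      fun x => (∫ t in x₀..A, h t) + ∫ t in A..x, h t := by
    filter_upwards [hS.mem_nhds hx] with y hy
    rw [intervalIntegral.integral_add_adjacent_intervals (hII _ _ h0 hA) (hII _ _ hA hy)]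
  exact ((continuousAt_const.add h2).congr h3.symm).continuousWithinAt

/-- The primitive of a locally integrable function on an open interval has that function as its
weak derivative. -/
theorem hasWeakDeriv_primitive {S : Set ℝ} (hS : IsOpen S) (hc : OrdConnected S) {x₀ : ℝ}
    (h0 : x₀ ∈ S) {h : ℝ → ℝ} (hh : LocallyIntegrableOn h S volume) :
    HasWeakDeriv S (1 : ℝ) (fun x => ∫ t in x₀..x, h t) h := by
  have hII : ∀ x y, x ∈ S → y ∈ S → IntervalIntegrable h volume x y := fun x y hx hy =>
    (hh.integrableOn_compact_subset (hc.uIcc_subset hx hy) isCompact_uIcc).intervalIntegrable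
  have hcont : ContinuousOn (fun x => ∫ t in x₀..x, h t) S := continuousOn_primitive hS hc h0 hh
  refine ⟨hcont.locallyIntegrableOn hS.measurableSet, hh, fun φ h1 h2 h3 => ?_⟩
  -- Inserting `x₀` keeps the set nonempty even for φ = 0 and places `x₀` between `A` and `B`.
  have hK : IsCompact (insert x₀ (tsupport φ)) := h2.isCompact.insert x₀
  have hne : (insert x₀ (tsupport φ)).Nonempty := insert_nonempty _ _
  have hKS : insert x₀ (tsupport φ) ⊆ S := insert_subset h0 h3
  obtain ⟨ε, hε, hball⟩ := Metric.isOpen_iff.1 hS _ (hKS (hK.sInf_mem hne))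
  obtain ⟨δ, hδ, hball'⟩ := Metric.isOpen_iff.1 hS _ (hKS (hK.sSup_mem hne))
  set A := sInf (insert x₀ (tsupport φ)) - ε / 2 with hAdef
  set B := sSup (insert x₀ (tsupport φ)) + δ / 2 with hBdef
  have hA : A ∈ S := hball (by
    rw [Metric.mem_ball, Real.dist_eq, abs_lt]; constructor <;> linarith)
  have hB : B ∈ S := hball' (by
    rw [Metric.mem_ball, Real.dist_eq, abs_lt]; constructor <;> linarith)
  have hmem : ∀ x ∈ insert x₀ (tsupport φ), A < x ∧ x < B := fun x hx =>
    ⟨by linarith [csInf_le hK.bddBelow hx], by linarith [le_csSup hK.bddAbove hx]⟩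
  have hx0 := hmem x₀ (mem_insert _ _)
  have hAB : A ≤ B := by linarith
  have z1 : ∀ x, x ∉ Ioo A B → φ x = 0 := fun x hx =>
    image_eq_zero_of_notMem_tsupport fun h => hx (hmem x (mem_insert_of_mem _ h))
  have z2 : ∀ x, x ∉ Ioo A B → deriv φ x = 0 := fun x hx =>
    image_eq_zero_of_notMem_tsupport fun h =>
      hx (hmem x (mem_insert_of_mem _ (tsupport_deriv_subset h)))
  have hIS : Ioc A B ⊆ S :=
    Ioc_subset_Icc_self.trans (by rw [← uIcc_of_le hAB]; exact hc.uIcc_subset hA hB)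
  have toI : ∀ F : ℝ → ℝ, (∀ x, x ∉ Ioo A B → F x = 0) → ∫ x in S, F x = ∫ x in A..B, F x := by
    intro F hF
    rw [intervalIntegral.integral_of_le hAB]
    exact setIntegral_eq_of_subset_of_forall_sdiff_eq_zero hS.measurableSet hIS
      fun x hx => hF x fun h => hx.2 (Ioo_subset_Ioc_self h)
  have hi := hII A B hA hB
  have hx0' : x₀ ∈ uIcc A B := by rw [uIcc_of_le hAB]; exact ⟨hx0.1.le, hx0.2.le⟩
  have acF := hi.absolutelyContinuousOnInterval_intervalIntegral hx0'
  have acφ : AbsolutelyContinuousOnInterval φ A B :=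
    (h1.of_le (by norm_cast) : ContDiff ℝ 1 φ).contDiffOn.absolutelyContinuousOnInterval
  have key := acF.integral_mul_deriv_eq_deriv_mul acφ
  rw [z1 A (by simp), z1 B (by simp)] at key
  have e : ∫ x in A..B, deriv (fun x => ∫ t in x₀..x, h t) x * φ x = ∫ x in A..B, h x * φ x := by
    apply intervalIntegral.integral_congr_ae
    filter_upwards [hi.ae_hasDerivAt_integral] with x hx hxm
    rw [(hx (uIoc_subset_uIcc hxm) x₀ hx0').deriv]
  rw [e] at key
  have hfd : ∀ x, fderiv ℝ φ x 1 = deriv φ x := fun x => rfl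
  simp only [hfd]
  rw [toI _ fun x hx => by rw [z2 x hx, mul_zero], toI _ fun x hx => by rw [z1 x hx, mul_zero],
    key]
  ring

/-! ### Attainment of an operator norm under finite control. -/

section CompactMaximizer

variable {H L : Type*} [NormedAddCommGroup H] [InnerProductSpace ℝ H]
  [NormedAddCommGroup L] [InnerProductSpace ℝ L]

/-- A nonzero operator between Hilbert spaces that is controlled, up to an arbitrarily small
multiple of the norm, by finitely many functionals attains its norm on the unit sphere. -/
theorem ContinuousLinearMap.exists_norm_eq_of_finite_control [CompleteSpace H]
    {ι : Type*} (J : H →L[ℝ] L) (hJ : J ≠ 0)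
    (hfin : ∀ ε > 0, ∃ (s : Finset ι) (l : ι → H →L[ℝ] ℝ),
      ∀ f, ‖J f‖ ^ 2 ≤ ε * ‖f‖ ^ 2 + ∑ i ∈ s, l i f ^ 2) :
    ∃ f, ‖f‖ = 1 ∧ ‖J f‖ = ‖J‖ := by
  have hJ0 : 0 < ‖J‖ := norm_pos_iff.2 hJ
  have hseq : ∀ n : ℕ, ∃ f : H, ‖f‖ = 1 ∧ ‖J‖ - 1 / (n + 1) < ‖J f‖ := by
    intro n
    have hlt : ‖J‖ - 1 / (n + 1) < ‖J‖ := sub_lt_self _ (by positivity)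
    by_contra! hcon
    have hb : ‖J‖ ≤ max 0 (‖J‖ - 1 / (n + 1)) := by
      refine J.opNorm_le_of_unit_norm (le_max_left _ _) fun f hf => ?_
      exact (hcon f hf).trans (le_max_right _ _)
    exact absurd hb (not_le.2 (max_lt hJ0 hlt))
  choose f hf1 hf2 using hseq
  -- Along an ultrafilter every bounded real sequence converges, which replaces the extraction of
  -- subsequences for the functionals.
  let U : Ultrafilter ℕ := Filter.hyperfilter ℕ
  have hUat : (U : Filter ℕ) ≤ atTop := Nat.hyperfilter_le_atTop
  have hJlim : Tendsto (fun n => ‖J (f n)‖) U (𝓝 ‖J‖) := by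
    refine Tendsto.mono_left ?_ hUat
    refine tendsto_of_tendsto_of_tendsto_of_le_of_le (g := fun n : ℕ => ‖J‖ - 1 / ((n : ℝ) + 1))
      ?_ tendsto_const_nhds (fun n => (hf2 n).le) fun n => ?_
    · simpa using (tendsto_const_nhds (x := ‖J‖)).sub tendsto_one_div_add_atTop_nhds_zero_nat
    · simpa [hf1 n] using J.le_opNorm (f n)
  -- With d = f_k - f_m and unit near-maximisers, the parallelogram law for f and for Jf gives ‖J‖²
  -- ‖d‖² ≤ 4‖J‖² - 2 (‖Jf_k‖² + ‖Jf_m‖²) + ‖Jd‖². The first difference is small by near-maximality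
  -- and ‖Jd‖² by the finite control, so norm convergence follows directly. With the constant 1/16
  -- the errors add up to at most (1/4 + 1/4 + 1/16) ε² ‖J‖².
  have hcauchy : Cauchy (Filter.map f U) := by
    rw [Metric.cauchy_iff]
    refine ⟨inferInstance, fun ε hε => ?_⟩
    obtain ⟨s, l, hl⟩ := hfin (ε ^ 2 * ‖J‖ ^ 2 / 16) (by positivity)
    have hlim : ∀ i, ∃ c, Tendsto (fun k => l i (f k)) U (𝓝 c) := by
      intro i
      have hmem : Metric.closedBall (0 : ℝ) ‖l i‖ ∈ U.map fun k => l i (f k) := by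
        refine Filter.mem_map.2 (Eventually.of_forall fun k => ?_)
        simpa [hf1 k] using (l i).le_opNorm (f k)
      obtain ⟨c, -, hc⟩ := (isCompact_closedBall (0 : ℝ) ‖l i‖).ultrafilter_le_nhds'
        (U.map fun k => l i (f k)) hmem
      exact ⟨c, hc⟩
    choose c hc using hlim
    set η : ℝ := ε ^ 2 * ‖J‖ ^ 2 / (16 * (s.card + 1)) with hη
    have hηpos : 0 < η := by positivity
    have hev : ∀ᶠ k in (U : Filter ℕ), (∀ i ∈ s, (l i (f k) - c i) ^ 2 < η / 4) ∧
        ‖J‖ ^ 2 - ε ^ 2 * ‖J‖ ^ 2 / 16 < ‖J (f k)‖ ^ 2 := by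
      refine ((Filter.eventually_all_finset s).2 fun i _ => ?_).and ?_
      · have : Tendsto (fun k => (l i (f k) - c i) ^ 2) U (𝓝 0) := by
          simpa using ((hc i).sub_const (c i)).pow 2
        exact this.eventually (gt_mem_nhds (by positivity))
      · exact (hJlim.pow 2).eventually (lt_mem_nhds (sub_lt_self _ (by positivity)))
    refine ⟨f '' {k | (∀ i ∈ s, (l i (f k) - c i) ^ 2 < η / 4) ∧
        ‖J‖ ^ 2 - ε ^ 2 * ‖J‖ ^ 2 / 16 < ‖J (f k)‖ ^ 2}, Filter.image_mem_map hev, ?_⟩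
    rintro _ ⟨k, ⟨hk1, hk2⟩, rfl⟩ _ ⟨m, ⟨hm1, hm2⟩, rfl⟩
    rw [dist_eq_norm]
    have hp1 := parallelogram_law_with_norm ℝ (f k) (f m)
    have hp2 := parallelogram_law_with_norm ℝ (J (f k)) (J (f m))
    rw [← map_add, ← map_sub] at hp2
    rw [hf1, hf1] at hp1
    have hop : ‖J (f k + f m)‖ ≤ ‖J‖ * ‖f k + f m‖ := J.le_opNorm _
    have hsum : ∑ i ∈ s, l i (f k - f m) ^ 2 ≤ s.card * η := by
      calc ∑ i ∈ s, l i (f k - f m) ^ 2 ≤ ∑ _i ∈ s, η := by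
            refine Finset.sum_le_sum fun i hi => ?_
            rw [map_sub]
            nlinarith [hk1 i hi, hm1 i hi, sq_nonneg ((l i (f k) - c i) + (l i (f m) - c i))]
        _ = s.card * η := by simp
    have hnη : s.card * η ≤ ε ^ 2 * ‖J‖ ^ 2 / 16 := by
      rw [hη, mul_div_assoc', div_le_div_iff₀ (by positivity) (by positivity)]
      nlinarith [show 0 ≤ ε ^ 2 * ‖J‖ ^ 2 by positivity]
    have hJd := hl (f k - f m)
    have hop2 : ‖J (f k + f m)‖ ^ 2 ≤ ‖J‖ ^ 2 * ‖f k + f m‖ ^ 2 := by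
      rw [← mul_pow]; gcongr
    have hd0 := sq_nonneg ‖f k - f m‖
    have hd4 : ‖f k - f m‖ ^ 2 ≤ 4 := by nlinarith [sq_nonneg ‖f k + f m‖]
    have hfinal : ‖J‖ ^ 2 * ‖f k - f m‖ ^ 2 < ‖J‖ ^ 2 * ε ^ 2 := by
      have e1 : ‖J‖ ^ 2 * ‖f k - f m‖ ^ 2 = 4 * ‖J‖ ^ 2 - ‖J‖ ^ 2 * ‖f k + f m‖ ^ 2 := by
        linear_combination ‖J‖ ^ 2 * hp1
      have e2 : ε ^ 2 * ‖J‖ ^ 2 / 16 * ‖f k - f m‖ ^ 2 ≤ ε ^ 2 * ‖J‖ ^ 2 / 16 * 4 := by gcongr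
      have e3 : 0 < ε ^ 2 * ‖J‖ ^ 2 := by positivity
      nlinarith
    have := lt_of_mul_lt_mul_left hfinal (by positivity)
    exact lt_of_pow_lt_pow_left₀ 2 hε.le this
  obtain ⟨g, hg⟩ := CompleteSpace.complete hcauchy
  have hg' : Tendsto f U (𝓝 g) := hg
  refine ⟨g, ?_, ?_⟩
  · refine tendsto_nhds_unique hg'.norm ?_
    simp [hf1]
  · exact tendsto_nhds_unique ((J.continuous.tendsto g).comp hg').norm hJlim

/-- At a unit vector where the norm of `J` is attained, `J† J f = ‖J‖² f`. -/
theorem ContinuousLinearMap.inner_map_map_of_norm_eq (J : H →L[ℝ] L) {f : H} (hf : ‖f‖ = 1)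
    (hJf : ‖J f‖ = ‖J‖) (g : H) : inner ℝ (J f) (J g) = ‖J‖ ^ 2 * inner ℝ f g := by
  have key : ∀ t : ℝ, 0 ≤ t ^ 2 * (‖J‖ ^ 2 * ‖g‖ ^ 2 - ‖J g‖ ^ 2) +
      t * (2 * (‖J‖ ^ 2 * inner ℝ f g - inner ℝ (J f) (J g))) := by
    intro t
    have h1 : ‖J (f + t • g)‖ ≤ ‖J‖ * ‖f + t • g‖ := J.le_opNorm _
    have h2 : ‖J (f + t • g)‖ ^ 2 ≤ ‖J‖ ^ 2 * ‖f + t • g‖ ^ 2 := by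
      rw [← mul_pow]; gcongr
    rw [map_add, map_smul, norm_add_sq_real, norm_add_sq_real, inner_smul_right, inner_smul_right,
      norm_smul, norm_smul, hf, hJf, mul_pow, mul_pow, Real.norm_eq_abs, sq_abs] at h2
    nlinarith
  set c := 2 * (‖J‖ ^ 2 * inner ℝ f g - inner ℝ (J f) (J g)) with hc
  set d := ‖J‖ ^ 2 * ‖g‖ ^ 2 - ‖J g‖ ^ 2 with hd
  have hc0 : c = 0 := by
    by_contra hne
    -- Nonnegativity of t² d + t c for all t forces c = 0: this choice of t would make the
    -- expression negative.
    have h3 := key (-c / (|d| + 1))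
    have h4 : (-c / (|d| + 1)) ^ 2 * d + -c / (|d| + 1) * c
        = c ^ 2 / (|d| + 1) ^ 2 * (d - (|d| + 1)) := by
      have : |d| + 1 ≠ 0 := by positivity
      field_simp
      ring
    rw [h4] at h3
    have h5 : d - (|d| + 1) < 0 := by linarith [le_abs_self d]
    have h6 : 0 < c ^ 2 / (|d| + 1) ^ 2 := by positivity
    nlinarith [mul_neg_of_pos_of_neg h6 h5]
  linarith

end CompactMaximizer

/-! ### Integrals over plane sets by slices. -/

section Fubini

theorem setLIntegral_gauss2_horizontal {A : Set (ℝ × ℝ)} (hA : MeasurableSet A)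
    {F : ℝ × ℝ → ENNReal} (hF : Measurable F) :
    ∫⁻ q in A, F q ∂gauss2 = ∫⁻ y, ∫⁻ x in {x | (x, y) ∈ A}, F (x, y) ∂gauss1 ∂gauss1 := by
  rw [← lintegral_indicator hA, gauss2,
    lintegral_prod_symm _ (hF.indicator hA).aemeasurable]
  refine lintegral_congr fun y => ?_
  have hm : MeasurableSet {x | (x, y) ∈ A} := measurable_prodMk_right hA
  rw [← lintegral_indicator hm]
  rfl

theorem setLIntegral_gauss2_vertical {A : Set (ℝ × ℝ)} (hA : MeasurableSet A)
    {F : ℝ × ℝ → ENNReal} (hF : Measurable F) :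
    ∫⁻ q in A, F q ∂gauss2 = ∫⁻ x, ∫⁻ y in {y | (x, y) ∈ A}, F (x, y) ∂gauss1 ∂gauss1 := by
  rw [← lintegral_indicator hA, gauss2,
    lintegral_prod _ (hF.indicator hA).aemeasurable]
  refine lintegral_congr fun x => ?_
  have hm : MeasurableSet {y | (x, y) ∈ A} := measurable_prodMk_left hA
  rw [← lintegral_indicator hm]
  rfl

theorem measurable_slice_lintegral {Ω : Set (ℝ × ℝ)} (hΩ : MeasurableSet Ω) {F : ℝ × ℝ → ENNReal}
    (hF : Measurable F) : Measurable fun y => ∫⁻ x in {x | (x, y) ∈ Ω}, F (x, y) ∂gauss1 := by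
  have : ∀ y, ∫⁻ x in {x | (x, y) ∈ Ω}, F (x, y) ∂gauss1
      = ∫⁻ x, Ω.indicator F (x, y) ∂gauss1 := by
    intro y
    have hm : MeasurableSet {x | (x, y) ∈ Ω} := measurable_prodMk_right hΩ
    rw [← lintegral_indicator hm]
    rfl
  simp only [this]
  exact (hF.indicator hΩ).lintegral_prod_left'

theorem ae_setLIntegral_slice_ne_top {A : Set (ℝ × ℝ)} (hA : MeasurableSet A)
    {F : ℝ × ℝ → ENNReal} (hF : Measurable F) (h : ∫⁻ q in A, F q ∂gauss2 ≠ ⊤) :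
    ∀ᵐ y, ∫⁻ x in {x | (x, y) ∈ A}, F (x, y) ∂gauss1 ≠ ⊤ := by
  rw [setLIntegral_gauss2_horizontal hA hF] at h
  have := ae_lt_top (measurable_slice_lintegral hA hF) h
  filter_upwards [volume_absolutelyContinuous_gauss1.ae_le this] with y hy using hy.ne

end Fubini

/-! ### Primitives on slices with square-integrable derivative. -/

section Slices

theorem memLp_two_of_lintegral {α : Type*} [MeasurableSpace α] {μ : Measure α} {h : α → ℝ}
    (hh : Measurable h) (hfin : ∫⁻ x, ‖h x‖ₑ ^ 2 ∂μ ≠ ⊤) : MemLp h 2 μ := by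
  refine ⟨hh.aestronglyMeasurable, ?_⟩
  rw [eLpNorm_lt_top_iff_lintegral_rpow_enorm_lt_top (by norm_num) (by norm_num)]
  simpa using lt_top_iff_ne_top.2 hfin

theorem lintegral_enorm_sq_ne_top_of_memLp {α : Type*} [MeasurableSpace α] {μ : Measure α}
    {h : α → ℝ} (hh : MemLp h 2 μ) : ∫⁻ x, ‖h x‖ₑ ^ 2 ∂μ ≠ ⊤ := by
  have := (eLpNorm_lt_top_iff_lintegral_rpow_enorm_lt_top (by norm_num) (by norm_num)).1 hh.2
  simpa using this.ne

theorem HasWeakDeriv.swap {U : Set (ℝ × ℝ)} (hU : IsOpen U) {u g : ℝ × ℝ → ℝ}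
    (h : HasWeakDeriv U ((0, 1) : ℝ × ℝ) u g) :
    HasWeakDeriv (Prod.swap ⁻¹' U) ((1, 0) : ℝ × ℝ) (u ∘ Prod.swap) (g ∘ Prod.swap) :=
  h.comp_continuousLinearEquiv hU (ContinuousLinearEquiv.prodComm ℝ ℝ ℝ)
    Measure.measurePreserving_swap

theorem ae_eq_primitive_rebase {S : Set ℝ} (hc : OrdConnected S) {f h : ℝ → ℝ}
    (hh : Measurable h) (hfin : ∫⁻ x in S, ‖h x‖ₑ ^ 2 ∂gauss1 ≠ ⊤) {x₀ x₁ k : ℝ} (h0 : x₀ ∈ S)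
    (h1 : x₁ ∈ S) (hf : ∀ᵐ x, x ∈ S → f x = k + ∫ t in x₀..x, h t) :
    ∀ᵐ x, x ∈ S → f x = (k + ∫ t in x₀..x₁, h t) + ∫ t in x₁..x, h t := by
  have hII : ∀ x y, x ∈ S → y ∈ S → IntervalIntegrable h volume x y := fun x y hx hy =>
    (intervalIntegrable_of_memLp
      (memLp_uIcc_of_lintegral_gauss1 hh hfin (hc.uIcc_subset hx hy))).1
  filter_upwards [hf] with x hx hxS
  rw [hx hxS, add_assoc, intervalIntegral.integral_add_adjacent_intervals (hII _ _ h0 h1)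
    (hII _ _ h1 hxS)]

theorem HasWeakDeriv.ae_slice_primitive {U : Set (ℝ × ℝ)} (hU : IsOpen U)
    (hc : ∀ y, OrdConnected {x | (x, y) ∈ U}) {u g : ℝ × ℝ → ℝ} (hum : Measurable u)
    (hgm : Measurable g) (h : HasWeakDeriv U ((1, 0) : ℝ × ℝ) u g)
    (hfin : ∫⁻ q in U, ‖g q‖ₑ ^ 2 ∂gauss2 ≠ ⊤) :
    ∀ᵐ y : ℝ, ∫⁻ x in {x | (x, y) ∈ U}, ‖g (x, y)‖ₑ ^ 2 ∂gauss1 ≠ ⊤ ∧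
      ∀ x₀, (x₀, y) ∈ U → ∃ k : ℝ, ∀ᵐ x : ℝ, x ∈ {x | (x, y) ∈ U} →
        u (x, y) = k + ∫ t in x₀..x, g (t, y) := by
  filter_upwards [h.ae_slice_eq_primitive hU hc hum hgm,
    ae_setLIntegral_slice_ne_top hU.measurableSet (by fun_prop) hfin] with y hy1 hy2
  refine ⟨hy2, fun x₀ hx₀ => ?_⟩
  obtain ⟨x₁, hx₁, k, hk⟩ := hy1 ⟨x₀, hx₀⟩
  exact ⟨_, ae_eq_primitive_rebase (S := {x | (x, y) ∈ U}) (f := fun x => u (x, y))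
    (h := fun x => g (x, y)) (hc y) (by fun_prop) hy2 hx₁ hx₀ hk⟩

theorem continuousOn_primitive_of_lintegral {S : Set ℝ} (hS : IsOpen S) (hc : OrdConnected S)
    {h : ℝ → ℝ} (hh : Measurable h) (hfin : ∫⁻ x in S, ‖h x‖ₑ ^ 2 ∂gauss1 ≠ ⊤) {x₀ : ℝ}
    (h0 : x₀ ∈ S) : ContinuousOn (fun x => ∫ t in x₀..x, h t) S :=
  continuousOn_primitive hS hc h0
    (locallyIntegrableOn_of_memLp_gauss1 hS (memLp_two_of_lintegral hh hfin))

/-- An odd function that is almost everywhere equal to `k + ∫₀ˣ h` has `k = 0`. -/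
theorem eq_zero_of_odd_primitive {S : Set ℝ} (hS : IsOpen S) (h0 : (0 : ℝ) ∈ S)
    (hsym : ∀ x ∈ S, -x ∈ S) {f h : ℝ → ℝ} {k : ℝ}
    (hcont : ContinuousOn (fun x => ∫ t in (0 : ℝ)..x, h t) S)
    (hf : ∀ᵐ x, x ∈ S → f x = k + ∫ t in (0 : ℝ)..x, h t)
    (hodd : ∀ᵐ x, x ∈ S → f (-x) = - f x) : k = 0 := by
  have hneg := (Measure.measurePreserving_neg (volume : Measure ℝ)).quasiMeasurePreserving.ae hf
  have hsum : ∀ᵐ x, x ∈ S →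
      2 * k + ((∫ t in (0 : ℝ)..-x, h t) + ∫ t in (0 : ℝ)..x, h t) = 0 := by
    filter_upwards [hf, hneg, hodd] with x h1 h2 h3 hx
    have e1 := h1 hx
    have e2 := h2 (hsym x hx)
    have e3 := h3 hx
    linarith
  -- Oddness makes `w` vanish almost everywhere; being continuous, it vanishes at 0, where its value
  -- is 2k.
  set w : ℝ → ℝ := fun x => 2 * k + ((∫ t in (0 : ℝ)..-x, h t) + ∫ t in (0 : ℝ)..x, h t) with hw
  have hwc : ContinuousOn w S :=
    continuousOn_const.add ((hcont.comp continuousOn_neg hsym).add hcont)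
  have hw0 : w 0 = 0 := by
    by_contra hne
    have hopen : IsOpen (S ∩ w ⁻¹' {0}ᶜ) := hwc.isOpen_inter_preimage hS isOpen_compl_singleton
    have hpos := hopen.measure_pos volume ⟨0, h0, hne⟩
    refine hpos.ne' ?_
    rw [ae_iff] at hsum
    refine measure_mono_null (fun x hx => ?_) hsum
    simp only [mem_ofPred_eq, Classical.not_imp]
    exact hx
  simpa [hw] using hw0

end Slices

/-! ### A Poincaré inequality on squares. -/

section Poincare

/-- Cauchy–Schwarz contributes one factor s, and each of the two integrations over an interval of
length s contributes another. -/
theorem lintegral_lintegral_sub_sq_le {x₀ s : ℝ} {f h : ℝ → ℝ} (hh : Measurable h)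
    (hf : ∀ᵐ x₁ ∂volume.restrict (Ico x₀ (x₀ + s)), ∀ᵐ x₂ ∂volume.restrict (Ico x₀ (x₀ + s)),
      f x₂ - f x₁ = ∫ t in x₁..x₂, h t) :
    ∫⁻ x₁ in Ico x₀ (x₀ + s), ∫⁻ x₂ in Ico x₀ (x₀ + s), ‖f x₂ - f x₁‖ₑ ^ 2
      ≤ ENNReal.ofReal s ^ 3 * ∫⁻ x in Ico x₀ (x₀ + s), ‖h x‖ₑ ^ 2 := by
  set I := Ico x₀ (x₀ + s) with hI
  have hvol : volume I = ENNReal.ofReal s := by simp [hI]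
  have h1 : ∀ᵐ x₁ ∂volume.restrict I, ∫⁻ x₂ in I, ‖f x₂ - f x₁‖ₑ ^ 2
      ≤ ENNReal.ofReal s ^ 2 * ∫⁻ x in I, ‖h x‖ₑ ^ 2 := by
    filter_upwards [hf, ae_restrict_mem measurableSet_Ico] with x₁ hx₁ hm₁
    calc ∫⁻ x₂ in I, ‖f x₂ - f x₁‖ₑ ^ 2
        ≤ ∫⁻ x₂ in I, ENNReal.ofReal s * ∫⁻ x in I, ‖h x‖ₑ ^ 2 := by
          refine lintegral_mono_ae ?_
          filter_upwards [hx₁, ae_restrict_mem measurableSet_Ico] with x₂ hx₂ hm₂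
          rw [hx₂]
          refine (enorm_intervalIntegral_sq_le hh _ _).trans ?_
          gcongr
          · rw [abs_le]; constructor <;> linarith [hm₁.1, hm₁.2, hm₂.1, hm₂.2]
          · exact uIoc_subset_uIcc.trans (ordConnected_Ico.uIcc_subset hm₁ hm₂)
      _ = ENNReal.ofReal s ^ 2 * ∫⁻ x in I, ‖h x‖ₑ ^ 2 := by
          rw [setLIntegral_const, hvol]; ring
  calc ∫⁻ x₁ in I, ∫⁻ x₂ in I, ‖f x₂ - f x₁‖ₑ ^ 2
      ≤ ∫⁻ x₁ in I, ENNReal.ofReal s ^ 2 * ∫⁻ x in I, ‖h x‖ₑ ^ 2 := lintegral_mono_ae h1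
    _ = _ := by rw [setLIntegral_const, hvol]; ring

/-- Two points q, q' of the square are joined through the corner (q'.1, q.2), so the double integral
of |u(q) - u(q')|² splits into a horizontal and a vertical part. What matters later is the factor s²
before the energy; the mean is kept as a separate term. -/
theorem lintegral_sq_le_poincare {x₀ y₀ s : ℝ} (hs : 0 < s) {u ux uy : ℝ × ℝ → ℝ}
    (hu : Measurable u) (hux : Measurable ux) (huy : Measurable uy)
    (hint : IntegrableOn u (Ico x₀ (x₀ + s) ×ˢ Ico y₀ (y₀ + s)))
    (hx : ∀ᵐ y ∂volume.restrict (Ico y₀ (y₀ + s)),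
      ∀ᵐ x₁ ∂volume.restrict (Ico x₀ (x₀ + s)), ∀ᵐ x₂ ∂volume.restrict (Ico x₀ (x₀ + s)),
        u (x₂, y) - u (x₁, y) = ∫ t in x₁..x₂, ux (t, y))
    (hy : ∀ᵐ x ∂volume.restrict (Ico x₀ (x₀ + s)),
      ∀ᵐ y₁ ∂volume.restrict (Ico y₀ (y₀ + s)), ∀ᵐ y₂ ∂volume.restrict (Ico y₀ (y₀ + s)),
        u (x, y₂) - u (x, y₁) = ∫ t in y₁..y₂, uy (x, t)) :
    ∫⁻ q in Ico x₀ (x₀ + s) ×ˢ Ico y₀ (y₀ + s), ‖u q‖ₑ ^ 2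
      ≤ 4 * ENNReal.ofReal s ^ 2 *
          (∫⁻ q in Ico x₀ (x₀ + s) ×ˢ Ico y₀ (y₀ + s), (‖ux q‖ₑ ^ 2 + ‖uy q‖ₑ ^ 2))
        + 2 * ENNReal.ofReal s⁻¹ ^ 2 *
          ‖∫ q in Ico x₀ (x₀ + s) ×ˢ Ico y₀ (y₀ + s), u q‖ₑ ^ 2 := by
  set μ := (volume : Measure ℝ).restrict (Ico x₀ (x₀ + s)) with hμ
  set ν := (volume : Measure ℝ).restrict (Ico y₀ (y₀ + s)) with hν
  have hprod : (volume : Measure (ℝ × ℝ)).restrict (Ico x₀ (x₀ + s) ×ˢ Ico y₀ (y₀ + s))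
      = μ.prod ν := by rw [Measure.volume_eq_prod, ← Measure.prod_restrict]
  rw [IntegrableOn, hprod] at hint
  rw [hprod]
  set σ := ENNReal.ofReal s with hσ
  set τ := ENNReal.ofReal s⁻¹ with hτ
  have hστ : τ * σ = 1 := by
    rw [hσ, hτ, ← ENNReal.ofReal_mul (by positivity), inv_mul_cancel₀ hs.ne', ENNReal.ofReal_one]
  have hμ1 : μ univ = σ := by simp [hμ, hσ]
  have hν1 : ν univ = σ := by simp [hν, hσ]
  have hT : (μ.prod ν) univ = σ ^ 2 := by
    rw [← univ_prod_univ, Measure.prod_prod, hμ1, hν1, sq]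
  have hTr : (μ.prod ν).real univ = s ^ 2 := by
    rw [Measure.real, hT, hσ, ← ENNReal.ofReal_pow hs.le, ENNReal.toReal_ofReal (by positivity)]
  -- the horizontal and vertical contributions
  have hD1 : ∫⁻ q, ∫⁻ q', ‖u (q.1, q.2) - u (q'.1, q.2)‖ₑ ^ 2 ∂μ.prod ν ∂μ.prod ν
      ≤ σ ^ 4 * ∫⁻ q, ‖ux q‖ₑ ^ 2 ∂μ.prod ν := by
    have e1 : ∀ q : ℝ × ℝ, ∫⁻ q', ‖u (q.1, q.2) - u (q'.1, q.2)‖ₑ ^ 2 ∂μ.prod ν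
        = σ * ∫⁻ x', ‖u (q.1, q.2) - u (x', q.2)‖ₑ ^ 2 ∂μ := by
      intro q
      rw [lintegral_prod _ (by fun_prop)]
      simp only [lintegral_const, hν1]
      rw [lintegral_mul_const _ (by fun_prop), mul_comm]
    have hm : Measurable fun p : (ℝ × ℝ) × ℝ => ‖u (p.1.1, p.1.2) - u (p.2, p.1.2)‖ₑ ^ 2 := by
      fun_prop
    have hm1 : Measurable fun q : ℝ × ℝ => ∫⁻ x', ‖u (q.1, q.2) - u (x', q.2)‖ₑ ^ 2 ∂μ :=
      hm.lintegral_prod_right'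
    simp only [e1]
    rw [lintegral_const_mul _ hm1, lintegral_prod_symm _ hm1.aemeasurable,
      lintegral_prod_symm _ (by fun_prop), ← lintegral_const_mul _ (by fun_prop),
      ← lintegral_const_mul]
    · refine lintegral_mono_ae ?_
      filter_upwards [hx] with y hy1
      have := lintegral_lintegral_sub_sq_le (h := fun t => ux (t, y)) (f := fun t => u (t, y))
        (by fun_prop) hy1
      calc σ * ∫⁻ x, ∫⁻ x', ‖u (x, y) - u (x', y)‖ₑ ^ 2 ∂μ ∂μ
          = σ * ∫⁻ x, ∫⁻ x', ‖u (x', y) - u (x, y)‖ₑ ^ 2 ∂μ ∂μ := by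
            simp only [enorm_sub_rev]
        _ ≤ σ * (σ ^ 3 * ∫⁻ x, ‖ux (x, y)‖ₑ ^ 2 ∂μ) := by gcongr
        _ = σ ^ 4 * ∫⁻ x, ‖ux (x, y)‖ₑ ^ 2 ∂μ := by ring
    · exact Measurable.lintegral_prod_left' (f := fun q : ℝ × ℝ => ‖ux q‖ₑ ^ 2) (by fun_prop)
  have hD2 : ∫⁻ q, ∫⁻ q', ‖u (q'.1, q.2) - u (q'.1, q'.2)‖ₑ ^ 2 ∂μ.prod ν ∂μ.prod ν
      ≤ σ ^ 4 * ∫⁻ q, ‖uy q‖ₑ ^ 2 ∂μ.prod ν := by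
    have hm : Measurable fun p : ℝ × (ℝ × ℝ) => ‖u (p.2.1, p.1) - u (p.2.1, p.2.2)‖ₑ ^ 2 := by
      fun_prop
    have hm1 : Measurable fun y : ℝ =>
        ∫⁻ q', ‖u (q'.1, y) - u (q'.1, q'.2)‖ₑ ^ 2 ∂μ.prod ν := hm.lintegral_prod_right'
    rw [lintegral_prod_symm (μ := μ) (ν := ν) (fun q : ℝ × ℝ =>
      ∫⁻ q', ‖u (q'.1, q.2) - u (q'.1, q'.2)‖ₑ ^ 2 ∂μ.prod ν)
      (hm1.comp measurable_snd).aemeasurable]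
    simp only [lintegral_const, hμ1]
    rw [lintegral_mul_const _ hm1]
    have hm2 : Measurable fun p : (ℝ × ℝ) × ℝ => ‖u (p.1.2, p.1.1) - u (p.1.2, p.2)‖ₑ ^ 2 := by
      fun_prop
    have hm3 : Measurable fun p : ℝ × ℝ => ∫⁻ y', ‖u (p.2, p.1) - u (p.2, y')‖ₑ ^ 2 ∂ν :=
      hm2.lintegral_prod_right'
    have e1 : ∫⁻ y, ∫⁻ q', ‖u (q'.1, y) - u (q'.1, q'.2)‖ₑ ^ 2 ∂μ.prod ν ∂ν
        = ∫⁻ x, ∫⁻ y, ∫⁻ y', ‖u (x, y) - u (x, y')‖ₑ ^ 2 ∂ν ∂ν ∂μ := by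
      rw [lintegral_lintegral_swap (μ := μ) (ν := ν)
        (f := fun x y => ∫⁻ y', ‖u (x, y) - u (x, y')‖ₑ ^ 2 ∂ν)
        (hm3.comp measurable_swap).aemeasurable]
      refine lintegral_congr fun y => ?_
      rw [lintegral_prod _ (by fun_prop)]
    rw [e1, mul_comm, lintegral_prod _ (by fun_prop), ← lintegral_const_mul _ (by fun_prop),
      ← lintegral_const_mul _ (Measurable.lintegral_prod_right'
        (f := fun q : ℝ × ℝ => ‖uy q‖ₑ ^ 2) (by fun_prop))]
    refine lintegral_mono_ae ?_
    filter_upwards [hy] with x hx1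
    have := lintegral_lintegral_sub_sq_le (h := fun t => uy (x, t)) (f := fun t => u (x, t))
      (by fun_prop) hx1
    calc σ * ∫⁻ y, ∫⁻ y', ‖u (x, y) - u (x, y')‖ₑ ^ 2 ∂ν ∂ν
        = σ * ∫⁻ y, ∫⁻ y', ‖u (x, y') - u (x, y)‖ₑ ^ 2 ∂ν ∂ν := by
          simp only [enorm_sub_rev]
      _ ≤ σ * (σ ^ 3 * ∫⁻ y, ‖uy (x, y)‖ₑ ^ 2 ∂ν) := by gcongr
      _ = σ ^ 4 * ∫⁻ y, ‖uy (x, y)‖ₑ ^ 2 ∂ν := by ring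
  set G := ∫⁻ q, (‖ux q‖ₑ ^ 2 + ‖uy q‖ₑ ^ 2) ∂μ.prod ν with hG
  have hD : ∫⁻ q, ∫⁻ q', ‖u q - u q'‖ₑ ^ 2 ∂μ.prod ν ∂μ.prod ν ≤ 2 * (σ ^ 4 * G) := by
    have hm1 : Measurable fun q : ℝ × ℝ =>
        ∫⁻ q', ‖u (q.1, q.2) - u (q'.1, q.2)‖ₑ ^ 2 ∂μ.prod ν := by
      have : Measurable fun p : (ℝ × ℝ) × (ℝ × ℝ) =>
        ‖u (p.1.1, p.1.2) - u (p.2.1, p.1.2)‖ₑ ^ 2 := by fun_prop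
      exact this.lintegral_prod_right'
    calc ∫⁻ q, ∫⁻ q', ‖u q - u q'‖ₑ ^ 2 ∂μ.prod ν ∂μ.prod ν
        ≤ ∫⁻ q, ∫⁻ q', 2 * (‖u (q.1, q.2) - u (q'.1, q.2)‖ₑ ^ 2
          + ‖u (q'.1, q.2) - u (q'.1, q'.2)‖ₑ ^ 2) ∂μ.prod ν ∂μ.prod ν := by
          refine lintegral_mono fun q => lintegral_mono fun q' => ?_
          refine le_trans (le_of_eq ?_) (enorm_add_sq_le _ _)
          simp
      _ = 2 * ((∫⁻ q, ∫⁻ q', ‖u (q.1, q.2) - u (q'.1, q.2)‖ₑ ^ 2 ∂μ.prod ν ∂μ.prod ν)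
          + ∫⁻ q, ∫⁻ q', ‖u (q'.1, q.2) - u (q'.1, q'.2)‖ₑ ^ 2 ∂μ.prod ν ∂μ.prod ν) := by
          rw [← lintegral_add_left hm1, ← lintegral_const_mul']
          · refine lintegral_congr fun q => ?_
            rw [lintegral_const_mul _ (by fun_prop), lintegral_add_left (by fun_prop)]
          · simp
      _ ≤ 2 * (σ ^ 4 * G) := by
          have hGe : σ ^ 4 * G = σ ^ 4 * (∫⁻ q, ‖ux q‖ₑ ^ 2 ∂μ.prod ν)
              + σ ^ 4 * ∫⁻ q, ‖uy q‖ₑ ^ 2 ∂μ.prod ν := by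
            rw [hG, lintegral_add_left (by fun_prop), mul_add]
          rw [hGe]
          gcongr
  set m := ∫ q, u q ∂μ.prod ν with hm
  have hpt : ∀ q, ‖u q‖ₑ ^ 2 ≤ 2 * (τ ^ 4 * ‖m‖ₑ ^ 2
      + τ ^ 4 * (σ ^ 2 * ∫⁻ q', ‖u q - u q'‖ₑ ^ 2 ∂μ.prod ν)) := by
    intro q
    -- The mean value of u plus the average deviation from it; the square has area s².
    have e : u q = s⁻¹ ^ 2 * m + s⁻¹ ^ 2 * ∫ q', (u q - u q') ∂μ.prod ν := by
      rw [integral_sub (integrable_const _) hint, integral_const, hTr, smul_eq_mul]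
      field_simp
      ring
    have hτe : ‖s⁻¹ ^ 2‖ₑ = τ ^ 2 := by
      rw [Real.enorm_eq_ofReal (by positivity), hτ, ENNReal.ofReal_pow (by positivity)]
    have h1 := enorm_integral_sq_le (μ := μ.prod ν) (h := fun q' => u q - u q') (by fun_prop)
    rw [hT] at h1
    calc ‖u q‖ₑ ^ 2 = ‖s⁻¹ ^ 2 * m + s⁻¹ ^ 2 * ∫ q', (u q - u q') ∂μ.prod ν‖ₑ ^ 2 := by rw [← e]
      _ ≤ _ := enorm_add_sq_le _ _
      _ = 2 * (τ ^ 4 * ‖m‖ₑ ^ 2 + τ ^ 4 * ‖∫ q', (u q - u q') ∂μ.prod ν‖ₑ ^ 2) := by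
          rw [enorm_mul, enorm_mul, hτe]; ring
      _ ≤ _ := by gcongr
  have hmq : Measurable fun q : ℝ × ℝ => ∫⁻ q', ‖u q - u q'‖ₑ ^ 2 ∂μ.prod ν := by
    have : Measurable fun p : (ℝ × ℝ) × (ℝ × ℝ) => ‖u p.1 - u p.2‖ₑ ^ 2 := by fun_prop
    exact this.lintegral_prod_right'
  calc ∫⁻ q, ‖u q‖ₑ ^ 2 ∂μ.prod ν
      ≤ ∫⁻ q, 2 * (τ ^ 4 * ‖m‖ₑ ^ 2
        + τ ^ 4 * (σ ^ 2 * ∫⁻ q', ‖u q - u q'‖ₑ ^ 2 ∂μ.prod ν)) ∂μ.prod ν :=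
        lintegral_mono hpt
    _ = 2 * (τ ^ 4 * ‖m‖ₑ ^ 2 * σ ^ 2
        + τ ^ 4 * (σ ^ 2 * ∫⁻ q, ∫⁻ q', ‖u q - u q'‖ₑ ^ 2 ∂μ.prod ν ∂μ.prod ν)) := by
        rw [lintegral_const_mul _ (by fun_prop), lintegral_add_left (by fun_prop), lintegral_const,
          hT, lintegral_const_mul _ (by fun_prop), lintegral_const_mul _ hmq]
    _ ≤ 2 * (τ ^ 4 * ‖m‖ₑ ^ 2 * σ ^ 2 + τ ^ 4 * (σ ^ 2 * (2 * (σ ^ 4 * G)))) := by gcongr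
    _ = 4 * ((τ * σ) ^ 4 * σ ^ 2) * G + 2 * ((τ * σ) ^ 2 * τ ^ 2) * ‖m‖ₑ ^ 2 := by ring
    _ = _ := by rw [hστ]; ring

end Poincare

/-! ### Finite control on a compact core by a grid of small squares. -/

section CompactCore

/-- A square of the grid of mesh `s` in the plane. -/
def gridSquare (s : ℝ) (n : ℤ × ℤ) : Set (ℝ × ℝ) :=
  Ico (n.1 * s) (n.1 * s + s) ×ˢ Ico (n.2 * s) (n.2 * s + s)

theorem measurableSet_gridSquare (s : ℝ) (n : ℤ × ℤ) : MeasurableSet (gridSquare s n) :=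
  measurableSet_Ico.prod measurableSet_Ico

theorem mem_gridSquare_iff {s : ℝ} (hs : 0 < s) {n : ℤ × ℤ} {q : ℝ × ℝ} :
    q ∈ gridSquare s n ↔ (⌊q.1 / s⌋, ⌊q.2 / s⌋) = n := by
  have h : ∀ (x : ℝ) (z : ℤ), x ∈ Ico (z * s) (z * s + s) ↔ ⌊x / s⌋ = z := by
    intro x z
    rw [Int.floor_eq_iff, le_div_iff₀ hs, div_lt_iff₀ hs, mem_Ico, add_mul, one_mul]
  rw [gridSquare, mem_prod, h, h, Prod.ext_iff]

theorem dist_le_of_mem_gridSquare {s : ℝ} {n : ℤ × ℤ} {q q' : ℝ × ℝ} (h : q ∈ gridSquare s n)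
    (h' : q' ∈ gridSquare s n) : dist q q' ≤ s := by
  obtain ⟨h1, h2⟩ := h
  obtain ⟨h1', h2'⟩ := h'
  rw [Prod.dist_eq, max_le_iff, Real.dist_eq, Real.dist_eq, abs_le, abs_le]
  refine ⟨⟨?_, ?_⟩, ?_, ?_⟩ <;> linarith [h1.1, h1.2, h2.1, h2.2, h1'.1, h1'.2, h2'.1, h2'.2]

theorem finite_gridSquare_inter {s : ℝ} (hs : 0 < s) {K : Set (ℝ × ℝ)} (hK : IsCompact K) :
    {n : ℤ × ℤ | (gridSquare s n ∩ K).Nonempty}.Finite := by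
  obtain ⟨R, hR⟩ := hK.isBounded.subset_closedBall 0
  refine (Set.Finite.prod (finite_Icc ⌊-R / s⌋ ⌊R / s⌋) (finite_Icc ⌊-R / s⌋ ⌊R / s⌋)).subset ?_
  rintro n ⟨q, hq, hqK⟩
  have hb := hR hqK
  rw [mem_closedBall_zero_iff, Prod.norm_def, max_le_iff, Real.norm_eq_abs, Real.norm_eq_abs,
    abs_le, abs_le] at hb
  rw [mem_gridSquare_iff hs] at hq
  rw [← hq]
  obtain ⟨⟨h1, h2⟩, h3, h4⟩ := hb
  refine ⟨⟨?_, ?_⟩, ?_, ?_⟩ <;> exact Int.floor_le_floor (by gcongr)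

/-- A function in `H¹(Ω, γ₂)` with Borel measurable representatives. -/
structure MeasurableH1Plane (Ω : Set (ℝ × ℝ)) (u ux uy : ℝ × ℝ → ℝ) : Prop where
  measurable : Measurable u
  measurable_dx : Measurable ux
  measurable_dy : Measurable uy
  memH1 : MemH1Plane Ω u ux uy

theorem setLIntegral_gauss2_le_volume (s : Set (ℝ × ℝ)) (F : ℝ × ℝ → ENNReal) :
    ∫⁻ q in s, F q ∂gauss2 ≤ ∫⁻ q in s, F q := by
  rw [gauss2_eq_withDensity]
  exact lintegral_mono' (Measure.restrict_mono subset_rfl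
    (withDensity_le_self gaussDensity2_le_one)) le_rfl

theorem setLIntegral_volume_le_gauss2 {s : Set (ℝ × ℝ)} (hs : MeasurableSet s) {c : ℝ}
    (hc : 0 < c) (h : ∀ q ∈ s, c ≤ gaussDensity2 q) (F : ℝ × ℝ → ENNReal) :
    ∫⁻ q in s, F q ≤ ENNReal.ofReal c⁻¹ * ∫⁻ q in s, F q ∂gauss2 := by
  rw [gauss2_eq_withDensity, ← smul_eq_mul, ← lintegral_smul_measure]
  exact lintegral_mono'
    (restrict_le_smul_withDensity continuous_gaussDensity2.measurable hs hc h) le_rfl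

/-- On a compact subset, the `L²` norm is controlled by a small multiple of the Dirichlet energy and
finitely many averages. -/
theorem exists_finite_control_compact {Ω : Set (ℝ × ℝ)} (hΩ : IsOpen Ω)
    (hcx : ∀ y, OrdConnected {x | (x, y) ∈ Ω}) (hcy : ∀ x, OrdConnected {y | (x, y) ∈ Ω})
    {K : Set (ℝ × ℝ)} (hK : IsCompact K) (hKΩ : K ⊆ Ω) {ε : ℝ} (hε : 0 < ε) :
    ∃ (s : ℝ) (F : Finset (ℤ × ℤ)) (C : ℝ), 0 ≤ C ∧
      (∀ n ∈ F, gridSquare s n ⊆ Ω ∧ ∃ c > 0, ∀ q ∈ gridSquare s n, c ≤ gaussDensity2 q) ∧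
      ∀ u ux uy, MeasurableH1Plane Ω u ux uy →
        ∫⁻ q in K, ‖u q‖ₑ ^ 2 ∂gauss2
          ≤ ENNReal.ofReal ε * (∫⁻ q in Ω, (‖ux q‖ₑ ^ 2 + ‖uy q‖ₑ ^ 2) ∂gauss2)
            + ENNReal.ofReal C * ∑ n ∈ F, ‖∫ q in gridSquare s n, u q‖ₑ ^ 2 := by
  -- Grid squares of mesh at most η that meet `K` stay in this compact thickening, on which the
  -- Gaussian density has a positive lower bound c.
  obtain ⟨η, hη, hηΩ⟩ := hK.exists_cthickening_subset_open hΩ hKΩ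
  obtain ⟨c, hc, hcρ⟩ := (hK.cthickening (r := η)).exists_forall_le'
    continuous_gaussDensity2.continuousOn (a := 0) fun q _ => gaussDensity2_pos q
  -- 4s² is the Poincaré constant, and c⁻¹ is the price of passing from Lebesgue to Gaussian energy.
  obtain ⟨s, hs, hsη, hsε⟩ : ∃ s > 0, s ≤ η ∧ 4 * s ^ 2 * c⁻¹ ≤ ε := by
    refine ⟨min η (min 1 (ε * c / 4)), by positivity, min_le_left _ _, ?_⟩
    set s := min η (min 1 (ε * c / 4))
    have h0 : 0 < s := by positivity
    have h1 : s ≤ 1 := (min_le_right _ _).trans (min_le_left _ _)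
    have h2 : s ≤ ε * c / 4 := (min_le_right _ _).trans (min_le_right _ _)
    rw [← div_eq_mul_inv, div_le_iff₀ hc]
    nlinarith
  set F := (finite_gridSquare_inter hs hK).toFinset with hF
  have hQ : ∀ n ∈ F, gridSquare s n ⊆ Metric.cthickening η K := by
    intro n hn q hq
    obtain ⟨q', hq', hqK⟩ := (finite_gridSquare_inter hs hK).mem_toFinset.1 hn
    exact Metric.mem_cthickening_of_dist_le q q' η K hqK
      ((dist_le_of_mem_gridSquare hq hq').trans hsη)
  refine ⟨s, F, 2 * s⁻¹ ^ 2, by positivity,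
    fun n hn => ⟨(hQ n hn).trans hηΩ, c, hc, fun q hq => hcρ q (hQ n hn hq)⟩,
    fun u ux uy h => ?_⟩
  have hum := h.measurable
  have huxm := h.measurable_dx
  have huym := h.measurable_dy
  have sx := h.memH1.weakDeriv_dx.ae_slice hΩ hcx h.measurable h.measurable_dx
  have sy := (h.memH1.weakDeriv_dy.swap hΩ).ae_slice (hΩ.preimage continuous_swap)
    (fun x => hcy x) (h.measurable.comp measurable_swap) (h.measurable_dy.comp measurable_swap)
  have hsq : ∀ n ∈ F, ∫⁻ q in gridSquare s n, ‖u q‖ₑ ^ 2 ∂gauss2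
      ≤ ENNReal.ofReal ε * (∫⁻ q in gridSquare s n, (‖ux q‖ₑ ^ 2 + ‖uy q‖ₑ ^ 2) ∂gauss2)
        + ENNReal.ofReal (2 * s⁻¹ ^ 2) * ‖∫ q in gridSquare s n, u q‖ₑ ^ 2 := by
    intro n hn
    have hQΩ : gridSquare s n ⊆ Ω := (hQ n hn).trans hηΩ
    have hint : IntegrableOn u (gridSquare s n) :=
      (h.memH1.weakDeriv_dx.locInt.integrableOn_compact_subset hηΩ hK.cthickening).mono_set
        (hQ n hn)
    have key := lintegral_sq_le_poincare hs hum huxm huym hint (by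
      filter_upwards [ae_restrict_of_ae sx, ae_restrict_mem measurableSet_Ico] with y hy hyI
      filter_upwards [ae_restrict_of_ae hy, ae_restrict_mem measurableSet_Ico] with x₁ hx₁ hx₁I
      filter_upwards [ae_restrict_of_ae (hx₁ (hQΩ ⟨hx₁I, hyI⟩)),
        ae_restrict_mem measurableSet_Ico] with x₂ hx₂ hx₂I
      exact hx₂ (hQΩ ⟨hx₂I, hyI⟩)) (by
      filter_upwards [ae_restrict_of_ae sy, ae_restrict_mem measurableSet_Ico] with x hx hxI
      filter_upwards [ae_restrict_of_ae hx, ae_restrict_mem measurableSet_Ico] with y₁ hy₁ hy₁I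
      filter_upwards [ae_restrict_of_ae (hy₁ (hQΩ ⟨hxI, hy₁I⟩)),
        ae_restrict_mem measurableSet_Ico] with y₂ hy₂ hy₂I
      exact hy₂ (hQΩ ⟨hxI, hy₂I⟩))
    change ∫⁻ q in gridSquare s n, _ ≤ _ * (∫⁻ q in gridSquare s n, _)
      + _ * ‖∫ q in gridSquare s n, _‖ₑ ^ 2 at key
    refine (setLIntegral_gauss2_le_volume _ _).trans (key.trans ?_)
    gcongr ?_ + ?_
    · calc 4 * ENNReal.ofReal s ^ 2 * (∫⁻ q in gridSquare s n, (‖ux q‖ₑ ^ 2 + ‖uy q‖ₑ ^ 2))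
          ≤ 4 * ENNReal.ofReal s ^ 2 * (ENNReal.ofReal c⁻¹ *
            (∫⁻ q in gridSquare s n, (‖ux q‖ₑ ^ 2 + ‖uy q‖ₑ ^ 2) ∂gauss2)) := by
            gcongr
            exact setLIntegral_volume_le_gauss2 (measurableSet_gridSquare s n) hc
              (fun q hq => hcρ q (hQ n hn hq)) _
        _ = ENNReal.ofReal (4 * s ^ 2 * c⁻¹) *
            (∫⁻ q in gridSquare s n, (‖ux q‖ₑ ^ 2 + ‖uy q‖ₑ ^ 2) ∂gauss2) := by
            rw [ENNReal.ofReal_mul (by positivity), ENNReal.ofReal_mul (by positivity),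
              ENNReal.ofReal_pow hs.le]
            simp only [ENNReal.ofReal_ofNat]
            ring
        _ ≤ _ := by gcongr
    · rw [ENNReal.ofReal_mul (by positivity), ENNReal.ofReal_pow (by positivity)]
      simp
  have hcover : K ⊆ ⋃ n ∈ F, gridSquare s n := by
    intro q hq
    refine mem_iUnion₂.2 ⟨(⌊q.1 / s⌋, ⌊q.2 / s⌋), ?_, (mem_gridSquare_iff hs).2 rfl⟩
    exact (finite_gridSquare_inter hs hK).mem_toFinset.2 ⟨q, (mem_gridSquare_iff hs).2 rfl, hq⟩
  have hdisj : (F : Set (ℤ × ℤ)).PairwiseDisjoint (gridSquare s) := by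
    intro n _ m _ hnm
    refine Set.disjoint_left.2 fun q hq hq' => hnm ?_
    rw [mem_gridSquare_iff hs] at hq hq'
    exact hq.symm.trans hq'
  calc ∫⁻ q in K, ‖u q‖ₑ ^ 2 ∂gauss2
      ≤ ∫⁻ q in ⋃ n ∈ F, gridSquare s n, ‖u q‖ₑ ^ 2 ∂gauss2 := lintegral_mono_set hcover
    _ = ∑ n ∈ F, ∫⁻ q in gridSquare s n, ‖u q‖ₑ ^ 2 ∂gauss2 :=
        lintegral_biUnion_finset hdisj (fun n _ => measurableSet_gridSquare s n) _
    _ ≤ ∑ n ∈ F, (ENNReal.ofReal ε *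
          (∫⁻ q in gridSquare s n, (‖ux q‖ₑ ^ 2 + ‖uy q‖ₑ ^ 2) ∂gauss2)
        + ENNReal.ofReal (2 * s⁻¹ ^ 2) * ‖∫ q in gridSquare s n, u q‖ₑ ^ 2) :=
        Finset.sum_le_sum hsq
    _ = ENNReal.ofReal ε *
          (∫⁻ q in ⋃ n ∈ F, gridSquare s n, (‖ux q‖ₑ ^ 2 + ‖uy q‖ₑ ^ 2) ∂gauss2)
        + ENNReal.ofReal (2 * s⁻¹ ^ 2) * ∑ n ∈ F, ‖∫ q in gridSquare s n, u q‖ₑ ^ 2 := by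
        rw [Finset.sum_add_distrib, ← Finset.mul_sum, ← Finset.mul_sum,
          lintegral_biUnion_finset hdisj (fun n _ => measurableSet_gridSquare s n)]
    _ ≤ _ := by
        gcongr
        exact iUnion₂_subset fun n hn => (hQ n hn).trans hηΩ

end CompactCore

/-! ### Symmetric intervals and horizontal tails of odd functions. -/

section SymmetricInterval

theorem mem_openInterval_neg_iff {a : EReal} {x : ℝ} :
    x ∈ openInterval (-a) a ↔ ((|x| : ℝ) : EReal) < a := by
  rw [openInterval, mem_ofPred_eq, EReal.neg_lt_comm, ← EReal.coe_neg]
  rcases abs_cases x with ⟨h, h'⟩ | ⟨h, h'⟩ <;> rw [h]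
  · refine ⟨fun h => h.2, fun h => ⟨lt_of_le_of_lt ?_ h, h⟩⟩
    exact_mod_cast (by linarith : -x ≤ x)
  · refine ⟨fun h => h.1, fun h => ⟨h, lt_of_le_of_lt ?_ h⟩⟩
    exact_mod_cast (by linarith : x ≤ -x)

theorem mem_openInterval_of_abs_le {a : EReal} {x t : ℝ} (hx : x ∈ openInterval (-a) a)
    (h : |t| ≤ |x|) : t ∈ openInterval (-a) a := by
  rw [mem_openInterval_neg_iff] at *
  exact lt_of_le_of_lt (by exact_mod_cast h) hx

theorem zero_mem_openInterval {a : EReal} (ha : 0 < a) : (0 : ℝ) ∈ openInterval (-a) a := by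
  rw [mem_openInterval_neg_iff]
  simpa using ha

theorem isOpen_openInterval (α β : EReal) : IsOpen (openInterval α β) :=
  (isOpen_lt continuous_const continuous_coe_real_ereal).inter
    (isOpen_lt continuous_coe_real_ereal continuous_const)

theorem ordConnected_of_abs {S : Set ℝ} (h : ∀ x ∈ S, ∀ t : ℝ, |t| ≤ |x| → t ∈ S) :
    OrdConnected S := by
  refine ⟨fun x hx y hy t ht => ?_⟩
  rcases le_total |x| |y| with hxy | hxy
  · refine h y hy t ((abs_le_max_abs_abs ht.1 ht.2).trans ?_)
    rw [max_eq_right hxy]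
  · refine h x hx t ((abs_le_max_abs_abs ht.1 ht.2).trans ?_)
    rw [max_eq_left hxy]

theorem ordConnected_openInterval (a : EReal) : OrdConnected (openInterval (-a) a) :=
  ordConnected_of_abs fun _ hx _ ht => mem_openInterval_of_abs_le hx ht

theorem openInterval_top : openInterval (-(⊤ : EReal)) ⊤ = univ := by
  ext x; simp [openInterval]

theorem openInterval_coe (r : ℝ) : openInterval (-(r : EReal)) r = Ioo (-r) r := by
  ext x
  rw [mem_openInterval_neg_iff, EReal.coe_lt_coe_iff, abs_lt, mem_Ioo]

theorem measurePreserving_neg_gauss1 : MeasurePreserving (fun x : ℝ => -x) gauss1 gauss1 := by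
  refine ⟨measurable_neg, ?_⟩
  rw [gauss1, gaussianReal_map_neg, neg_zero]

/-- For finite a, the value 0 at the origin controls f near the ends. For a = ∞ the Hardy estimate
with P = 0 and k = 0 treats the left tail, and oddness copies it to the right. The threshold m works
for all symmetric subintervals at once, hence for all slices of a region. -/
theorem exists_odd_tail_le {a : EReal} (ha : 0 < a) {ε : ℝ} (hε : 0 < ε) :
    ∃ m ∈ openInterval (-a) a, 0 ≤ m ∧ ∀ S : Set ℝ, IsOpen S → OrdConnected S →
      (∀ x ∈ S, -x ∈ S) → S ⊆ openInterval (-a) a → (0 : ℝ) ∈ S → ∀ f h : ℝ → ℝ, Measurable h →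
      (∀ᵐ x, x ∈ S → f x = ∫ t in (0 : ℝ)..x, h t) → (∀ᵐ x, x ∈ S → f (-x) = - f x) →
      ∫⁻ x in S ∩ {x | m < |x|}, ‖f x‖ₑ ^ 2 ∂gauss1
        ≤ ENNReal.ofReal ε * ∫⁻ x in S, (‖f x‖ₑ ^ 2 + ‖h x‖ₑ ^ 2) ∂gauss1 := by
  induction a using EReal.rec with
  | bot => simp at ha
  | coe r =>
    have hr : 0 < r := by exact_mod_cast ha
    rw [openInterval_coe]
    have hm : max 0 (r - ε / (2 * r)) < r := max_lt hr (sub_lt_self _ (by positivity))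
    have hm0 : 0 ≤ max 0 (r - ε / (2 * r)) := le_max_left _ _
    refine ⟨max 0 (r - ε / (2 * r)), ⟨by linarith, hm⟩, hm0,
      fun S hS hc _ hSI h0 f h hh hf _ => ?_⟩
    refine (setLIntegral_near_ends_le hS.measurableSet hc h0 hm.le hSI hh hf).trans ?_
    gcongr ENNReal.ofReal ?_ * ?_
    · have : r - ε / (2 * r) ≤ max 0 (r - ε / (2 * r)) := le_max_right _ _
      have h2 : r - max 0 (r - ε / (2 * r)) ≤ ε / (2 * r) := by linarith
      calc 2 * (r - max 0 (r - ε / (2 * r))) * r ≤ 2 * (ε / (2 * r)) * r := by gcongr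
        _ = ε := by field_simp
    · exact lintegral_mono fun x => le_add_self
  | top =>
    -- The two tails contribute 8 / M² each.
    obtain ⟨M, hM, hMε⟩ : ∃ M : ℝ, 0 < M ∧ 16 / M ^ 2 ≤ ε := by
      refine ⟨max 1 (16 / ε), by positivity, ?_⟩
      have h1 : 1 ≤ max 1 (16 / ε) := le_max_left _ _
      have h2 : 16 / ε ≤ max 1 (16 / ε) := le_max_right _ _
      rw [div_le_iff₀ (by positivity)]
      rw [div_le_iff₀ hε] at h2
      nlinarith
    refine ⟨M, by rw [openInterval_top]; trivial, hM.le, fun S hS hc hsym _ h0 f h hh hf hodd => ?_⟩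
    have hS' := hS.measurableSet
    have key := setLIntegral_tail_le hS hc le_rfl hM (by linarith) (by simpa using h0) hh (k := 0)
      (by simpa using hf)
    have hneg : ∫⁻ x in S ∩ Ici M, ‖f x‖ₑ ^ 2 ∂gauss1
        = ∫⁻ x in S ∩ Iic (-M), ‖f x‖ₑ ^ 2 ∂gauss1 := by
      have hpre : (fun x : ℝ => -x) ⁻¹' (S ∩ Ici M) = S ∩ Iic (-M) := by
        ext x
        simp only [mem_preimage, mem_inter_iff, mem_Ici, mem_Iic, le_neg]
        exact and_congr_left fun _ => ⟨fun h => by simpa using hsym _ h, hsym x⟩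
      rw [← measurePreserving_neg_gauss1.setLIntegral_comp_preimage_emb
        (MeasurableEquiv.neg ℝ).measurableEmbedding, hpre]
      refine setLIntegral_congr_fun_ae (hS'.inter measurableSet_Iic) ?_
      filter_upwards [gauss1_absolutelyContinuous.ae_le hodd] with x hx hxS
      rw [hx hxS.1, enorm_neg]
    have hsub : S ∩ {x | M < |x|} ⊆ (S ∩ Iic (-M)) ∪ (S ∩ Ici M) := by
      rintro x ⟨hxS, hxM⟩
      have hxM' : M < |x| := hxM
      rcases lt_abs.1 hxM' with h | h
      · exact Or.inr ⟨hxS, h.le⟩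
      · exact Or.inl ⟨hxS, by rw [mem_Iic]; linarith⟩
    calc ∫⁻ x in S ∩ {x | M < |x|}, ‖f x‖ₑ ^ 2 ∂gauss1
        ≤ ∫⁻ x in (S ∩ Iic (-M)) ∪ (S ∩ Ici M), ‖f x‖ₑ ^ 2 ∂gauss1 := lintegral_mono_set hsub
      _ ≤ (∫⁻ x in S ∩ Iic (-M), ‖f x‖ₑ ^ 2 ∂gauss1) + ∫⁻ x in S ∩ Ici M, ‖f x‖ₑ ^ 2 ∂gauss1 :=
          lintegral_union_le _ _ _
      _ ≤ ENNReal.ofReal (8 / M ^ 2) * (∫⁻ x in S, (‖f x‖ₑ ^ 2 + ‖h x‖ₑ ^ 2) ∂gauss1)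
          + ENNReal.ofReal (8 / M ^ 2) * ∫⁻ x in S, (‖f x‖ₑ ^ 2 + ‖h x‖ₑ ^ 2) ∂gauss1 := by
          rw [hneg]; gcongr
      _ = ENNReal.ofReal (16 / M ^ 2) * ∫⁻ x in S, (‖f x‖ₑ ^ 2 + ‖h x‖ₑ ^ 2) ∂gauss1 := by
          rw [← add_mul, ← ENNReal.ofReal_add (by positivity) (by positivity)]
          congr 2; ring
      _ ≤ _ := by gcongr

end SymmetricInterval

/-! ### Regions below a profile, and control of odd functions on them. -/

section Region

/-- The conditions on the upper profile `p` of a region `{-a < x < a, y < p x}`: it is continuous,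
and decreasing in `|x|`. -/
structure IsRegionProfile (a : EReal) (p : ℝ → ℝ) : Prop where
  pos : 0 < a
  cont : ContinuousOn p (openInterval (-a) a)
  anti : ∀ x ∈ openInterval (-a) a, ∀ t, |t| ≤ |x| → p x ≤ p t

variable {a : EReal} {p : ℝ → ℝ}

theorem IsRegionProfile.continuousOn_sub (hp : IsRegionProfile a p) :
    ContinuousOn (fun q : ℝ × ℝ => p q.1 - q.2) (openInterval (-a) a ×ˢ univ) :=
  (hp.cont.comp continuousOn_fst fun _ hq => hq.1).sub continuousOn_snd

theorem IsRegionProfile.isOpen_inter (hp : IsRegionProfile a p) {U : Set ℝ} (hU : IsOpen U) :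
    IsOpen {q : ℝ × ℝ | q.1 ∈ openInterval (-a) a ∧ p q.1 - q.2 ∈ U} := by
  have := hp.continuousOn_sub.isOpen_inter_preimage
    ((isOpen_openInterval (-a) a).prod isOpen_univ) hU
  convert this using 1
  ext q; simp

theorem IsRegionProfile.isOpen (hp : IsRegionProfile a p) : IsOpen (regionBelow a p) := by
  have := hp.isOpen_inter isOpen_Ioi (U := Ioi 0)
  convert this using 1
  ext q; simp [regionBelow]

theorem IsRegionProfile.mem_of_abs_le (hp : IsRegionProfile a p) {x y t : ℝ}
    (h : (x, y) ∈ regionBelow a p) (ht : |t| ≤ |x|) : (t, y) ∈ regionBelow a p :=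
  ⟨mem_openInterval_of_abs_le h.1 ht, lt_of_lt_of_le h.2 (hp.anti x h.1 t ht)⟩

theorem IsRegionProfile.ordConnected_horizontal (hp : IsRegionProfile a p) (y : ℝ) :
    OrdConnected {x | (x, y) ∈ regionBelow a p} :=
  ordConnected_of_abs fun _ hx _ ht => hp.mem_of_abs_le hx ht

theorem ordConnected_vertical_regionBelow (x : ℝ) :
    OrdConnected {y | (x, y) ∈ regionBelow a p} :=
  ⟨fun _ hy _ hy' _ ht => ⟨hy.1, lt_of_le_of_lt ht.2 hy'.2⟩⟩

theorem IsRegionProfile.neg_mem (hp : IsRegionProfile a p) {x y : ℝ}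
    (h : (x, y) ∈ regionBelow a p) : (-x, y) ∈ regionBelow a p :=
  hp.mem_of_abs_le h (by simp)

theorem ae_ae_of_ae_plane {P : ℝ × ℝ → Prop} (h : ∀ᵐ q, P q) : ∀ᵐ y : ℝ, ∀ᵐ x : ℝ, P (x, y) :=
  Measure.ae_ae_of_ae_prod
    ((Measure.measurePreserving_swap (μ := (volume : Measure ℝ))
      (ν := (volume : Measure ℝ))).quasiMeasurePreserving.ae h)

/-- Oddness removes the integration constant when the primitive is based at 0, a point that lies in
every nonempty slice. -/
theorem IsRegionProfile.ae_odd_slice (hp : IsRegionProfile a p) {u ux uy : ℝ × ℝ → ℝ}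
    (h : MeasurableH1Plane (regionBelow a p) u ux uy)
    (hodd : ∀ᵐ q ∂volume.restrict (regionBelow a p), u (-q.1, q.2) = - u q) :
    ∀ᵐ y : ℝ, (0, y) ∈ regionBelow a p →
      ∫⁻ x in {x | (x, y) ∈ regionBelow a p}, ‖ux (x, y)‖ₑ ^ 2 ∂gauss1 ≠ ⊤ ∧
      (∀ᵐ x, x ∈ {x | (x, y) ∈ regionBelow a p} → u (x, y) = ∫ t in (0 : ℝ)..x, ux (t, y)) ∧
      ∀ᵐ x, x ∈ {x | (x, y) ∈ regionBelow a p} → u (-x, y) = - u (x, y) := by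
  have hsl := h.memH1.weakDeriv_dx.ae_slice_primitive hp.isOpen hp.ordConnected_horizontal
    h.measurable h.measurable_dx (lintegral_enorm_sq_ne_top_of_memLp h.memH1.memLp_dx)
  have ho := ae_ae_of_ae_plane ((ae_restrict_iff' hp.isOpen.measurableSet).1 hodd)
  have hmx := h.measurable_dx
  filter_upwards [hsl, ho] with y hy1 hy2 h0
  obtain ⟨k, hk⟩ := hy1.2 0 h0
  have hSo : IsOpen {x | (x, y) ∈ regionBelow a p} := hp.isOpen.preimage (by fun_prop)
  have hk0 : k = 0 := eq_zero_of_odd_primitive hSo h0 (fun x hx => hp.neg_mem hx)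
    (f := fun x => u (x, y))
    (continuousOn_primitive_of_lintegral hSo (hp.ordConnected_horizontal y) (by fun_prop)
      hy1.1 h0) hk hy2
  refine ⟨hy1.1, ?_, hy2⟩
  simpa [hk0] using hk

/-- On a region `{-a < x < a, y < p x}`, the `L²` norm of an odd function is controlled by a small
multiple of its `H¹` norm and finitely many averages. -/
theorem IsRegionProfile.exists_finite_control (hp : IsRegionProfile a p) {ε : ℝ} (hε : 0 < ε) :
    ∃ (s : ℝ) (F : Finset (ℤ × ℤ)) (C : ℝ), 0 ≤ C ∧
      (∀ n ∈ F, gridSquare s n ⊆ regionBelow a p ∧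
        ∃ c > 0, ∀ q ∈ gridSquare s n, c ≤ gaussDensity2 q) ∧
      ∀ u ux uy, MeasurableH1Plane (regionBelow a p) u ux uy →
        (∀ᵐ q ∂volume.restrict (regionBelow a p), u (-q.1, q.2) = - u q) →
        ∫⁻ q in regionBelow a p, ‖u q‖ₑ ^ 2 ∂gauss2
          ≤ ENNReal.ofReal ε * (∫⁻ q in regionBelow a p,
              (‖u q‖ₑ ^ 2 + (‖ux q‖ₑ ^ 2 + ‖uy q‖ₑ ^ 2)) ∂gauss2)
            + ENNReal.ofReal C * ∑ n ∈ F, ‖∫ q in gridSquare s n, u q‖ₑ ^ 2 := by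
  set Ω := regionBelow a p with hΩdef
  have hΩ : IsOpen Ω := hp.isOpen
  have hε4 : 0 < ε / 4 := by positivity
  obtain ⟨m, hmI, hm0, hm⟩ := exists_odd_tail_le hp.pos hε4
  have hI : ∀ x, |x| ≤ m → x ∈ openInterval (-a) a := fun x hx =>
    mem_openInterval_of_abs_le hmI (by rwa [abs_of_nonneg hm0])
  have hIcc : Icc (-m) m ⊆ openInterval (-a) a := fun x hx => hI x (abs_le.2 hx)
  obtain ⟨P₀, hP₀⟩ := isCompact_Icc.exists_bound_of_continuousOn (hp.cont.mono hIcc)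
  have hP₀0 : 0 ≤ P₀ := (norm_nonneg _).trans (hP₀ 0 ⟨by linarith, hm0⟩)
  -- The extra 1 puts (x, -P) strictly below the graph for all |x| ≤ m, so it serves as a common
  -- base height for the vertical primitives.
  set P := P₀ + 1 with hPdef
  have hP : ∀ x, |x| ≤ m → |p x| ≤ P₀ := fun x hx => hP₀ x (abs_le.1 hx)
  obtain ⟨M, hM, hPM, hMε⟩ : ∃ M : ℝ, 0 < M ∧ 2 * P ≤ M ∧ 8 / M ^ 2 ≤ ε / 4 := by
    have h1 : 2 * P ≤ max (2 * P) (32 / ε) := le_max_left _ _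
    have h2 : 32 / ε ≤ max (2 * P) (32 / ε) := le_max_right _ _
    have h3 : 1 ≤ max (2 * P) (32 / ε) := by linarith
    refine ⟨max (2 * P) (32 / ε), by positivity, h1, ?_⟩
    rw [div_le_iff₀ (by positivity)]
    rw [div_le_iff₀ hε] at h2
    nlinarith
  have hG := gaussDensity_pos (P + 1)
  obtain ⟨δ, hδ, hδ1, hδε⟩ : ∃ δ : ℝ, 0 < δ ∧ δ ≤ 1 ∧
      2 * (gaussDensity (P + 1))⁻¹ * δ ≤ ε / 4 := by
    refine ⟨min 1 (ε / 4 * gaussDensity (P + 1) / 2), by positivity, min_le_left _ _, ?_⟩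
    calc 2 * (gaussDensity (P + 1))⁻¹ * min 1 (ε / 4 * gaussDensity (P + 1) / 2)
        ≤ 2 * (gaussDensity (P + 1))⁻¹ * (ε / 4 * gaussDensity (P + 1) / 2) := by
          gcongr
          exact min_le_right _ _
      _ = ε / 4 := by field_simp
  -- The core consists of the points with |x| ≤ m at depth between δ and P + M below the graph.
  -- Points with y > -M have depth less than P + M, so what remains of Ω is a horizontal tail, a
  -- lower tail and a layer of thickness δ; each of the four pieces costs ε / 4.
  set K : Set (ℝ × ℝ) := (fun q : ℝ × ℝ => (q.1, p q.1 - q.2)) '' (Icc (-m) m ×ˢ Icc δ (P + M))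
    with hKdef
  have hK : IsCompact K := by
    refine (isCompact_Icc.prod isCompact_Icc).image_of_continuousOn ?_
    exact continuousOn_fst.prodMk (hp.continuousOn_sub.mono fun q hq => ⟨hIcc hq.1, mem_univ _⟩)
  have hKΩ : K ⊆ Ω := by
    rintro _ ⟨⟨x, s⟩, ⟨hx, hs⟩, rfl⟩
    exact ⟨hIcc hx, by simp only; linarith [hs.1]⟩
  obtain ⟨s, F, C, hC, hF, hcore⟩ := exists_finite_control_compact hΩ hp.ordConnected_horizontal
    ordConnected_vertical_regionBelow hK hKΩ hε4
  refine ⟨s, F, C, hC, hF, fun u ux uy h hodd => ?_⟩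
  have hum := h.measurable
  have huxm := h.measurable_dx
  have huym := h.measurable_dy
  set N := ∫⁻ q in Ω, (‖u q‖ₑ ^ 2 + (‖ux q‖ₑ ^ 2 + ‖uy q‖ₑ ^ 2)) ∂gauss2 with hN
  set A₁ : Set (ℝ × ℝ) := Ω ∩ {q | m < |q.1|} with hA₁
  set A₂ : Set (ℝ × ℝ) := Ω ∩ {q | |q.1| ≤ m ∧ q.2 ≤ -M} with hA₂
  set A₃ : Set (ℝ × ℝ) := Ω ∩ {q | |q.1| ≤ m ∧ p q.1 - q.2 < δ} with hA₃
  have mA₁ : MeasurableSet A₁ :=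
    hΩ.measurableSet.inter (measurableSet_lt measurable_const (by fun_prop))
  have mA₂ : MeasurableSet A₂ := hΩ.measurableSet.inter
    ((measurableSet_le (f := fun q : ℝ × ℝ => |q.1|) (by fun_prop) measurable_const).inter
      (measurableSet_le (f := fun q : ℝ × ℝ => q.2) (by fun_prop) measurable_const))
  have mA₃ : MeasurableSet A₃ := by
    have h1 := (hp.isOpen_inter (isOpen_Iio (a := δ))).measurableSet
    have h2 : A₃ = Ω ∩ ({q | |q.1| ≤ m} ∩
        {q : ℝ × ℝ | q.1 ∈ openInterval (-a) a ∧ p q.1 - q.2 ∈ Iio δ}) := by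
      ext q
      simp only [hA₃, mem_inter_iff, mem_ofPred_eq, mem_Iio]
      exact ⟨fun h => ⟨h.1, h.2.1, h.1.1, h.2.2⟩, fun h => ⟨h.1, h.2.1, h.2.2.2⟩⟩
    rw [h2]
    exact hΩ.measurableSet.inter ((measurableSet_le (by fun_prop) measurable_const).inter h1)
  have hcover : Ω ⊆ K ∪ (A₁ ∪ (A₂ ∪ A₃)) := by
    rintro ⟨x, y⟩ hq
    by_cases h1 : m < |x|
    · exact Or.inr (Or.inl ⟨hq, h1⟩)
    rw [not_lt] at h1
    by_cases h2 : y ≤ -M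
    · exact Or.inr (Or.inr (Or.inl ⟨hq, h1, h2⟩))
    by_cases h3 : p x - y < δ
    · exact Or.inr (Or.inr (Or.inr ⟨hq, h1, h3⟩))
    refine Or.inl ⟨(x, p x - y), ⟨abs_le.1 h1, ⟨not_lt.1 h3, ?_⟩⟩, by simp⟩
    have := (abs_le.1 (hP x h1)).2
    simp only
    linarith [not_le.1 h2]
  -- the horizontal tail
  have b₁ : ∫⁻ q in A₁, ‖u q‖ₑ ^ 2 ∂gauss2 ≤ ENNReal.ofReal (ε / 4) * N := by
    have hle : ∫⁻ q in Ω, (‖u q‖ₑ ^ 2 + ‖ux q‖ₑ ^ 2) ∂gauss2 ≤ N :=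
      lintegral_mono fun q => by gcongr; exact le_self_add
    refine le_trans ?_ (mul_le_mul_right hle _)
    rw [setLIntegral_gauss2_horizontal mA₁ (by fun_prop),
      setLIntegral_gauss2_horizontal hΩ.measurableSet (by fun_prop),
      ← lintegral_const_mul' _ _ ENNReal.ofReal_ne_top]
    refine lintegral_mono_ae (gauss1_absolutelyContinuous.ae_le ?_)
    filter_upwards [hp.ae_odd_slice h hodd] with y hy
    by_cases h0 : (0, y) ∈ Ω
    · obtain ⟨-, hy2, hy3⟩ := hy h0
      exact hm {x | (x, y) ∈ Ω} (hΩ.preimage (by fun_prop)) (hp.ordConnected_horizontal y)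
        (fun x hx => hp.neg_mem hx) (fun x hx => hx.1) h0 (fun x => u (x, y))
        (fun x => ux (x, y)) (by fun_prop) hy2 hy3
    · have : {x | (x, y) ∈ A₁} = ∅ := by
        refine eq_empty_of_forall_notMem fun x hx => h0 (hp.mem_of_abs_le hx.1 (by simp))
      simp [this]
  -- the vertical tails
  have hsl := (h.memH1.weakDeriv_dy.swap hΩ).ae_slice_primitive (hΩ.preimage continuous_swap)
    (fun x => ordConnected_vertical_regionBelow x) (hum.comp measurable_swap)
    (huym.comp measurable_swap) (by
      have := lintegral_enorm_sq_ne_top_of_memLp h.memH1.memLp_dy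
      rw [setLIntegral_gauss2_vertical hΩ.measurableSet (by fun_prop)] at this
      rw [setLIntegral_gauss2_horizontal (hΩ.preimage continuous_swap).measurableSet
        (by fun_prop)]
      exact this)
  have hle₂ : ∫⁻ q in Ω, (‖u q‖ₑ ^ 2 + ‖uy q‖ₑ ^ 2) ∂gauss2 ≤ N :=
    lintegral_mono fun q => by gcongr; exact le_add_self
  have hSx : ∀ x, |x| ≤ m → {y | (x, y) ∈ Ω} = Iio (p x) := by
    intro x hx
    ext y
    exact ⟨fun h => h.2, fun h => ⟨hI x hx, h⟩⟩
  have b₂ : ∫⁻ q in A₂, ‖u q‖ₑ ^ 2 ∂gauss2 ≤ ENNReal.ofReal (ε / 4) * N := by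
    refine le_trans ?_ (mul_le_mul_right hle₂ _)
    rw [setLIntegral_gauss2_vertical mA₂ (by fun_prop),
      setLIntegral_gauss2_vertical hΩ.measurableSet (by fun_prop),
      ← lintegral_const_mul' _ _ ENNReal.ofReal_ne_top]
    refine lintegral_mono_ae (gauss1_absolutelyContinuous.ae_le ?_)
    filter_upwards [hsl] with x hx
    by_cases hxm : |x| ≤ m
    · have hmem : (x, -P) ∈ Ω := ⟨hI x hxm, by
        have := (abs_le.1 (hP x hxm)).1
        simp only; linarith⟩
      obtain ⟨k, hk⟩ := hx.2 (-P) hmem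
      have key := setLIntegral_tail_le (S := {y | (x, y) ∈ Ω}) (hΩ.preimage (by fun_prop))
        (ordConnected_vertical_regionBelow x) (by linarith) hM hPM hmem
        (f := fun y => u (x, y)) (h := fun y => uy (x, y)) (by fun_prop) hk
      have hset : {y | (x, y) ∈ A₂} = {y | (x, y) ∈ Ω} ∩ Iic (-M) := by
        ext y
        exact ⟨fun h => ⟨h.1, h.2.2⟩, fun h => ⟨h.1, hxm, h.2⟩⟩
      rw [hset]
      refine key.trans ?_
      gcongr
    · have : {y | (x, y) ∈ A₂} = ∅ := eq_empty_of_forall_notMem fun y hy => hxm hy.2.1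
      simp [this]
  have b₃ : ∫⁻ q in A₃, ‖u q‖ₑ ^ 2 ∂gauss2 ≤ ENNReal.ofReal (ε / 4) * N := by
    refine le_trans ?_ (mul_le_mul_right hle₂ _)
    rw [setLIntegral_gauss2_vertical mA₃ (by fun_prop),
      setLIntegral_gauss2_vertical hΩ.measurableSet (by fun_prop),
      ← lintegral_const_mul' _ _ ENNReal.ofReal_ne_top]
    refine lintegral_mono_ae (gauss1_absolutelyContinuous.ae_le ?_)
    filter_upwards [hsl] with x hx
    by_cases hxm : |x| ≤ m
    · have hmem : (x, -P) ∈ Ω := ⟨hI x hxm, by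
        have := (abs_le.1 (hP x hxm)).1
        simp only; linarith⟩
      obtain ⟨k, hk⟩ := hx.2 (-P) hmem
      have hk' : ∀ᵐ y, y ∈ Iio (p x) → u (x, y) = k + ∫ t in -P..y, uy (x, t) := by
        rw [← hSx x hxm]; exact hk
      have key := setLIntegral_near_top_le (b := p x) (P := P) ((hP x hxm).trans (by linarith))
        hδ.le hδ1 hmem.2
        (f := fun y => u (x, y)) (h := fun y => uy (x, y)) (by fun_prop) (by fun_prop) hk'
      have hset : {y | (x, y) ∈ A₃} = Ioo (p x - δ) (p x) := by
        ext y
        refine ⟨fun h => ⟨?_, h.1.2⟩, fun h => ⟨⟨hI x hxm, h.2⟩, hxm, ?_⟩⟩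
        · have : p x - y < δ := h.2.2
          linarith
        · have := h.1
          simp only
          linarith
      rw [hset, hSx x hxm]
      refine key.trans ?_
      gcongr
    · have : {y | (x, y) ∈ A₃} = ∅ := eq_empty_of_forall_notMem fun y hy => hxm hy.2.1
      simp [this]
  have b₀ : ∫⁻ q in K, ‖u q‖ₑ ^ 2 ∂gauss2 ≤ ENNReal.ofReal (ε / 4) * N
      + ENNReal.ofReal C * ∑ n ∈ F, ‖∫ q in gridSquare s n, u q‖ₑ ^ 2 := by
    refine (hcore u ux uy h).trans ?_
    gcongr
    exact lintegral_mono fun q => le_add_self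
  calc ∫⁻ q in Ω, ‖u q‖ₑ ^ 2 ∂gauss2
      ≤ ∫⁻ q in K ∪ (A₁ ∪ (A₂ ∪ A₃)), ‖u q‖ₑ ^ 2 ∂gauss2 := lintegral_mono_set hcover
    _ ≤ (∫⁻ q in K, ‖u q‖ₑ ^ 2 ∂gauss2) + ((∫⁻ q in A₁, ‖u q‖ₑ ^ 2 ∂gauss2) +
        ((∫⁻ q in A₂, ‖u q‖ₑ ^ 2 ∂gauss2) + ∫⁻ q in A₃, ‖u q‖ₑ ^ 2 ∂gauss2)) := by
        refine (lintegral_union_le _ _ _).trans ?_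
        gcongr
        refine (lintegral_union_le _ _ _).trans ?_
        gcongr
        exact lintegral_union_le _ _ _
    _ ≤ (ENNReal.ofReal (ε / 4) * N
        + ENNReal.ofReal C * ∑ n ∈ F, ‖∫ q in gridSquare s n, u q‖ₑ ^ 2)
        + (ENNReal.ofReal (ε / 4) * N + (ENNReal.ofReal (ε / 4) * N
          + ENNReal.ofReal (ε / 4) * N)) := by gcongr
    _ = (4 * ENNReal.ofReal (ε / 4)) * N
        + ENNReal.ofReal C * ∑ n ∈ F, ‖∫ q in gridSquare s n, u q‖ₑ ^ 2 := by ring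
    _ = _ := by
        rw [show (4 : ENNReal) = ENNReal.ofReal 4 by simp, ← ENNReal.ofReal_mul (by norm_num)]
        congr 3
        ring

end Region

/-! ### Functions of x alone as Sobolev functions in the plane. -/

section Lift

theorem HasWeakDeriv.mono_set {E : Type*} [NormedAddCommGroup E] [NormedSpace ℝ E]
    [MeasureSpace E] {U V : Set E} (hVU : V ⊆ U) (hU : MeasurableSet U)
    {v : E} {u g : E → ℝ} (h : HasWeakDeriv U v u g) : HasWeakDeriv V v u g where
  locInt := h.locInt.mono_set hVU
  locInt_deriv := h.locInt_deriv.mono_set hVU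
  integral_eq φ h1 h2 h3 := by
    have key := h.integral_eq φ h1 h2 (h3.trans hVU)
    have z1 : ∀ x, x ∉ V → φ x = 0 := fun x hx =>
      image_eq_zero_of_notMem_tsupport fun h => hx (h3 h)
    have z2 : ∀ x, x ∉ V → fderiv ℝ φ x = 0 := fun x hx =>
      image_eq_zero_of_notMem_tsupport fun h => hx (h3 (tsupport_fderiv_subset ℝ h))
    rw [setIntegral_eq_of_subset_of_forall_sdiff_eq_zero hU hVU fun x hx => by simp [z2 x hx.2],
      setIntegral_eq_of_subset_of_forall_sdiff_eq_zero hU hVU fun x hx => by simp [z1 x hx.2]]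
      at key
    exact key

theorem gauss2_restrict_strip (I : Set ℝ) :
    gauss2.restrict (I ×ˢ univ) = (gauss1.restrict I).prod gauss1 := by
  rw [gauss2, ← Measure.prod_restrict, Measure.restrict_univ]

theorem integrable_mul_of_locallyIntegrableOn {U : Set (ℝ × ℝ)} {k ψ : ℝ × ℝ → ℝ}
    (hk : LocallyIntegrableOn k U volume) (hψ : Continuous ψ) (hc : HasCompactSupport ψ)
    (hs : tsupport ψ ⊆ U) : Integrable (fun q => k q * ψ q) volume := by
  have hK : IntegrableOn k (tsupport ψ) volume := hk.integrableOn_compact_subset hs hc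
  have : IntegrableOn (fun q => k q * ψ q) (tsupport ψ) volume :=
    hK.mul_continuousOn hψ.continuousOn hc
  exact this.integrable_of_forall_notMem_eq_zero fun q hq => by
    simp [image_eq_zero_of_notMem_tsupport hq]

/-- For the x-derivative, every horizontal slice of a plane test function is a test function on `I`.
For the y-derivative, z comes out of the inner integral and ∂_y φ integrates to 0 over each vertical
line. -/
theorem MemH1Line.memH1Plane_strip {I : Set ℝ} (hI : IsOpen I) {z dz : ℝ → ℝ}
    (h : MemH1Line I z dz) :
    MemH1Plane (I ×ˢ univ) (fun q => z q.1) (fun q => dz q.1) 0 := by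
  have hU : IsOpen (I ×ˢ (univ : Set ℝ)) := hI.prod isOpen_univ
  have m1 : MemLp (fun q : ℝ × ℝ => z q.1) 2 (gauss2.restrict (I ×ˢ univ)) := by
    rw [gauss2_restrict_strip]; exact h.memLp.comp_fst _
  have m2 : MemLp (fun q : ℝ × ℝ => dz q.1) 2 (gauss2.restrict (I ×ˢ univ)) := by
    rw [gauss2_restrict_strip]; exact h.memLp_deriv.comp_fst _
  have m3 : MemLp (0 : ℝ × ℝ → ℝ) 2 (gauss2.restrict (I ×ˢ univ)) := MemLp.zero'
  have l1 := locallyIntegrableOn_of_memLp_gauss2 hU m1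
  have l2 := locallyIntegrableOn_of_memLp_gauss2 hU m2
  have l3 := locallyIntegrableOn_of_memLp_gauss2 hU m3
  refine ⟨m1, m2, m3, ⟨l1, l2, fun φ h1 h2 h3 => ?_⟩, ⟨l1, l3, fun φ h1 h2 h3 => ?_⟩⟩
  · have hdc : ∀ v, Continuous fun q => fderiv ℝ φ q v := fun v =>
      (h1.continuous_fderiv (by simp)).clm_apply continuous_const
    have i1 := integrable_mul_of_locallyIntegrableOn l1 (hdc (1, 0)) (h2.fderiv_apply (𝕜 := ℝ) _)
      ((tsupport_fderiv_apply_subset ℝ _).trans h3)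
    have i2 := integrable_mul_of_locallyIntegrableOn l2 h1.continuous h2 h3
    have z1 : ∀ q : ℝ × ℝ, q ∉ I ×ˢ (univ : Set ℝ) → φ q = 0 := fun q hq =>
      image_eq_zero_of_notMem_tsupport fun h => hq (h3 h)
    have z2 : ∀ q : ℝ × ℝ, q ∉ I ×ˢ (univ : Set ℝ) → fderiv ℝ φ q = 0 := fun q hq =>
      image_eq_zero_of_notMem_tsupport fun h => hq (h3 (tsupport_fderiv_subset ℝ h))
    rw [setIntegral_eq_integral_of_forall_compl_eq_zero fun q hq => by simp [z2 q hq],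
      setIntegral_eq_integral_of_forall_compl_eq_zero fun q hq => by simp [z1 q hq],
      Measure.volume_eq_prod, integral_prod_symm _ i1, integral_prod_symm _ i2, ← integral_neg]
    refine integral_congr_ae (Eventually.of_forall fun y => ?_)
    have hemb : Topology.IsClosedEmbedding fun x : ℝ => (x, y) :=
      Function.LeftInverse.isClosedEmbedding (f := Prod.fst) (fun _ => rfl) continuous_fst
        (by fun_prop)
    have c1 : ContDiff ℝ ∞ fun x => φ (x, y) := h1.comp (by fun_prop)
    have c2 : HasCompactSupport fun x => φ (x, y) := h2.comp_isClosedEmbedding hemb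
    have c3 : tsupport (fun x => φ (x, y)) ⊆ I := by
      intro x hx
      exact (h3 (tsupport_comp_subset_preimage φ hemb.continuous hx)).1
    have key := h.weakDeriv.integral_eq _ c1 c2 c3
    have hd : ∀ x, fderiv ℝ (fun x => φ (x, y)) x 1 = fderiv ℝ φ (x, y) (1, 0) := by
      intro x
      have d1 : HasFDerivAt (fun x : ℝ => (x, y)) ((ContinuousLinearMap.id ℝ ℝ).prod 0) x :=
        (hasFDerivAt_id x).prodMk (hasFDerivAt_const y x)
      have d2 := ((h1.differentiable (by simp)) (x, y)).hasFDerivAt.comp x d1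
      change fderiv ℝ (φ ∘ fun x => (x, y)) x 1 = _
      rw [d2.fderiv]
      simp
    rw [setIntegral_eq_integral_of_forall_compl_eq_zero fun x hx => by
        rw [hd, z2 (x, y) fun h => hx h.1]; simp,
      setIntegral_eq_integral_of_forall_compl_eq_zero fun x hx => by
        rw [z1 (x, y) fun h => hx h.1]; simp] at key
    simpa only [hd] using key
  · have hdc : ∀ v, Continuous fun q => fderiv ℝ φ q v := fun v =>
      (h1.continuous_fderiv (by simp)).clm_apply continuous_const
    have i1 := integrable_mul_of_locallyIntegrableOn l1 (hdc (0, 1)) (h2.fderiv_apply (𝕜 := ℝ) _)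
      ((tsupport_fderiv_apply_subset ℝ _).trans h3)
    have z2 : ∀ q : ℝ × ℝ, q ∉ I ×ˢ (univ : Set ℝ) → fderiv ℝ φ q = 0 := fun q hq =>
      image_eq_zero_of_notMem_tsupport fun h => hq (h3 (tsupport_fderiv_subset ℝ h))
    rw [setIntegral_eq_integral_of_forall_compl_eq_zero fun q hq => by simp [z2 q hq],
      Measure.volume_eq_prod, integral_prod _ i1]
    simp only [Pi.zero_apply, zero_mul, integral_zero, neg_zero]
    have : ∀ x : ℝ, ∫ y, z x * fderiv ℝ φ (x, y) (0, 1) = 0 := by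
      intro x
      rw [integral_const_mul]
      have hemb : Topology.IsClosedEmbedding fun y : ℝ => (x, y) :=
        Function.LeftInverse.isClosedEmbedding (f := Prod.snd) (fun _ => rfl) continuous_snd
          (by fun_prop)
      have d : ∀ y, HasDerivAt (fun y => φ (x, y)) (fderiv ℝ φ (x, y) (0, 1)) y := by
        intro y
        have d1 : HasDerivAt (fun y : ℝ => (x, y)) (0, 1) y :=
          (hasDerivAt_const y x).prodMk (hasDerivAt_id y)
        exact ((h1.differentiable (by simp)) (x, y)).hasFDerivAt.comp_hasDerivAt y d1
      have j1 : Integrable fun y => fderiv ℝ φ (x, y) (0, 1) :=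
        ((hdc (0, 1)).comp hemb.continuous).integrable_of_hasCompactSupport
          ((h2.fderiv_apply (𝕜 := ℝ) (0, 1)).comp_isClosedEmbedding hemb)
      have j2 : Integrable fun y => φ (x, y) :=
        (h1.continuous.comp hemb.continuous).integrable_of_hasCompactSupport
          (h2.comp_isClosedEmbedding hemb)
      rw [integral_eq_zero_of_hasDerivAt_of_integrable d j1 j2, mul_zero]
    simp [this]

theorem MemH1Plane.mono_set {U V : Set (ℝ × ℝ)} (hVU : V ⊆ U) (hU : MeasurableSet U)
    {u ux uy : ℝ × ℝ → ℝ} (h : MemH1Plane U u ux uy) : MemH1Plane V u ux uy where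
  memLp := h.memLp.mono_measure (Measure.restrict_mono hVU le_rfl)
  memLp_dx := h.memLp_dx.mono_measure (Measure.restrict_mono hVU le_rfl)
  memLp_dy := h.memLp_dy.mono_measure (Measure.restrict_mono hVU le_rfl)
  weakDeriv_dx := h.weakDeriv_dx.mono_set hVU hU
  weakDeriv_dy := h.weakDeriv_dy.mono_set hVU hU

/-- A function of one variable in `H¹(I, γ₁)`, seen as a function on a plane domain over `I`. -/
theorem MemH1Line.memH1Plane {I : Set ℝ} (hI : IsOpen I) {z dz : ℝ → ℝ}
    (h : MemH1Line I z dz) {Ω : Set (ℝ × ℝ)} (hΩ : ∀ q ∈ Ω, q.1 ∈ I) :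
    MemH1Plane Ω (fun q => z q.1) (fun q => dz q.1) 0 :=
  MemH1Plane.mono_set (U := I ×ˢ univ) (fun q hq => ⟨hΩ q hq, mem_univ _⟩)
    (hI.prod isOpen_univ).measurableSet (h.memH1Plane_strip hI)

theorem memLp_two_id_gauss1 : MemLp (fun x : ℝ => x) 2 gauss1 := memLp_id_gaussianReal 2

theorem memH1Line_id {I : Set ℝ} (hI : IsOpen I) (hc : OrdConnected I) (h0 : (0 : ℝ) ∈ I) :
    MemH1Line I (fun x => x) (fun _ => 1) := by
  refine ⟨memLp_two_id_gauss1.restrict I, memLp_const 1, ?_⟩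
  have := hasWeakDeriv_primitive hI hc h0 (h := fun _ => 1)
    (locallyIntegrableOn_const 1)
  simpa using this

end Lift

/-! ### The odd Sobolev space as a closed subspace of `L²(Ω, γ₂; ℝ³)`. -/

section HilbertSpace

theorem setIntegral_gauss2 {Ω : Set (ℝ × ℝ)} (hΩ : MeasurableSet Ω) (F : ℝ × ℝ → ℝ) :
    ∫ q in Ω, F q ∂gauss2 = ∫ q in Ω, gaussDensity2 q * F q := by
  rw [gauss2_eq_withDensity, setIntegral_withDensity_eq_setIntegral_toReal_smul
    continuous_gaussDensity2.measurable.ennreal_ofReal (by simp) _ hΩ]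
  simp [ENNReal.toReal_ofReal (gaussDensity2_pos _).le]

/-- The Hilbert space `L²(Ω, γ₂; ℝ³)`, whose elements are seen as triples `(u, uₓ, u_y)`. -/
abbrev TripleSpace (Ω : Set (ℝ × ℝ)) : Type :=
  Lp (EuclideanSpace ℝ (Fin 3)) 2 (gauss2.restrict Ω)

/-- The vector field that represents `f ↦ ∫_Ω A f₀ + B f₁ + C f₂` in `L²(Ω, γ₂; ℝ³)`. -/
noncomputable def weightedTriple (A B C : ℝ × ℝ → ℝ) (q : ℝ × ℝ) : EuclideanSpace ℝ (Fin 3) :=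
  (gaussDensity2 q)⁻¹ • !₂[A q, B q, C q]

variable {Ω : Set (ℝ × ℝ)}

theorem memLp_triple {μ : Measure (ℝ × ℝ)} {A B C : ℝ × ℝ → ℝ} (hA : MemLp A 2 μ)
    (hB : MemLp B 2 μ) (hC : MemLp C 2 μ) :
    MemLp (fun q => (!₂[A q, B q, C q] : EuclideanSpace ℝ (Fin 3))) 2 μ := by
  refine MemLp.of_eval_piLp fun i => ?_
  fin_cases i
  · exact hA
  · exact hB
  · exact hC

/-- Dividing by the density turns a Lebesgue pairing into a Gaussian inner product. The weak
derivative identities, stated with Lebesgue measure, thus become closed linear conditions in the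
Gaussian L² space. -/
theorem inner_weightedTriple (hΩ : MeasurableSet Ω) {A B C : ℝ × ℝ → ℝ}
    (h : MemLp (weightedTriple A B C) 2 (gauss2.restrict Ω)) (f : TripleSpace Ω) :
    inner ℝ (h.toLp _) f = ∫ q in Ω, (A q * f q 0 + B q * f q 1 + C q * f q 2) := by
  rw [L2.inner_def, ← integral_congr_ae (f := fun q => inner ℝ (weightedTriple A B C q) (f q)),
    setIntegral_gauss2 hΩ]
  · refine integral_congr_ae (Eventually.of_forall fun q => ?_)
    have := (gaussDensity2_pos q).ne'
    simp only [weightedTriple, inner_smul_left, PiLp.inner_apply, Fin.sum_univ_three]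
    simp
    field_simp
  · filter_upwards [h.coeFn_toLp] with q hq
    rw [hq]

theorem memLp_weightedTriple_of_continuous {A B C : ℝ × ℝ → ℝ} (hA : Continuous A)
    (hB : Continuous B) (hC : Continuous C) (hA' : HasCompactSupport A)
    (hB' : HasCompactSupport B) (hC' : HasCompactSupport C) :
    MemLp (weightedTriple A B C) 2 (gauss2.restrict Ω) := by
  have hρ : Continuous fun q => (gaussDensity2 q)⁻¹ :=
    continuous_gaussDensity2.inv₀ fun q => (gaussDensity2_pos q).ne'
  have key : ∀ D : ℝ × ℝ → ℝ, Continuous D → HasCompactSupport D →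
      MemLp (fun q => (gaussDensity2 q)⁻¹ * D q) 2 (gauss2.restrict Ω) := fun D h1 h2 =>
    (hρ.mul h1).memLp_of_hasCompactSupport (h2.mul_left)
  convert memLp_triple (key A hA hA') (key B hB hB') (key C hC hC') using 1
  ext q i
  fin_cases i <;> simp [weightedTriple]

/-- The reflection in the `y`-axis. -/
def reflectY (q : ℝ × ℝ) : ℝ × ℝ := (-q.1, q.2)

theorem SymmYAxis.preimage (hsym : SymmYAxis Ω) : reflectY ⁻¹' Ω = Ω := by
  ext q
  refine ⟨fun h => ?_, fun h => hsym q h⟩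
  have := hsym _ h
  simpa [reflectY] using this

theorem measurePreserving_reflectY : MeasurePreserving reflectY gauss2 gauss2 :=
  measurePreserving_neg_gauss1.prod (MeasurePreserving.id gauss1)

theorem measurePreserving_reflectY_volume : MeasurePreserving reflectY volume volume :=
  (Measure.measurePreserving_neg (volume : Measure ℝ)).prod (MeasurePreserving.id volume)

theorem measurePreserving_reflectY_restrict (hΩ : MeasurableSet Ω) (hsym : SymmYAxis Ω) :
    MeasurePreserving reflectY (gauss2.restrict Ω) (gauss2.restrict Ω) := by
  have := measurePreserving_reflectY.restrict_preimage hΩ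
  rwa [hsym.preimage] at this

theorem measurePreserving_reflectY_restrict_volume (hΩ : MeasurableSet Ω) (hsym : SymmYAxis Ω) :
    MeasurePreserving reflectY ((volume : Measure (ℝ × ℝ)).restrict Ω) (volume.restrict Ω) := by
  have := measurePreserving_reflectY_volume.restrict_preimage hΩ
  rwa [hsym.preimage] at this

/-- The component `f ↦ fᵢ`. -/
noncomputable def tripleComp (Ω : Set (ℝ × ℝ)) (i : Fin 3) :
    TripleSpace Ω →L[ℝ] Lp ℝ 2 (gauss2.restrict Ω) :=
  (EuclideanSpace.proj (𝕜 := ℝ) i).compLpL 2 (gauss2.restrict Ω)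

theorem coeFn_tripleComp (i : Fin 3) (f : TripleSpace Ω) :
    tripleComp Ω i f =ᵐ[gauss2.restrict Ω] fun q => f q i :=
  ContinuousLinearMap.coeFn_compLpL _ f

/-- Smooth test functions with compact support in `Ω`. -/
def IsTestFunction (Ω : Set (ℝ × ℝ)) (φ : ℝ × ℝ → ℝ) : Prop :=
  ContDiff ℝ ∞ φ ∧ HasCompactSupport φ ∧ tsupport φ ⊆ Ω

theorem IsTestFunction.memLp_weightedTriple_dx {φ : ℝ × ℝ → ℝ} (h : IsTestFunction Ω φ) :
    MemLp (weightedTriple (fun q => fderiv ℝ φ q (1, 0)) φ 0) 2 (gauss2.restrict Ω) :=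
  memLp_weightedTriple_of_continuous
    ((h.1.continuous_fderiv (by simp)).clm_apply continuous_const) h.1.continuous continuous_zero
    (h.2.1.fderiv_apply (𝕜 := ℝ) _) h.2.1 HasCompactSupport.zero

theorem IsTestFunction.memLp_weightedTriple_dy {φ : ℝ × ℝ → ℝ} (h : IsTestFunction Ω φ) :
    MemLp (weightedTriple (fun q => fderiv ℝ φ q (0, 1)) 0 φ) 2 (gauss2.restrict Ω) :=
  memLp_weightedTriple_of_continuous
    ((h.1.continuous_fderiv (by simp)).clm_apply continuous_const) continuous_zero h.1.continuous
    (h.2.1.fderiv_apply (𝕜 := ℝ) _) HasCompactSupport.zero h.2.1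

/-- The odd functions of `H¹(Ω, γ₂)`, together with their weak gradients, as a subspace of
`L²(Ω, γ₂; ℝ³)`. -/
noncomputable def oddH1 (hσ : MeasurePreserving reflectY (gauss2.restrict Ω) (gauss2.restrict Ω)) :
    Submodule ℝ (TripleSpace Ω) :=
  (⨅ φ : {φ // IsTestFunction Ω φ},
    (innerSL ℝ (φ.2.memLp_weightedTriple_dx.toLp _)).ker ⊓
      (innerSL ℝ (φ.2.memLp_weightedTriple_dy.toLp _)).ker) ⊓
  ((Lp.compMeasurePreservingₗᵢ ℝ reflectY hσ).toContinuousLinearMap.comp (tripleComp Ω 0)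
    + tripleComp Ω 0).ker

theorem isClosed_oddH1 (hσ : MeasurePreserving reflectY (gauss2.restrict Ω) (gauss2.restrict Ω)) :
    IsClosed (oddH1 hσ : Set (TripleSpace Ω)) := by
  rw [oddH1, Submodule.coe_inf, Submodule.coe_iInf]
  refine (isClosed_iInter fun φ => ?_).inter (ContinuousLinearMap.isClosed_ker _)
  rw [Submodule.coe_inf]
  exact (ContinuousLinearMap.isClosed_ker _).inter (ContinuousLinearMap.isClosed_ker _)

theorem memLp_triple_apply (f : TripleSpace Ω) (i : Fin 3) :
    MemLp (fun q => f q i) 2 (gauss2.restrict Ω) :=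
  (Lp.memLp (tripleComp Ω i f)).ae_eq (coeFn_tripleComp i f)

theorem ae_gauss2_restrict_iff {P : ℝ × ℝ → Prop} :
    (∀ᵐ q ∂gauss2.restrict Ω, P q) ↔ ∀ᵐ q ∂volume.restrict Ω, P q :=
  ⟨fun h => (volume_absolutelyContinuous_gauss2.restrict Ω).ae_le h,
    fun h => (gauss2_absolutelyContinuous.restrict Ω).ae_le h⟩

/-- The kernel conditions are exactly the weak derivative identities and oddness; local
integrability is automatic, since the Gaussian density is locally bounded below. -/
theorem mem_oddH1_iff (hΩ : IsOpen Ω)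
    (hσ : MeasurePreserving reflectY (gauss2.restrict Ω) (gauss2.restrict Ω))
    (f : TripleSpace Ω) :
    f ∈ oddH1 hσ ↔ MemH1Plane Ω (fun q => f q 0) (fun q => f q 1) (fun q => f q 2) ∧
      ∀ᵐ q ∂volume.restrict Ω, f (-q.1, q.2) 0 = - f q 0 := by
  have hl : ∀ i, LocallyIntegrableOn (fun q => f q i) Ω volume := fun i =>
    locallyIntegrableOn_of_memLp_gauss2 hΩ (memLp_triple_apply f i)
  have hodd : ((Lp.compMeasurePreservingₗᵢ ℝ reflectY hσ).toContinuousLinearMap.comp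
      (tripleComp Ω 0) + tripleComp Ω 0) f = 0 ↔
      ∀ᵐ q ∂volume.restrict Ω, f (-q.1, q.2) 0 = - f q 0 := by
    rw [← ae_gauss2_restrict_iff, Lp.eq_zero_iff_ae_eq_zero]
    have e1 : (((Lp.compMeasurePreservingₗᵢ ℝ reflectY hσ).toContinuousLinearMap.comp
        (tripleComp Ω 0) + tripleComp Ω 0) f : ℝ × ℝ → ℝ) =ᵐ[gauss2.restrict Ω]
        fun q => f (-q.1, q.2) 0 + f q 0 := by
      have a1 := Lp.coeFn_add (Lp.compMeasurePreserving reflectY hσ (tripleComp Ω 0 f))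
        (tripleComp Ω 0 f)
      have a2 := Lp.coeFn_compMeasurePreserving (tripleComp Ω 0 f) hσ
      have a3 := coeFn_tripleComp 0 f
      have a4 := hσ.quasiMeasurePreserving.ae a3
      filter_upwards [a1, a2, a3, a4] with q h1 h2 h3 h4
      refine h1.trans ?_
      rw [Pi.add_apply, h2, h3, Function.comp_apply, h4]
      rfl
    constructor
    · intro h
      filter_upwards [h, e1] with q h1 h2
      rw [h2] at h1
      simp only [Pi.zero_apply] at h1
      linarith
    · intro h
      filter_upwards [h, e1] with q h1 h2
      rw [h2, h1]
      simp
  have hi : ∀ (φ : ℝ × ℝ → ℝ), IsTestFunction Ω φ → ∀ (v : ℝ × ℝ) (i : Fin 3),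
      (∫ q in Ω, (fderiv ℝ φ q v * f q 0 + φ q * f q i) = 0 ↔
      ∫ q in Ω, f q 0 * fderiv ℝ φ q v = - ∫ q in Ω, f q i * φ q) := by
    intro φ hφ v i
    have i1 := integrable_mul_of_locallyIntegrableOn (hl 0)
      ((hφ.1.continuous_fderiv (by simp)).clm_apply (continuous_const (y := v)))
      (hφ.2.1.fderiv_apply (𝕜 := ℝ) v) ((tsupport_fderiv_apply_subset ℝ v).trans hφ.2.2)
    have i2 := integrable_mul_of_locallyIntegrableOn (hl i) hφ.1.continuous hφ.2.1 hφ.2.2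
    simp only [mul_comm _ (f _ _)]
    rw [integral_add i1.integrableOn i2.integrableOn, add_eq_zero_iff_eq_neg]
  rw [oddH1, Submodule.mem_inf, Submodule.mem_iInf]
  constructor
  · rintro ⟨h1, h2⟩
    refine ⟨⟨memLp_triple_apply f 0, memLp_triple_apply f 1, memLp_triple_apply f 2,
      ⟨hl 0, hl 1, fun φ a b c => ?_⟩, ⟨hl 0, hl 2, fun φ a b c => ?_⟩⟩, hodd.1 h2⟩
    · have := (Submodule.mem_inf.1 (h1 ⟨φ, a, b, c⟩)).1
      change inner ℝ _ f = 0 at this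
      rw [inner_weightedTriple hΩ.measurableSet] at this
      rw [← hi φ ⟨a, b, c⟩]
      simpa using this
    · have := (Submodule.mem_inf.1 (h1 ⟨φ, a, b, c⟩)).2
      change inner ℝ _ f = 0 at this
      rw [inner_weightedTriple hΩ.measurableSet] at this
      rw [← hi φ ⟨a, b, c⟩]
      simpa using this
  · rintro ⟨h1, h2⟩
    refine ⟨fun φ => Submodule.mem_inf.2 ⟨?_, ?_⟩, hodd.2 h2⟩
    · change inner ℝ _ f = 0
      rw [inner_weightedTriple hΩ.measurableSet]
      have := (hi φ.1 φ.2 _ _).2 (h1.weakDeriv_dx.integral_eq φ.1 φ.2.1 φ.2.2.1 φ.2.2.2)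
      simpa using this
    · change inner ℝ _ f = 0
      rw [inner_weightedTriple hΩ.measurableSet]
      have := (hi φ.1 φ.2 _ _).2 (h1.weakDeriv_dy.integral_eq φ.1 φ.2.1 φ.2.2.1 φ.2.2.2)
      simpa using this

end HilbertSpace

/-! ### Existence of the lowest odd eigenvalue. -/

section Existence

variable {Ω : Set (ℝ × ℝ)}

theorem integrable_mul_of_memLp_two {α : Type*} [MeasurableSpace α] {μ : Measure α} {f g : α → ℝ}
    (hf : MemLp f 2 μ) (hg : MemLp g 2 μ) : Integrable (fun x => f x * g x) μ :=
  hf.integrable_mul hg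

theorem ofReal_integral_sq {α : Type*} [MeasurableSpace α] {μ : Measure α} {f : α → ℝ}
    (hf : MemLp f 2 μ) : ENNReal.ofReal (∫ x, f x ^ 2 ∂μ) = ∫⁻ x, ‖f x‖ₑ ^ 2 ∂μ := by
  rw [ofReal_integral_eq_lintegral_ofReal hf.integrable_sq
    (Eventually.of_forall fun x => sq_nonneg _)]
  exact lintegral_congr fun x => (enorm_sq_eq_ofReal _).symm

theorem integral_sq_pos {f : ℝ × ℝ → ℝ} (hf : MemLp f 2 (gauss2.restrict Ω))
    (h : ¬ f =ᵐ[volume.restrict Ω] 0) : 0 < ∫ q in Ω, f q ^ 2 ∂gauss2 := by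
  refine lt_of_le_of_ne (integral_nonneg fun q => sq_nonneg _) fun h0 => h ?_
  have := (integral_eq_zero_iff_of_nonneg (fun q => sq_nonneg (f q)) hf.integrable_sq).1 h0.symm
  refine ae_gauss2_restrict_iff.1 ?_
  filter_upwards [this] with q hq
  simpa using hq

theorem HasWeakDeriv.linear_comb {v : ℝ × ℝ} {u g u' g' : ℝ × ℝ → ℝ}
    (h : HasWeakDeriv Ω v u g) (h' : HasWeakDeriv Ω v u' g') (c d : ℝ) :
    HasWeakDeriv Ω v (fun q => c * u q + d * u' q) (fun q => c * g q + d * g' q) where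
  locInt := (h.locInt.smul c).add (h'.locInt.smul d)
  locInt_deriv := (h.locInt_deriv.smul c).add (h'.locInt_deriv.smul d)
  integral_eq φ h1 h2 h3 := by
    have hd : Continuous fun q => fderiv ℝ φ q v :=
      (h1.continuous_fderiv (by simp)).clm_apply continuous_const
    have s1 := h2.fderiv_apply (𝕜 := ℝ) v
    have s2 := (tsupport_fderiv_apply_subset ℝ v).trans h3
    have i1 := (integrable_mul_of_locallyIntegrableOn h.locInt hd s1 s2).integrableOn (s := Ω)
    have i2 := (integrable_mul_of_locallyIntegrableOn h'.locInt hd s1 s2).integrableOn (s := Ω)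
    have i3 := (integrable_mul_of_locallyIntegrableOn h.locInt_deriv h1.continuous h2
      h3).integrableOn (s := Ω)
    have i4 := (integrable_mul_of_locallyIntegrableOn h'.locInt_deriv h1.continuous h2
      h3).integrableOn (s := Ω)
    simp only [add_mul, mul_assoc]
    rw [integral_add (i1.const_mul c) (i2.const_mul d), integral_add (i3.const_mul c)
      (i4.const_mul d), integral_const_mul, integral_const_mul, integral_const_mul,
      integral_const_mul, h.integral_eq φ h1 h2 h3, h'.integral_eq φ h1 h2 h3]
    ring

theorem MemH1Plane.linear_comb {u ux uy w wx wy : ℝ × ℝ → ℝ} (h : MemH1Plane Ω u ux uy)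
    (h' : MemH1Plane Ω w wx wy) (c d : ℝ) :
    MemH1Plane Ω (fun q => c * u q + d * w q) (fun q => c * ux q + d * wx q)
      (fun q => c * uy q + d * wy q) where
  memLp := (h.memLp.const_mul c).add (h'.memLp.const_mul d)
  memLp_dx := (h.memLp_dx.const_mul c).add (h'.memLp_dx.const_mul d)
  memLp_dy := (h.memLp_dy.const_mul c).add (h'.memLp_dy.const_mul d)
  weakDeriv_dx := h.weakDeriv_dx.linear_comb h'.weakDeriv_dx c d
  weakDeriv_dy := h.weakDeriv_dy.linear_comb h'.weakDeriv_dy c d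

/-- The reflection in the `y`-axis as a linear automorphism. -/
noncomputable def reflectYEquiv : (ℝ × ℝ) ≃L[ℝ] (ℝ × ℝ) :=
  (ContinuousLinearEquiv.neg ℝ).prodCongr (ContinuousLinearEquiv.refl ℝ ℝ)

theorem MemH1Plane.comp_reflectY (hΩ : IsOpen Ω) (hsym : SymmYAxis Ω) {u ux uy : ℝ × ℝ → ℝ}
    (h : MemH1Plane Ω u ux uy) :
    MemH1Plane Ω (fun q => u (reflectY q)) (fun q => - ux (reflectY q))
      (fun q => uy (reflectY q)) := by
  have hσ := measurePreserving_reflectY_restrict hΩ.measurableSet hsym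
  have e : reflectYEquiv ⁻¹' Ω = Ω := hsym.preimage
  have d1 := (h.weakDeriv_dx.comp_continuousLinearEquiv hΩ reflectYEquiv
    measurePreserving_reflectY_volume).smul_dir (-1)
  have d2 := h.weakDeriv_dy.comp_continuousLinearEquiv hΩ reflectYEquiv
    measurePreserving_reflectY_volume
  rw [e] at d1 d2
  refine ⟨h.memLp.comp_measurePreserving hσ, (h.memLp_dx.comp_measurePreserving hσ).neg,
    h.memLp_dy.comp_measurePreserving hσ, ?_, ?_⟩
  · have ev : (-1 : ℝ) • reflectYEquiv.symm (1, 0) = (1, 0) := by simp [reflectYEquiv]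
    rw [ev] at d1
    exact d1.congr_ae .rfl (Eventually.of_forall fun q => neg_one_mul _)
  · have ev : reflectYEquiv.symm (0, 1) = (0, 1) := by simp [reflectYEquiv]
    rw [ev] at d2
    exact d2

/-- The reflected function equals -u, so uniqueness of weak derivatives compares their gradients; in
the x-direction the chain rule adds a further sign. -/
theorem MemH1Plane.ae_reflect_of_odd (hΩ : IsOpen Ω) (hsym : SymmYAxis Ω) {u ux uy : ℝ × ℝ → ℝ}
    (h : MemH1Plane Ω u ux uy) (hodd : ∀ᵐ q ∂volume.restrict Ω, u (-q.1, q.2) = - u q) :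
    ∀ᵐ q ∂volume.restrict Ω, u (reflectY q) = - u q ∧ ux (reflectY q) = ux q ∧
      uy (reflectY q) = - uy q := by
  have h1 := h.comp_reflectY hΩ hsym
  have h2 := h.linear_comb h (-1) 0
  have e : (fun q => u (reflectY q)) =ᵐ[volume.restrict Ω] fun q => -1 * u q + 0 * u q := by
    filter_upwards [hodd] with q hq
    rw [reflectY, hq]; ring
  have dx := (h1.weakDeriv_dx.congr_ae e .rfl).unique hΩ h2.weakDeriv_dx
  have dy := (h1.weakDeriv_dy.congr_ae e .rfl).unique hΩ h2.weakDeriv_dy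
  filter_upwards [hodd, dx, dy] with q h1 h2 h3
  refine ⟨h1, ?_, ?_⟩
  · linarith
  · linarith

/-- Only odd test functions matter for the weak equation of an odd function. -/
theorem MemH1Plane.weak_eq_of_odd (hΩ : IsOpen Ω) (hsym : SymmYAxis Ω) {u ux uy : ℝ × ℝ → ℝ}
    (h : MemH1Plane Ω u ux uy) (hodd : ∀ᵐ q ∂volume.restrict Ω, u (-q.1, q.2) = - u q) {m : ℝ}
    (heq : ∀ φ φx φy : ℝ × ℝ → ℝ, MemH1Plane Ω φ φx φy →
      (∀ᵐ q ∂volume.restrict Ω, φ (-q.1, q.2) = - φ q) →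
      ∫ q in Ω, (ux q * φx q + uy q * φy q) ∂gauss2 = m * ∫ q in Ω, u q * φ q ∂gauss2)
    {φ φx φy : ℝ × ℝ → ℝ} (hφ : MemH1Plane Ω φ φx φy) :
    ∫ q in Ω, (ux q * φx q + uy q * φy q) ∂gauss2 = m * ∫ q in Ω, u q * φ q ∂gauss2 := by
  have hσ := measurePreserving_reflectY_restrict hΩ.measurableSet hsym
  have hae := ae_gauss2_restrict_iff.2 (h.ae_reflect_of_odd hΩ hsym hodd)
  -- The odd part of φ. Averaging each integrand with its reflection replaces φ by this odd part.
  have hψ := hφ.linear_comb (hφ.comp_reflectY hΩ hsym) (1 / 2) (-1 / 2)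
  have key := heq _ _ _ hψ (Eventually.of_forall fun q => by
    simp only [reflectY, neg_neg]; ring)
  have avg : ∀ G : ℝ × ℝ → ℝ, Integrable G (gauss2.restrict Ω) →
      ∫ q in Ω, (G q + G (reflectY q)) / 2 ∂gauss2 = ∫ q in Ω, G q ∂gauss2 := by
    intro G hG
    have hmap : ∫ q in Ω, G (reflectY q) ∂gauss2 = ∫ q in Ω, G q ∂gauss2 :=
      hσ.integral_comp reflectYEquiv.toHomeomorph.measurableEmbedding G
    have hG' : Integrable (fun q => G (reflectY q)) (gauss2.restrict Ω) :=
      hσ.integrable_comp_of_integrable hG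
    rw [integral_div, integral_add hG hG', hmap]
    ring
  have iG : Integrable (fun q => ux q * φx q + uy q * φy q) (gauss2.restrict Ω) :=
    (integrable_mul_of_memLp_two h.memLp_dx hφ.memLp_dx).add
      (integrable_mul_of_memLp_two h.memLp_dy hφ.memLp_dy)
  have iH : Integrable (fun q => u q * φ q) (gauss2.restrict Ω) :=
    integrable_mul_of_memLp_two h.memLp hφ.memLp
  rw [← avg _ iG, ← avg _ iH]
  convert key using 1
  · refine integral_congr_ae ?_
    filter_upwards [hae] with q ⟨h1, h2, h3⟩
    rw [h2, h3]; ring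
  · congr 1
    refine integral_congr_ae ?_
    filter_upwards [hae] with q ⟨h1, h2, h3⟩
    rw [h1]; ring

theorem inner_triple (f g : TripleSpace Ω) :
    inner ℝ f g = (∫ q in Ω, f q 0 * g q 0 ∂gauss2)
      + ∫ q in Ω, (f q 1 * g q 1 + f q 2 * g q 2) ∂gauss2 := by
  have i := fun j => integrable_mul_of_memLp_two (memLp_triple_apply f j) (memLp_triple_apply g j)
  have i' : Integrable (fun q => f q 1 * g q 1 + f q 2 * g q 2) (gauss2.restrict Ω) :=
    (i 1).add (i 2)
  rw [L2.inner_def, ← integral_add (i 0) i']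
  refine integral_congr_ae (Eventually.of_forall fun q => ?_)
  simp only [PiLp.inner_apply, Fin.sum_univ_three]
  simp
  ring

theorem inner_tripleComp_zero (f g : TripleSpace Ω) :
    inner ℝ (tripleComp Ω 0 f) (tripleComp Ω 0 g) = ∫ q in Ω, f q 0 * g q 0 ∂gauss2 := by
  rw [L2.inner_def]
  refine integral_congr_ae ?_
  filter_upwards [coeFn_tripleComp 0 f, coeFn_tripleComp 0 g] with q h1 h2
  rw [h1, h2]
  simp [mul_comm]

theorem measurable_triple_apply (f : TripleSpace Ω) (i : Fin 3) : Measurable fun q => f q i :=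
  (EuclideanSpace.proj (𝕜 := ℝ) i).continuous.measurable.comp (Lp.stronglyMeasurable f).measurable

/-- An element of `H¹(Ω, γ₂)` with its weak gradient, as an element of `L²(Ω, γ₂; ℝ³)`. -/
noncomputable def MemH1Plane.toTriple {u ux uy : ℝ × ℝ → ℝ} (h : MemH1Plane Ω u ux uy) :
    TripleSpace Ω :=
  (memLp_triple h.memLp h.memLp_dx h.memLp_dy).toLp _

theorem MemH1Plane.ae_toTriple {u ux uy : ℝ × ℝ → ℝ} (h : MemH1Plane Ω u ux uy) :
    ∀ᵐ q ∂gauss2.restrict Ω,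
      h.toTriple q 0 = u q ∧ h.toTriple q 1 = ux q ∧ h.toTriple q 2 = uy q := by
  filter_upwards [(memLp_triple h.memLp h.memLp_dx h.memLp_dy).coeFn_toLp] with q hq
  rw [MemH1Plane.toTriple, hq]
  simp

theorem MemH1Plane.measurableH1Plane_toTriple {u ux uy : ℝ × ℝ → ℝ}
    (h : MemH1Plane Ω u ux uy) :
    MeasurableH1Plane Ω (fun q => h.toTriple q 0) (fun q => h.toTriple q 1)
      (fun q => h.toTriple q 2) := by
  have hae := ae_gauss2_restrict_iff.1 h.ae_toTriple
  have e0 : u =ᵐ[volume.restrict Ω] fun q => h.toTriple q 0 := hae.mono fun q hq => hq.1.symm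
  have e1 : ux =ᵐ[volume.restrict Ω] fun q => h.toTriple q 1 := hae.mono fun q hq => hq.2.1.symm
  have e2 : uy =ᵐ[volume.restrict Ω] fun q => h.toTriple q 2 := hae.mono fun q hq => hq.2.2.symm
  exact ⟨measurable_triple_apply _ _, measurable_triple_apply _ _, measurable_triple_apply _ _,
    memLp_triple_apply _ _, memLp_triple_apply _ _, memLp_triple_apply _ _,
    h.weakDeriv_dx.congr_ae e0 e1, h.weakDeriv_dy.congr_ae e0 e2⟩

theorem MemH1Plane.odd_toTriple (hΩ : IsOpen Ω) (hsym : SymmYAxis Ω)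
    {u ux uy : ℝ × ℝ → ℝ} (h : MemH1Plane Ω u ux uy)
    (hodd : ∀ᵐ q ∂volume.restrict Ω, u (-q.1, q.2) = - u q) :
    ∀ᵐ q ∂volume.restrict Ω, h.toTriple (-q.1, q.2) 0 = - h.toTriple q 0 := by
  have e0 : u =ᵐ[volume.restrict Ω] fun q => h.toTriple q 0 :=
    (ae_gauss2_restrict_iff.1 h.ae_toTriple).mono fun q hq => hq.1.symm
  have hr := (measurePreserving_reflectY_restrict_volume hΩ.measurableSet
    hsym).quasiMeasurePreserving.ae e0
  filter_upwards [hodd, e0, hr] with q h1 h2 h3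
  rw [← h2, ← h1]
  exact h3.symm

theorem MemH1Plane.toTriple_mem_oddH1 (hΩ : IsOpen Ω) (hsym : SymmYAxis Ω)
    {u ux uy : ℝ × ℝ → ℝ} (h : MemH1Plane Ω u ux uy)
    (hodd : ∀ᵐ q ∂volume.restrict Ω, u (-q.1, q.2) = - u q)
    (hσ : MeasurePreserving reflectY (gauss2.restrict Ω) (gauss2.restrict Ω)) :
    h.toTriple ∈ oddH1 hσ :=
  (mem_oddH1_iff hΩ hσ _).2 ⟨h.measurableH1Plane_toTriple.memH1, h.odd_toTriple hΩ hsym hodd⟩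

variable {a : EReal} {p : ℝ → ℝ}

theorem IsRegionProfile.symmYAxis (hp : IsRegionProfile a p) : SymmYAxis (regionBelow a p) :=
  fun _ hq => hp.neg_mem hq

theorem IsRegionProfile.nonempty (hp : IsRegionProfile a p) : (regionBelow a p).Nonempty :=
  ⟨(0, p 0 - 1), zero_mem_openInterval hp.pos, sub_one_lt (p 0)⟩

theorem IsRegionProfile.memH1Plane_fst (hp : IsRegionProfile a p) :
    MemH1Plane (regionBelow a p) (fun q => q.1) (fun _ => 1) 0 :=
  (memH1Line_id (isOpen_openInterval (-a) a) (ordConnected_openInterval a)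
    (zero_mem_openInterval hp.pos)).memH1Plane (isOpen_openInterval (-a) a) fun _ hq => hq.1

/-- The lower bound on the density makes the representing field, the indicator of the cell divided
by the density, bounded and hence square integrable. -/
theorem exists_cell_functional (hΩ : MeasurableSet Ω) {s : ℝ} {n : ℤ × ℤ}
    (hs : gridSquare s n ⊆ Ω) {c : ℝ} (hc : 0 < c)
    (hρ : ∀ q ∈ gridSquare s n, c ≤ gaussDensity2 q) :
    ∃ l : TripleSpace Ω →L[ℝ] ℝ, ∀ f, l f = ∫ q in gridSquare s n, f q 0 := by
  have hm := measurableSet_gridSquare s n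
  have hL : MemLp (weightedTriple ((gridSquare s n).indicator 1) 0 0) 2 (gauss2.restrict Ω) := by
    have h1 : MemLp (fun q => (gaussDensity2 q)⁻¹ * (gridSquare s n).indicator 1 q) 2
        (gauss2.restrict Ω) := by
      refine MemLp.of_bound (C := c⁻¹) ?_ (Eventually.of_forall fun q => ?_)
      · exact (continuous_gaussDensity2.measurable.inv.mul
          (measurable_one.indicator hm)).aestronglyMeasurable
      · by_cases hq : q ∈ gridSquare s n
        · rw [indicator_of_mem hq, Pi.one_apply, mul_one, Real.norm_eq_abs,
            abs_of_pos (inv_pos.2 (gaussDensity2_pos q))]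
          exact inv_anti₀ hc (hρ q hq)
        · rw [indicator_of_notMem hq, mul_zero, norm_zero]
          positivity
    convert memLp_triple h1 (MemLp.zero' (ε := ℝ)) (MemLp.zero' (ε := ℝ)) using 1
    ext q i
    fin_cases i <;> simp [weightedTriple]
  refine ⟨innerSL ℝ (hL.toLp _), fun f => ?_⟩
  rw [innerSL_apply_apply, inner_weightedTriple hΩ hL]
  have : ∀ q, (gridSquare s n).indicator 1 q * f q 0 + (0 : ℝ × ℝ → ℝ) q * f q 1
      + (0 : ℝ × ℝ → ℝ) q * f q 2 = (gridSquare s n).indicator (fun q => f q 0) q := by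
    intro q
    by_cases hq : q ∈ gridSquare s n <;> simp [hq]
  simp only [this]
  rw [setIntegral_indicator hm, inter_eq_self_of_subset_right hs]

theorem IsRegionProfile.finite_control_tripleComp (hp : IsRegionProfile a p)
    (hσ : MeasurePreserving reflectY (gauss2.restrict (regionBelow a p))
      (gauss2.restrict (regionBelow a p))) {ε : ℝ} (hε : 0 < ε) :
    ∃ (F : Finset (ℤ × ℤ)) (l : ℤ × ℤ → oddH1 hσ →L[ℝ] ℝ), ∀ f : oddH1 hσ,
      ‖(tripleComp (regionBelow a p) 0 ∘L (oddH1 hσ).subtypeL) f‖ ^ 2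
        ≤ ε * ‖f‖ ^ 2 + ∑ n ∈ F, l n f ^ 2 := by
  obtain ⟨s, F, C, hC, hF, hctl⟩ := hp.exists_finite_control hε
  have hΩ := hp.isOpen
  have hex : ∀ n, ∃ l : TripleSpace (regionBelow a p) →L[ℝ] ℝ, n ∈ F →
      ∀ f, l f = ∫ q in gridSquare s n, f q 0 := by
    intro n
    by_cases hn : n ∈ F
    · obtain ⟨hs, c, hc, hρ⟩ := hF n hn
      obtain ⟨l, hl⟩ := exists_cell_functional hΩ.measurableSet hs hc hρ
      exact ⟨l, fun _ => hl⟩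
    · exact ⟨0, fun h => absurd h hn⟩
  choose l hl using hex
  -- The constant C is absorbed into the functionals, which enter squared.
  refine ⟨F, fun n => (√C • l n) ∘L (oddH1 hσ).subtypeL, fun f => ?_⟩
  obtain ⟨h1, h2⟩ := (mem_oddH1_iff hΩ hσ _).1 f.2
  have hmeas := measurable_triple_apply (f : TripleSpace (regionBelow a p))
  have key := hctl _ _ _ ⟨hmeas 0, hmeas 1, hmeas 2, h1⟩ h2
  have n1 : ‖(tripleComp (regionBelow a p) 0 ∘L (oddH1 hσ).subtypeL) f‖ ^ 2
      = ∫ q in regionBelow a p, (f : TripleSpace (regionBelow a p)) q 0 ^ 2 ∂gauss2 := by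
    rw [← real_inner_self_eq_norm_sq]
    simp only [sq]
    exact inner_tripleComp_zero _ _
  have n2 : ‖f‖ ^ 2 = (∫ q in regionBelow a p, (f : TripleSpace (regionBelow a p)) q 0 ^ 2 ∂gauss2)
      + ((∫ q in regionBelow a p, (f : TripleSpace (regionBelow a p)) q 1 ^ 2 ∂gauss2)
        + ∫ q in regionBelow a p, (f : TripleSpace (regionBelow a p)) q 2 ^ 2 ∂gauss2) := by
    rw [Submodule.coe_norm, ← real_inner_self_eq_norm_sq, inner_triple,
      ← integral_add h1.memLp_dx.integrable_sq h1.memLp_dy.integrable_sq]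
    simp only [sq]
  have nn : ∀ i, 0 ≤ ∫ q in regionBelow a p,
      (f : TripleSpace (regionBelow a p)) q i ^ 2 ∂gauss2 :=
    fun i => integral_nonneg fun q => sq_nonneg _
  have e2 : ∫⁻ q in regionBelow a p, (‖(f : TripleSpace (regionBelow a p)) q 0‖ₑ ^ 2
      + (‖(f : TripleSpace (regionBelow a p)) q 1‖ₑ ^ 2
        + ‖(f : TripleSpace (regionBelow a p)) q 2‖ₑ ^ 2)) ∂gauss2 = ENNReal.ofReal (‖f‖ ^ 2) := by
    have m0 := hmeas 0
    have m1 := hmeas 1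
    rw [lintegral_add_left (by fun_prop), lintegral_add_left (by fun_prop), n2,
      ENNReal.ofReal_add (nn 0) (add_nonneg (nn 1) (nn 2)), ENNReal.ofReal_add (nn 1) (nn 2),
      ofReal_integral_sq h1.memLp, ofReal_integral_sq h1.memLp_dx, ofReal_integral_sq h1.memLp_dy]
  have e3 : ENNReal.ofReal C * ∑ n ∈ F,
      ‖∫ q in gridSquare s n, (f : TripleSpace (regionBelow a p)) q 0‖ₑ ^ 2
      = ENNReal.ofReal (∑ n ∈ F, ((√C • l n) ∘L (oddH1 hσ).subtypeL) f ^ 2) := by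
    rw [ENNReal.ofReal_sum_of_nonneg fun n _ => sq_nonneg _, Finset.mul_sum]
    refine Finset.sum_congr rfl fun n hn => ?_
    rw [← hl n hn, enorm_sq_eq_ofReal, ← ENNReal.ofReal_mul hC]
    congr 1
    change _ = (√C * l n f) ^ 2
    rw [mul_pow, Real.sq_sqrt hC]
  rw [e2, e3, ← ofReal_integral_sq h1.memLp, ← n1, ← ENNReal.ofReal_mul hε.le,
    ← ENNReal.ofReal_add (by positivity) (Finset.sum_nonneg fun n _ => sq_nonneg _),
    ENNReal.ofReal_le_ofReal_iff
      (add_nonneg (by positivity) (Finset.sum_nonneg fun n _ => sq_nonneg _))] at key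
  exact key

/-- The lowest odd Neumann eigenvalue exists, and is the minimum of the Rayleigh quotient over the
odd functions. -/
theorem IsRegionProfile.exists_isLeast_oddNeumannEigenvalues (hp : IsRegionProfile a p) :
    ∃ m, IsLeast (oddNeumannEigenvalues (regionBelow a p)) m ∧
      ∀ u ux uy, MemH1Plane (regionBelow a p) u ux uy →
        (∀ᵐ q ∂volume.restrict (regionBelow a p), u (-q.1, q.2) = - u q) →
        m * ∫ q in regionBelow a p, u q * u q ∂gauss2
          ≤ ∫ q in regionBelow a p, (ux q * ux q + uy q * uy q) ∂gauss2 := by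
  have hΩ := hp.isOpen
  have hsym := hp.symmYAxis
  have hσ := measurePreserving_reflectY_restrict hΩ.measurableSet hsym
  set Ω := regionBelow a p
  set J : oddH1 hσ →L[ℝ] Lp ℝ 2 (gauss2.restrict Ω) :=
    tripleComp Ω 0 ∘L (oddH1 hσ).subtypeL with hJdef
  have : CompleteSpace (oddH1 hσ) := (isClosed_oddH1 hσ).completeSpace_coe
  have hinJ : ∀ f g : oddH1 hσ, inner ℝ (J f) (J g)
      = ∫ q in Ω, (f : TripleSpace Ω) q 0 * (g : TripleSpace Ω) q 0 ∂gauss2 :=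
    fun f g => inner_tripleComp_zero _ _
  have hin : ∀ f g : oddH1 hσ, inner ℝ f g = inner ℝ (J f) (J g)
      + ∫ q in Ω, ((f : TripleSpace Ω) q 1 * (g : TripleSpace Ω) q 1
        + (f : TripleSpace Ω) q 2 * (g : TripleSpace Ω) q 2) ∂gauss2 := fun f g => by
    rw [hinJ, Submodule.coe_inner, inner_triple]
  have hJ : J ≠ 0 := by
    intro h0
    have hx := hp.memH1Plane_fst
    have hxm := hx.toTriple_mem_oddH1 hΩ hsym (Eventually.of_forall fun q => rfl) hσ
    have h1 := hinJ ⟨_, hxm⟩ ⟨_, hxm⟩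
    rw [h0] at h1
    have hne : ¬ (fun q : ℝ × ℝ => q.1) =ᵐ[volume.restrict Ω] 0 := by
      intro he
      -- If x vanished almost everywhere on Ω it would agree with -x + x, and uniqueness of the weak
      -- derivative would give 1 = 0.
      have hd : (fun _ => (1 : ℝ)) =ᵐ[volume.restrict Ω] fun q => -1 * 1 + 1 * 1 := by
        refine hx.weakDeriv_dx.unique hΩ ((hx.weakDeriv_dx.linear_comb hx.weakDeriv_dx (-1)
          1).congr_ae ?_ .rfl)
        filter_upwards [he] with q hq
        simpa using hq.symm
      have hz : ∀ᵐ q ∂volume.restrict Ω, False := hd.mono fun q hq => by norm_num at hq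
      rw [ae_restrict_iff' hΩ.measurableSet] at hz
      have : volume Ω = 0 := measure_mono_null (fun q hq => by simpa using hq) hz
      exact (hΩ.measure_pos volume hp.nonempty).ne' this
    have hpos := integral_sq_pos hx.memLp hne
    have e : ∫ q in Ω, hx.toTriple q 0 * hx.toTriple q 0 ∂gauss2 = ∫ q in Ω, q.1 ^ 2 ∂gauss2 := by
      refine integral_congr_ae ?_
      filter_upwards [hx.ae_toTriple] with q hq
      rw [hq.1, sq]
    rw [← e, ← h1] at hpos
    simp at hpos
  obtain ⟨f, hf, hJf⟩ := J.exists_norm_eq_of_finite_control hJ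
    fun ε hε => hp.finite_control_tripleComp hσ hε
  have hJ0 : 0 < ‖J‖ ^ 2 := by
    refine pow_pos ((norm_nonneg J).lt_of_ne' fun h => hJ (ContinuousLinearMap.ext fun x => ?_)) 2
    have := J.le_opNorm x
    rw [h, zero_mul] at this
    exact norm_le_zero_iff.1 this
  obtain ⟨hf1, hf2⟩ := (mem_oddH1_iff hΩ hσ _).1 f.2
  -- Since ‖g‖² = ‖Jg‖² + Dirichlet energy, the bound ‖Jg‖² ≤ ‖J‖² ‖g‖² is the Rayleigh inequality
  -- with constant 1/‖J‖² - 1.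
  have hineq : ∀ u ux uy, MemH1Plane Ω u ux uy →
      (∀ᵐ q ∂volume.restrict Ω, u (-q.1, q.2) = - u q) →
      (1 / ‖J‖ ^ 2 - 1) * ∫ q in Ω, u q * u q ∂gauss2
        ≤ ∫ q in Ω, (ux q * ux q + uy q * uy q) ∂gauss2 := by
    intro u ux uy h hodd
    let g : oddH1 hσ := ⟨_, h.toTriple_mem_oddH1 hΩ hsym hodd hσ⟩
    have h1 := hinJ g g
    have h2 := hin g g
    have e1 : ∫ q in Ω, h.toTriple q 0 * h.toTriple q 0 ∂gauss2
        = ∫ q in Ω, u q * u q ∂gauss2 := integral_congr_ae <| by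
      filter_upwards [h.ae_toTriple] with q hq
      rw [hq.1]
    have e2 : ∫ q in Ω, (h.toTriple q 1 * h.toTriple q 1 + h.toTriple q 2 * h.toTriple q 2) ∂gauss2
        = ∫ q in Ω, (ux q * ux q + uy q * uy q) ∂gauss2 := integral_congr_ae <| by
      filter_upwards [h.ae_toTriple] with q hq
      rw [hq.2.1, hq.2.2]
    rw [← e1, ← e2, ← h1]
    have h3 : ‖J g‖ ^ 2 ≤ ‖J‖ ^ 2 * ‖g‖ ^ 2 := by
      rw [← mul_pow]; gcongr; exact J.le_opNorm g
    rw [← real_inner_self_eq_norm_sq, ← real_inner_self_eq_norm_sq, h2] at h3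
    rw [sub_mul, one_mul, sub_le_iff_le_add', div_mul_eq_mul_div, one_mul, div_le_iff₀ hJ0,
      mul_comm _ (‖J‖ ^ 2)]
    exact h3
  refine ⟨1 / ‖J‖ ^ 2 - 1, ⟨⟨_, _, _, ⟨hf1, fun h0 => ?_, ?_⟩, hf2⟩, ?_⟩, hineq⟩
  · have h1 := hinJ f f
    rw [real_inner_self_eq_norm_sq, hJf] at h1
    have : ∫ q in Ω, (f : TripleSpace Ω) q 0 * (f : TripleSpace Ω) q 0 ∂gauss2 = 0 := by
      rw [← integral_zero (ℝ × ℝ) ℝ (μ := gauss2.restrict Ω)]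
      refine integral_congr_ae ?_
      filter_upwards [ae_gauss2_restrict_iff.2 h0] with q hq
      rw [hq]; simp
    rw [this] at h1
    exact hJ0.ne' h1
  · intro φ φx φy hφ
    refine hf1.weak_eq_of_odd hΩ hsym hf2 (fun φ φx φy h hodd => ?_) hφ
    let g : oddH1 hσ := ⟨_, h.toTriple_mem_oddH1 hΩ hsym hodd hσ⟩
    have h1 := hinJ f g
    have h2 := hin f g
    have h3 := J.inner_map_map_of_norm_eq hf hJf g
    have e1 : ∫ q in Ω, (f : TripleSpace Ω) q 0 * h.toTriple q 0 ∂gauss2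
        = ∫ q in Ω, (f : TripleSpace Ω) q 0 * φ q ∂gauss2 := integral_congr_ae <| by
      filter_upwards [h.ae_toTriple] with q hq
      rw [hq.1]
    have e2 : ∫ q in Ω, ((f : TripleSpace Ω) q 1 * h.toTriple q 1
          + (f : TripleSpace Ω) q 2 * h.toTriple q 2) ∂gauss2
        = ∫ q in Ω, ((f : TripleSpace Ω) q 1 * φx q + (f : TripleSpace Ω) q 2 * φy q) ∂gauss2 :=
      integral_congr_ae <| by
        filter_upwards [h.ae_toTriple] with q hq
        rw [hq.2.1, hq.2.2]
    rw [← e1, ← e2, ← h1]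
    rw [h2] at h3
    rw [sub_mul, one_mul, eq_sub_iff_add_eq', div_mul_eq_mul_div, one_mul, eq_div_iff hJ0.ne',
      mul_comm _ (‖J‖ ^ 2)]
    exact h3.symm
  · rintro m ⟨u, ux, uy, hu, hodd⟩
    have h1 := hineq u ux uy hu.memH1 hodd
    rw [hu.weak_eq u ux uy hu.memH1] at h1
    have hpos := integral_sq_pos hu.memH1.memLp hu.ne_zero
    simp only [sq] at hpos
    exact le_of_mul_le_mul_right h1 hpos

end Existence

/-! ### The one-dimensional inequality on symmetric subintervals. -/

section OddPrimitive

variable {a : EReal}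

theorem MemH1Line.congr_ae {I : Set ℝ} {z dz z' dz' : ℝ → ℝ} (h : MemH1Line I z dz)
    (hz : z =ᵐ[volume.restrict I] z') (hdz : dz =ᵐ[volume.restrict I] dz') :
    MemH1Line I z' dz' where
  memLp := h.memLp.ae_eq ((gauss1_absolutelyContinuous.restrict I).ae_le hz)
  memLp_deriv := h.memLp_deriv.ae_eq ((gauss1_absolutelyContinuous.restrict I).ae_le hdz)
  weakDeriv := h.weakDeriv.congr_ae hz hdz

theorem measurePreserving_neg_gauss1_restrict (a : EReal) :
    MeasurePreserving (fun x : ℝ => -x) (gauss1.restrict (openInterval (-a) a))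
      (gauss1.restrict (openInterval (-a) a)) := by
  have := measurePreserving_neg_gauss1.restrict_preimage
    (isOpen_openInterval (-a) a).measurableSet
  convert this using 2
  ext x
  rw [mem_preimage, mem_openInterval_neg_iff, mem_openInterval_neg_iff, abs_neg]

theorem odd_primitive_of_even {g : ℝ → ℝ}
    (heven : ∀ᵐ x, x ∈ openInterval (-a) a → g (-x) = g x) {x : ℝ}
    (hx : x ∈ openInterval (-a) a) :
    ∫ t in (0 : ℝ)..-x, g t = - ∫ t in (0 : ℝ)..x, g t := by
  have h1 : ∫ t in (0 : ℝ)..x, g (-t) = ∫ t in (0 : ℝ)..x, g t := by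
    refine intervalIntegral.integral_congr_ae ?_
    filter_upwards [heven] with t ht htx
    refine ht (mem_openInterval_of_abs_le hx ?_)
    rcases le_total 0 x with h | h
    · rw [uIoc_of_le h] at htx
      rw [abs_of_pos htx.1, abs_of_nonneg h]; exact htx.2
    · rw [uIoc_of_ge h] at htx
      rw [abs_of_nonpos htx.2, abs_of_nonpos h]; linarith [htx.1]
  rw [← h1, intervalIntegral.integral_comp_neg, neg_zero, intervalIntegral.integral_symm]

theorem memH1Line_primitive (ha : 0 < a) {g : ℝ → ℝ}
    (hg : MemLp g 2 (gauss1.restrict (openInterval (-a) a)))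
    (hL : MemLp (fun x => ∫ t in (0 : ℝ)..x, g t) 2 (gauss1.restrict (openInterval (-a) a))) :
    MemH1Line (openInterval (-a) a) (fun x => ∫ t in (0 : ℝ)..x, g t) g :=
  ⟨hL, hg, hasWeakDeriv_primitive (isOpen_openInterval (-a) a) (ordConnected_openInterval a)
    (zero_mem_openInterval ha)
    (locallyIntegrableOn_of_memLp_gauss1 (isOpen_openInterval (-a) a) hg)⟩

theorem integral_eq_zero_of_odd {F : ℝ → ℝ} (hF : ∀ x ∈ openInterval (-a) a, F (-x) = - F x) :
    ∫ x in openInterval (-a) a, F x ∂gauss1 = 0 := by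
  have h1 := (measurePreserving_neg_gauss1_restrict a).integral_comp
    (MeasurableEquiv.neg ℝ).measurableEmbedding F
  rw [setIntegral_congr_fun (isOpen_openInterval (-a) a).measurableSet hF, integral_neg] at h1
  linarith

theorem nonneg_of_mem_rayleighQuotients (α β : EReal) {R : ℝ} (hR : R ∈ rayleighQuotients α β) :
    0 ≤ R := by
  obtain ⟨z, dz, -, -, -, rfl⟩ := hR
  exact div_nonneg (integral_nonneg fun x => sq_nonneg _) (integral_nonneg fun x => sq_nonneg _)

theorem mu1_nonneg (α β : EReal) : 0 ≤ mu1 α β :=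
  Real.sInf_nonneg fun _ hR => nonneg_of_mem_rayleighQuotients α β hR

theorem gauss1_ae_restrict_iff {I : Set ℝ} {P : ℝ → Prop} :
    (∀ᵐ q ∂gauss1.restrict I, P q) ↔ ∀ᵐ q ∂volume.restrict I, P q :=
  ⟨fun h => (volume_absolutelyContinuous_gauss1.restrict I).ae_le h,
    fun h => (gauss1_absolutelyContinuous.restrict I).ae_le h⟩

theorem integral_sq_pos_line {I : Set ℝ} {f : ℝ → ℝ} (hf : MemLp f 2 (gauss1.restrict I))
    (h : ¬ f =ᵐ[volume.restrict I] 0) : 0 < ∫ q in I, f q ^ 2 ∂gauss1 := by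
  refine lt_of_le_of_ne (integral_nonneg fun q => sq_nonneg _) fun h0 => h ?_
  have := (integral_eq_zero_iff_of_nonneg (fun q => sq_nonneg (f q)) hf.integrable_sq).1 h0.symm
  refine gauss1_ae_restrict_iff.1 ?_
  filter_upwards [this] with q hq
  simpa using hq

/-- The multiplied form of the variational inequality also covers z = 0 and does not presuppose that
the infimum is attained. -/
theorem MemH1Line.mu1_mul_le {α β : EReal} {z dz : ℝ → ℝ}
    (h : MemH1Line (openInterval α β) z dz) (h0 : ∫ x in openInterval α β, z x ∂gauss1 = 0) :
    mu1 α β * ∫ x in openInterval α β, z x ^ 2 ∂gauss1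
      ≤ ∫ x in openInterval α β, dz x ^ 2 ∂gauss1 := by
  by_cases hz : z =ᵐ[volume.restrict (openInterval α β)] 0
  · have : ∫ x in openInterval α β, z x ^ 2 ∂gauss1 = 0 := by
      rw [← integral_zero ℝ ℝ (μ := gauss1.restrict (openInterval α β))]
      refine integral_congr_ae ?_
      filter_upwards [gauss1_ae_restrict_iff.2 hz] with q hq
      rw [hq]; simp
    rw [this, mul_zero]
    exact integral_nonneg fun x => sq_nonneg _
  · rw [← le_div_iff₀ (integral_sq_pos_line h.memLp hz)]
    exact csInf_le ⟨0, fun _ hR => nonneg_of_mem_rayleighQuotients α β hR⟩ ⟨z, dz, h, hz, h0, rfl⟩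

/-- The primitive of a function that vanishes outside a symmetric interval `S` of `(-a, a)` is
square integrable on `(-a, a)` as soon as it is so on `S`. -/
theorem memLp_primitive_indicator (ha : 0 < a) {S : Set ℝ} (hS : MeasurableSet S)
    (hsym : ∀ x ∈ S, -x ∈ S) (hc : OrdConnected S) (hSI : S ⊆ openInterval (-a) a)
    {h : ℝ → ℝ} (hh : Measurable h) (hfin : ∫⁻ x in S, ‖h x‖ₑ ^ 2 ∂gauss1 ≠ ⊤)
    (hF : ∫⁻ x in S, ‖∫ t in (0 : ℝ)..x, S.indicator h t‖ₑ ^ 2 ∂gauss1 ≠ ⊤) :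
    MemLp (S.indicator h) 2 (gauss1.restrict (openInterval (-a) a)) ∧
    MemLp (fun x => ∫ t in (0 : ℝ)..x, S.indicator h t) 2
      (gauss1.restrict (openInterval (-a) a)) := by
  set I := openInterval (-a) a with hI
  have hIo : IsOpen I := isOpen_openInterval (-a) a
  have hgm : Measurable (S.indicator h) := hh.indicator hS
  have hgfin : ∫⁻ x in I, ‖S.indicator h x‖ₑ ^ 2 ∂gauss1 ≠ ⊤ := by
    have e : ∀ x, ‖S.indicator h x‖ₑ ^ 2 = S.indicator (fun x => ‖h x‖ₑ ^ 2) x := fun x => by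
      by_cases hx : x ∈ S <;> simp [hx]
    simp only [e]
    rwa [lintegral_indicator hS, Measure.restrict_restrict hS, inter_eq_self_of_subset_left hSI]
  have hcont := continuousOn_primitive_of_lintegral hIo (ordConnected_openInterval a) hgm hgfin
    (zero_mem_openInterval ha)
  refine ⟨memLp_two_of_lintegral hgm hgfin, ?_⟩
  have haes : AEStronglyMeasurable (fun x => ∫ t in (0 : ℝ)..x, S.indicator h t)
      (gauss1.restrict I) := hcont.aestronglyMeasurable hIo.measurableSet
  by_cases hSeq : S = I
  · refine ⟨haes, ?_⟩
    rw [eLpNorm_lt_top_iff_lintegral_rpow_enorm_lt_top (by norm_num) (by norm_num)]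
    rw [← hSeq]
    simpa using lt_top_iff_ne_top.2 hF
  -- By symmetry and convexity `S` lies in |x| < |x₀|. The primitive is constant beyond ±|x₀| and
  -- bounded in between by continuity, so it is square integrable for the finite measure.
  · obtain ⟨x₀, hx₀I, hx₀S⟩ : ∃ x₀ ∈ I, x₀ ∉ S := by
      by_contra! hcon
      exact hSeq (hSI.antisymm hcon)
    have hSsub : ∀ x ∈ S, |x| < |x₀| := by
      intro x hx
      by_contra! hle
      refine hx₀S (hc.out (x := -|x|) (y := |x|) ?_ ?_ (abs_le.1 hle))
      · rcases abs_choice x with h | h <;> rw [h]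
        · exact hsym x hx
        · simpa using hx
      · rcases abs_choice x with h | h <;> rw [h]
        · exact hx
        · exact hsym x hx
    have hKI : Icc (-|x₀|) |x₀| ⊆ I := fun x hx =>
      mem_openInterval_of_abs_le hx₀I (abs_le.2 hx)
    obtain ⟨M, hM⟩ := isCompact_Icc.exists_bound_of_continuousOn (hcont.mono hKI)
    refine MemLp.of_bound (C := M) haes ?_
    refine (ae_restrict_iff' hIo.measurableSet).2 (Eventually.of_forall fun x hxI => ?_)
    have hvanish : ∀ y z : ℝ, (∀ t ∈ uIoc y z, |x₀| ≤ |t|) →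
        ∫ t in y..z, S.indicator h t = 0 := by
      intro y z hyz
      refine intervalIntegral.integral_zero_ae (Eventually.of_forall fun t ht => ?_)
      exact indicator_of_notMem (fun hts => (hyz t ht).not_gt (hSsub t hts)) _
    have hII : ∀ y z, y ∈ I → z ∈ I → IntervalIntegrable (S.indicator h) volume y z :=
      fun y z hy hz => (intervalIntegrable_of_memLp (memLp_uIcc_of_lintegral_gauss1 hgm hgfin
        ((ordConnected_openInterval a).uIcc_subset hy hz))).1
    have h0I := zero_mem_openInterval ha
    rcases le_or_gt |x| |x₀| with hle | hlt
    · exact hM x (abs_le.1 hle)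
    · have hx0 : 0 ≤ |x₀| := abs_nonneg x₀
      rcases le_total 0 x with hx | hx
      · rw [abs_of_nonneg hx] at hlt
        have hm : |x₀| ∈ Icc (-|x₀|) |x₀| := ⟨by linarith, le_rfl⟩
        rw [← intervalIntegral.integral_add_adjacent_intervals (hII 0 |x₀| h0I (hKI hm))
          (hII |x₀| x (hKI hm) hxI), hvanish |x₀| x, add_zero]
        · exact hM _ hm
        · intro t ht
          rw [uIoc_of_le hlt.le] at ht
          exact ht.1.le.trans (le_abs_self t)
      · rw [abs_of_nonpos hx] at hlt
        have hm : -|x₀| ∈ Icc (-|x₀|) |x₀| := ⟨le_rfl, by linarith⟩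
        rw [← intervalIntegral.integral_add_adjacent_intervals (hII 0 (-|x₀|) h0I (hKI hm))
          (hII (-|x₀|) x (hKI hm) hxI), hvanish (-|x₀|) x, add_zero]
        · exact hM _ hm
        · intro t ht
          rw [uIoc_of_ge (by linarith)] at ht
          exact le_trans (by linarith [ht.2]) (neg_le_abs t)

theorem integral_indicator_primitive {S : Set ℝ} (hc : OrdConnected S) (h0 : (0 : ℝ) ∈ S)
    {h : ℝ → ℝ} {x : ℝ} (hx : x ∈ S) :
    ∫ t in (0 : ℝ)..x, S.indicator h t = ∫ t in (0 : ℝ)..x, h t :=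
  intervalIntegral.integral_congr fun _ ht => indicator_of_mem (hc.uIcc_subset h0 hx ht) _

/-- Cutting h off outside `S` gives a competitor on (-a, a): evenness of h makes its primitive odd,
hence of mean zero; the energy lives on `S`, and restricting the L² norm back to `S` only decreases
it. -/
theorem mu1_mul_lintegral_primitive_le (ha : 0 < a) {S : Set ℝ} (hS : MeasurableSet S)
    (hsym : ∀ x ∈ S, -x ∈ S) (hc : OrdConnected S) (hSI : S ⊆ openInterval (-a) a)
    (h0 : (0 : ℝ) ∈ S) {h : ℝ → ℝ} (hh : Measurable h)
    (heven : ∀ᵐ x, x ∈ S → h (-x) = h x) (hfin : ∫⁻ x in S, ‖h x‖ₑ ^ 2 ∂gauss1 ≠ ⊤)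
    (hF : ∫⁻ x in S, ‖∫ t in (0 : ℝ)..x, h t‖ₑ ^ 2 ∂gauss1 ≠ ⊤) :
    ENNReal.ofReal (mu1 (-a) a) * ∫⁻ x in S, ‖∫ t in (0 : ℝ)..x, h t‖ₑ ^ 2 ∂gauss1
      ≤ ∫⁻ x in S, ‖h x‖ₑ ^ 2 ∂gauss1 := by
  have e : ∫⁻ x in S, ‖∫ t in (0 : ℝ)..x, S.indicator h t‖ₑ ^ 2 ∂gauss1
      = ∫⁻ x in S, ‖∫ t in (0 : ℝ)..x, h t‖ₑ ^ 2 ∂gauss1 :=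
    setLIntegral_congr_fun hS fun x hx => by
      simp only [integral_indicator_primitive hc h0 hx]
  obtain ⟨hg, hL⟩ := memLp_primitive_indicator ha hS hsym hc hSI hh hfin (e ▸ hF)
  have heven' : ∀ᵐ x, x ∈ openInterval (-a) a → S.indicator h (-x) = S.indicator h x := by
    filter_upwards [heven] with x hx _
    by_cases hxS : x ∈ S
    · rw [indicator_of_mem hxS, indicator_of_mem (hsym x hxS), hx hxS]
    · rw [indicator_of_notMem hxS, indicator_of_notMem fun h => hxS (by simpa using hsym _ h)]
  have key := (memH1Line_primitive ha hg hL).mu1_mul_le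
    (integral_eq_zero_of_odd fun x hx => odd_primitive_of_even heven' hx)
  have e2 : ∫⁻ x in openInterval (-a) a, ‖S.indicator h x‖ₑ ^ 2 ∂gauss1
      = ∫⁻ x in S, ‖h x‖ₑ ^ 2 ∂gauss1 := by
    have e : ∀ x, ‖S.indicator h x‖ₑ ^ 2 = S.indicator (fun x => ‖h x‖ₑ ^ 2) x := fun x => by
      by_cases hx : x ∈ S <;> simp [hx]
    simp only [e]
    rw [lintegral_indicator hS, Measure.restrict_restrict hS, inter_eq_self_of_subset_left hSI]
  rw [← ENNReal.ofReal_le_ofReal_iff (integral_nonneg fun x => sq_nonneg _),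
    ENNReal.ofReal_mul (mu1_nonneg _ _), ofReal_integral_sq hL, ofReal_integral_sq hg, e2] at key
  refine le_trans ?_ key
  rw [← e]
  gcongr

end OddPrimitive

/-! ### Slicing and the lower bound for odd eigenvalues. -/

section Slicing

variable {a : EReal} {p : ℝ → ℝ}

theorem IsRegionProfile.ae_slice_facts (hp : IsRegionProfile a p) {u ux uy : ℝ × ℝ → ℝ}
    (h : MeasurableH1Plane (regionBelow a p) u ux uy)
    (hodd : ∀ᵐ q ∂volume.restrict (regionBelow a p), u (-q.1, q.2) = - u q) :
    ∀ᵐ y : ℝ, (0, y) ∈ regionBelow a p →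
      (∀ᵐ x, x ∈ {x | (x, y) ∈ regionBelow a p} → ux (-x, y) = ux (x, y)) ∧
      ∫⁻ x in {x | (x, y) ∈ regionBelow a p}, ‖ux (x, y)‖ₑ ^ 2 ∂gauss1 ≠ ⊤ ∧
      ∫⁻ x in {x | (x, y) ∈ regionBelow a p}, ‖u (x, y)‖ₑ ^ 2 ∂gauss1 ≠ ⊤ ∧
      ∫⁻ x in {x | (x, y) ∈ regionBelow a p}, ‖∫ t in (0 : ℝ)..x, ux (t, y)‖ₑ ^ 2 ∂gauss1
        = ∫⁻ x in {x | (x, y) ∈ regionBelow a p}, ‖u (x, y)‖ₑ ^ 2 ∂gauss1 := by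
  have hΩ := hp.isOpen
  have hr := ae_ae_of_ae_plane ((ae_restrict_iff' hΩ.measurableSet).1
    (h.memH1.ae_reflect_of_odd hΩ hp.symmYAxis hodd))
  have hum := h.measurable
  filter_upwards [hp.ae_odd_slice h hodd, hr, ae_setLIntegral_slice_ne_top hΩ.measurableSet
    (by fun_prop) (lintegral_enorm_sq_ne_top_of_memLp h.memH1.memLp)] with y h1 h2 h3 h0
  obtain ⟨h4, h5, -⟩ := h1 h0
  refine ⟨h2.mono fun x hx hxS => (hx hxS).2.1, h4, h3, ?_⟩
  refine setLIntegral_congr_fun_ae (measurable_prodMk_right hΩ.measurableSet) ?_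
  filter_upwards [gauss1_absolutelyContinuous.ae_le h5] with x hx hxS
  rw [hx hxS]

/-- A slice that misses 0 is empty, because the region contains (t, y) whenever it contains (x, y)
with |t| ≤ |x|. On the other slices the interval inequality applies. -/
theorem IsRegionProfile.ae_mu1_mul_slice_le (hp : IsRegionProfile a p) {u ux uy : ℝ × ℝ → ℝ}
    (h : MeasurableH1Plane (regionBelow a p) u ux uy)
    (hodd : ∀ᵐ q ∂volume.restrict (regionBelow a p), u (-q.1, q.2) = - u q) :
    ∀ᵐ y : ℝ, ENNReal.ofReal (mu1 (-a) a) *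
      ∫⁻ x in {x | (x, y) ∈ regionBelow a p}, ‖u (x, y)‖ₑ ^ 2 ∂gauss1
        ≤ ∫⁻ x in {x | (x, y) ∈ regionBelow a p}, ‖ux (x, y)‖ₑ ^ 2 ∂gauss1 := by
  have hmx := h.measurable_dx
  filter_upwards [hp.ae_slice_facts h hodd] with y hy
  by_cases h0 : (0, y) ∈ regionBelow a p
  · obtain ⟨h1, h2, h3, h4⟩ := hy h0
    rw [← h4] at h3 ⊢
    exact mu1_mul_lintegral_primitive_le (h := fun x => ux (x, y)) hp.pos
      (measurable_prodMk_right hp.isOpen.measurableSet) (fun x hx => hp.neg_mem hx)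
      (hp.ordConnected_horizontal y) (fun x hx => hx.1) h0 (by fun_prop) h1 h2 h3
  · have : {x | (x, y) ∈ regionBelow a p} = ∅ := by
      ext x
      simp only [mem_ofPred_eq, mem_empty_iff_false, iff_false]
      exact fun hx => h0 (hp.mem_of_abs_le hx (by simp))
    simp [this]

theorem IsRegionProfile.mu1_mul_lintegral_le (hp : IsRegionProfile a p) {u ux uy : ℝ × ℝ → ℝ}
    (h : MeasurableH1Plane (regionBelow a p) u ux uy)
    (hodd : ∀ᵐ q ∂volume.restrict (regionBelow a p), u (-q.1, q.2) = - u q) :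
    ENNReal.ofReal (mu1 (-a) a) * ∫⁻ q in regionBelow a p, ‖u q‖ₑ ^ 2 ∂gauss2
      ≤ ∫⁻ q in regionBelow a p, ‖ux q‖ₑ ^ 2 ∂gauss2 := by
  have hm := hp.isOpen.measurableSet
  have hum := h.measurable
  have hmx := h.measurable_dx
  rw [setLIntegral_gauss2_horizontal hm (by fun_prop),
    setLIntegral_gauss2_horizontal hm (by fun_prop),
    ← lintegral_const_mul _ (measurable_slice_lintegral hm (F := fun q => ‖u q‖ₑ ^ 2)
      (by fun_prop))]
  exact lintegral_mono_ae (gauss1_absolutelyContinuous.ae_le (hp.ae_mu1_mul_slice_le h hodd))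

/-- An odd eigenfunction with a jointly measurable gradient, together with its energy identity. -/
theorem IsRegionProfile.exists_measurable_of_mem (hp : IsRegionProfile a p) {m : ℝ}
    (hm : m ∈ oddNeumannEigenvalues (regionBelow a p)) :
    ∃ u ux uy, MeasurableH1Plane (regionBelow a p) u ux uy ∧
      (∀ᵐ q ∂volume.restrict (regionBelow a p), u (-q.1, q.2) = - u q) ∧
      0 < ∫ q in regionBelow a p, u q ^ 2 ∂gauss2 ∧
      (∫ q in regionBelow a p, ux q ^ 2 ∂gauss2) + (∫ q in regionBelow a p, uy q ^ 2 ∂gauss2)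
        = m * ∫ q in regionBelow a p, u q ^ 2 ∂gauss2 := by
  obtain ⟨u, ux, uy, hu, hodd⟩ := hm
  have h := hu.memH1.measurableH1Plane_toTriple
  refine ⟨_, _, _, h, hu.memH1.odd_toTriple hp.isOpen hp.symmYAxis hodd, ?_, ?_⟩
  · refine (integral_sq_pos hu.memH1.memLp hu.ne_zero).trans_eq (integral_congr_ae ?_)
    filter_upwards [hu.memH1.ae_toTriple] with q hq
    rw [hq.1]
  · have key := hu.weak_eq u ux uy hu.memH1
    rw [← integral_add h.memH1.memLp_dx.integrable_sq h.memH1.memLp_dy.integrable_sq]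
    simp only [← sq] at key
    convert key using 1
    · refine integral_congr_ae ?_
      filter_upwards [hu.memH1.ae_toTriple] with q hq
      rw [hq.2.1, hq.2.2]
    · congr 1
      refine integral_congr_ae ?_
      filter_upwards [hu.memH1.ae_toTriple] with q hq
      rw [hq.1]

/-- The slicing inequality uses only the x-part of the energy; the y-part is discarded as
nonnegative. -/
theorem IsRegionProfile.mu1_le (hp : IsRegionProfile a p) {m : ℝ}
    (hm : m ∈ oddNeumannEigenvalues (regionBelow a p)) : mu1 (-a) a ≤ m := by
  obtain ⟨u, ux, uy, h, hodd, hpos, heq⟩ := hp.exists_measurable_of_mem hm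
  have key := hp.mu1_mul_lintegral_le h hodd
  rw [← ofReal_integral_sq h.memH1.memLp, ← ofReal_integral_sq h.memH1.memLp_dx,
    ← ENNReal.ofReal_mul (mu1_nonneg _ _),
    ENNReal.ofReal_le_ofReal_iff (integral_nonneg fun q => sq_nonneg _)] at key
  have hy : 0 ≤ ∫ q in regionBelow a p, uy q ^ 2 ∂gauss2 := integral_nonneg fun q => sq_nonneg _
  exact le_of_mul_le_mul_right (by linarith) hpos

end Slicing

/-! ### Half-strips: equality, and attainment of the one-dimensional minimum. -/

section HalfStrip

variable {a : EReal}

theorem isRegionProfile_const (ha : 0 < a) (b : ℝ) : IsRegionProfile a fun _ => b :=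
  ⟨ha, continuousOn_const, fun _ _ _ _ => le_rfl⟩

theorem gauss1_real_Iio_pos (b : ℝ) : 0 < (gauss1.restrict (Iio b)).real univ := by
  rw [measureReal_restrict_apply_univ]
  refine ENNReal.toReal_pos (fun h => ?_) (measure_ne_top _ _)
  have := volume_absolutelyContinuous_gauss1 h
  rw [Real.volume_Iio] at this
  exact ENNReal.top_ne_zero this

theorem integral_halfStrip_fst (a : EReal) (b : ℝ) (f : ℝ → ℝ) :
    ∫ q in halfStrip a b, f q.1 ∂gauss2
      = (gauss1.restrict (Iio b)).real univ * ∫ x in openInterval (-a) a, f x ∂gauss1 := by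
  rw [halfStrip, gauss2, ← Measure.prod_restrict, integral_fun_fst, smul_eq_mul]

/-- The lowest odd eigenvalue of a half-strip bounds the quotients of odd functions of `x`. -/
theorem le_of_odd_line (ha : 0 < a) {b m : ℝ}
    (hm : ∀ u ux uy, MemH1Plane (halfStrip a b) u ux uy →
        (∀ᵐ q ∂volume.restrict (halfStrip a b), u (-q.1, q.2) = - u q) →
        m * ∫ q in halfStrip a b, u q * u q ∂gauss2
          ≤ ∫ q in halfStrip a b, (ux q * ux q + uy q * uy q) ∂gauss2)
    {g : ℝ → ℝ} (heven : ∀ x, g (-x) = g x)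
    (hg : MemLp g 2 (gauss1.restrict (openInterval (-a) a)))
    (hL : MemLp (fun x => ∫ t in (0 : ℝ)..x, g t) 2 (gauss1.restrict (openInterval (-a) a))) :
    m * ∫ x in openInterval (-a) a, (∫ t in (0 : ℝ)..x, g t) ^ 2 ∂gauss1
      ≤ ∫ x in openInterval (-a) a, g x ^ 2 ∂gauss1 := by
  have h := (memH1Line_primitive ha hg hL).memH1Plane (isOpen_openInterval (-a) a)
    (Ω := halfStrip a b) fun q hq => hq.1
  have key := hm _ _ _ h <| by
    refine (ae_restrict_iff' ((isRegionProfile_const ha b).isOpen.measurableSet)).2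
      (Eventually.of_forall fun q hq => ?_)
    exact odd_primitive_of_even (Eventually.of_forall fun x _ => heven x) hq.1
  simp only [← sq, Pi.zero_apply, ne_eq, OfNat.ofNat_ne_zero, not_false_eq_true, zero_pow,
    add_zero] at key
  rw [integral_halfStrip_fst a b fun x => (∫ t in (0 : ℝ)..x, g t) ^ 2,
    integral_halfStrip_fst a b fun x => g x ^ 2, mul_left_comm] at key
  exact le_of_mul_le_mul_left key (gauss1_real_Iio_pos b)

/-- With F the primitive of h from 0, the primitives of h(|t|) and h(-|t|) at x ≥ 0 are F(x) and
-F(-x), and both are odd in x: they are the odd extensions of the two halves of F. -/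
theorem integral_even_extensions_sq (h : ℝ → ℝ) (x : ℝ) :
    (∫ t in (0 : ℝ)..x, h |t|) ^ 2 + (∫ t in (0 : ℝ)..x, h (-|t|)) ^ 2
      = (∫ t in (0 : ℝ)..x, h t) ^ 2 + (∫ t in (0 : ℝ)..-x, h t) ^ 2 := by
  have hpos : ∀ x : ℝ, 0 ≤ x → ∀ k : ℝ → ℝ, ∫ t in (0 : ℝ)..x, k |t| = ∫ t in (0 : ℝ)..x, k t :=
    fun x hx k => intervalIntegral.integral_congr fun t ht => by
      rw [uIcc_of_le hx] at ht
      simp only [abs_of_nonneg ht.1]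
  have hneg : ∀ x : ℝ, ∀ k : ℝ → ℝ, ∫ t in (0 : ℝ)..-x, k t = - ∫ t in (0 : ℝ)..x, k (-t) := by
    intro x k
    rw [intervalIntegral.integral_comp_neg, neg_zero, intervalIntegral.integral_symm]
  rcases le_total 0 x with hx | hx
  · rw [hpos x hx h, hpos x hx fun t => h (-t), hneg x h, neg_sq]
  · have e1 : ∀ k : ℝ → ℝ, ∫ t in (0 : ℝ)..x, k |t| = - ∫ t in (0 : ℝ)..-x, k t := by
      intro k
      have := hneg (-x) fun t => k |t|
      rw [neg_neg] at this
      rw [this]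
      simp only [abs_neg]
      rw [hpos (-x) (by linarith)]
    have e2 := hneg (-x) h
    rw [neg_neg] at e2
    rw [e1 h, e1 fun t => h (-t), e2]
    ring

/-- The inequality for odd functions is applied to the odd extensions of the right and the left half
of the primitive and then summed; by symmetry of γ₁ both sides are doubled. -/
theorem le_of_line (ha : 0 < a) {b m : ℝ}
    (hm : ∀ u ux uy, MemH1Plane (halfStrip a b) u ux uy →
        (∀ᵐ q ∂volume.restrict (halfStrip a b), u (-q.1, q.2) = - u q) →
        m * ∫ q in halfStrip a b, u q * u q ∂gauss2
          ≤ ∫ q in halfStrip a b, (ux q * ux q + uy q * uy q) ∂gauss2)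
    {g : ℝ → ℝ} (hgm : Measurable g)
    (hg : MemLp g 2 (gauss1.restrict (openInterval (-a) a)))
    (hL : MemLp (fun x => ∫ t in (0 : ℝ)..x, g t) 2 (gauss1.restrict (openInterval (-a) a))) :
    m * ∫ x in openInterval (-a) a, (∫ t in (0 : ℝ)..x, g t) ^ 2 ∂gauss1
      ≤ ∫ x in openInterval (-a) a, g x ^ 2 ∂gauss1 := by
  set I := openInterval (-a) a with hI
  have hIo : IsOpen I := isOpen_openInterval (-a) a
  have hσ := measurePreserving_neg_gauss1_restrict a
  have hgn : MemLp (fun x => g (-x)) 2 (gauss1.restrict I) := hg.comp_measurePreserving hσ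
  have hLn : MemLp (fun x => ∫ t in (0 : ℝ)..-x, g t) 2 (gauss1.restrict I) :=
    hL.comp_measurePreserving hσ
  -- Each half is square integrable because its square is dominated by the sum of the two squares.
  have hdom : ∀ {k₁ k₂ : ℝ → ℝ}, AEStronglyMeasurable k₁ (gauss1.restrict I) →
      (∀ x, k₁ x ^ 2 + k₂ x ^ 2 = g x ^ 2 + g (-x) ^ 2) → MemLp k₁ 2 (gauss1.restrict I) := by
    intro k₁ k₂ hk hsum
    refine (memLp_two_iff_integrable_sq hk).2
      ((hg.integrable_sq.add hgn.integrable_sq).mono' (hk.pow 2) (Eventually.of_forall fun x => ?_))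
    rw [Real.norm_eq_abs, abs_of_nonneg (sq_nonneg _), Pi.add_apply]
    nlinarith [hsum x, sq_nonneg (k₂ x)]
  have hsum : ∀ x, g |x| ^ 2 + g (-|x|) ^ 2 = g x ^ 2 + g (-x) ^ 2 := by
    intro x
    rcases abs_choice x with h | h <;> rw [h]
    rw [neg_neg, add_comm]
  have hg1 : MemLp (fun x => g |x|) 2 (gauss1.restrict I) :=
    hdom (by fun_prop : Measurable fun x => g |x|).aestronglyMeasurable hsum
  have hg2 : MemLp (fun x => g (-|x|)) 2 (gauss1.restrict I) :=
    hdom (k₂ := fun x => g |x|) (by fun_prop : Measurable fun x => g (-|x|)).aestronglyMeasurable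
      fun x => by rw [add_comm, hsum]
  have hFm : ∀ {k : ℝ → ℝ}, MemLp k 2 (gauss1.restrict I) →
      AEStronglyMeasurable (fun x => ∫ t in (0 : ℝ)..x, k t) (gauss1.restrict I) := fun hk =>
    (continuousOn_primitive hIo (ordConnected_openInterval a) (zero_mem_openInterval ha)
      (locallyIntegrableOn_of_memLp_gauss1 hIo hk)).aestronglyMeasurable hIo.measurableSet
  have hdomF : ∀ {k₁ k₂ : ℝ → ℝ}, AEStronglyMeasurable k₁ (gauss1.restrict I) →
      (∀ x, k₁ x ^ 2 + k₂ x ^ 2 = (∫ t in (0 : ℝ)..x, g t) ^ 2 + (∫ t in (0 : ℝ)..-x, g t) ^ 2) →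
      MemLp k₁ 2 (gauss1.restrict I) := by
    intro k₁ k₂ hk hsum
    refine (memLp_two_iff_integrable_sq hk).2
      ((hL.integrable_sq.add hLn.integrable_sq).mono' (hk.pow 2) (Eventually.of_forall fun x => ?_))
    rw [Real.norm_eq_abs, abs_of_nonneg (sq_nonneg _), Pi.add_apply]
    nlinarith [hsum x, sq_nonneg (k₂ x)]
  have hF1 := hdomF (hFm hg1) (integral_even_extensions_sq g)
  have hF2 := hdomF (k₂ := fun x => ∫ t in (0 : ℝ)..x, g |t|) (hFm hg2)
    fun x => by rw [add_comm, integral_even_extensions_sq]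
  have i1 := le_of_odd_line ha hm (fun x => by rw [abs_neg]) hg1 hF1
  have i2 := le_of_odd_line ha hm (fun x => by rw [abs_neg]) hg2 hF2
  have s1 : (∫ x in I, (∫ t in (0 : ℝ)..x, g |t|) ^ 2 ∂gauss1)
      + ∫ x in I, (∫ t in (0 : ℝ)..x, g (-|t|)) ^ 2 ∂gauss1
      = 2 * ∫ x in I, (∫ t in (0 : ℝ)..x, g t) ^ 2 ∂gauss1 := by
    rw [← integral_add hF1.integrable_sq hF2.integrable_sq]
    simp only [integral_even_extensions_sq]
    rw [integral_add hL.integrable_sq hLn.integrable_sq,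
      hσ.integral_comp (MeasurableEquiv.neg ℝ).measurableEmbedding
        (fun x => (∫ t in (0 : ℝ)..x, g t) ^ 2)]
    ring
  have s2 : (∫ x in I, g |x| ^ 2 ∂gauss1) + ∫ x in I, g (-|x|) ^ 2 ∂gauss1
      = 2 * ∫ x in I, g x ^ 2 ∂gauss1 := by
    rw [← integral_add hg1.integrable_sq hg2.integrable_sq]
    simp only [hsum]
    rw [integral_add hg.integrable_sq hgn.integrable_sq,
      hσ.integral_comp (MeasurableEquiv.neg ℝ).measurableEmbedding (fun x => g x ^ 2)]
    ring
  have i3 := add_le_add i1 i2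
  rw [← mul_add, s1, s2] at i3
  linarith

/-- Deduced from the plane: lift z to the strip and take one good horizontal slice. -/
theorem MemH1Line.ae_eq_primitive (ha : 0 < a) {z dz : ℝ → ℝ}
    (h : MemH1Line (openInterval (-a) a) z dz) (hz : Measurable z) (hdz : Measurable dz) :
    ∃ k : ℝ, ∀ᵐ x, x ∈ openInterval (-a) a → z x = k + ∫ t in (0 : ℝ)..x, dz t := by
  have hIo := isOpen_openInterval (-a) a
  have h2 := h.memH1Plane_strip hIo
  have key := h2.weakDeriv_dx.ae_slice_primitive (hIo.prod isOpen_univ)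
    (fun y => by simpa using ordConnected_openInterval a) (by fun_prop) (by fun_prop)
    (lintegral_enorm_sq_ne_top_of_memLp h2.memLp_dx)
  obtain ⟨y, hy⟩ := key.exists
  simpa using hy.2 0 ⟨zero_mem_openInterval ha, mem_univ _⟩

theorem le_rayleighQuotient (ha : 0 < a) {b m : ℝ} (hm0 : 0 ≤ m)
    (hm : ∀ u ux uy, MemH1Plane (halfStrip a b) u ux uy →
        (∀ᵐ q ∂volume.restrict (halfStrip a b), u (-q.1, q.2) = - u q) →
        m * ∫ q in halfStrip a b, u q * u q ∂gauss2
          ≤ ∫ q in halfStrip a b, (ux q * ux q + uy q * uy q) ∂gauss2)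
    {R : ℝ} (hR : R ∈ rayleighQuotients (-a) a) : m ≤ R := by
  obtain ⟨z, dz, h, hne, hmean, rfl⟩ := hR
  have hIo := isOpen_openInterval (-a) a
  rw [le_div_iff₀ (integral_sq_pos_line h.memLp hne)]
  set z' := h.memLp.1.mk z
  set g := h.memLp_deriv.1.mk dz
  have hzz : z =ᵐ[gauss1.restrict (openInterval (-a) a)] z' := h.memLp.1.ae_eq_mk
  have hdg : dz =ᵐ[gauss1.restrict (openInterval (-a) a)] g := h.memLp_deriv.1.ae_eq_mk
  have hgm : Measurable g := h.memLp_deriv.1.stronglyMeasurable_mk.measurable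
  have h' : MemH1Line (openInterval (-a) a) z' g :=
    h.congr_ae (gauss1_ae_restrict_iff.1 hzz) (gauss1_ae_restrict_iff.1 hdg)
  obtain ⟨k, hk⟩ := h'.ae_eq_primitive ha h.memLp.1.stronglyMeasurable_mk.measurable hgm
  have hk' : ∀ᵐ x ∂gauss1.restrict (openInterval (-a) a),
      (∫ t in (0 : ℝ)..x, g t) = z x - k := by
    have := gauss1_ae_restrict_iff.2 ((ae_restrict_iff' hIo.measurableSet).2 hk)
    filter_upwards [this, hzz] with x hx hx'
    rw [hx', hx]; ring
  have hL : MemLp (fun x => ∫ t in (0 : ℝ)..x, g t) 2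
      (gauss1.restrict (openInterval (-a) a)) := by
    refine (h.memLp.sub (memLp_const k)).ae_eq ?_
    filter_upwards [hk'] with x hx
    rw [hx]; rfl
  have key := le_of_line ha hm hgm h'.memLp_deriv hL
  have hi : Integrable z (gauss1.restrict (openInterval (-a) a)) :=
    h.memLp.integrable (by norm_num)
  have e1 : ∫ x in openInterval (-a) a, g x ^ 2 ∂gauss1
      = ∫ x in openInterval (-a) a, dz x ^ 2 ∂gauss1 := integral_congr_ae <| by
    filter_upwards [hdg] with x hx
    rw [hx]
  -- Among the translates z - k, the mean-zero function z itself has the least L² norm.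
  have e2 : ∫ x in openInterval (-a) a, z x ^ 2 ∂gauss1
      ≤ ∫ x in openInterval (-a) a, (∫ t in (0 : ℝ)..x, g t) ^ 2 ∂gauss1 := by
    have : ∫ x in openInterval (-a) a, (∫ t in (0 : ℝ)..x, g t) ^ 2 ∂gauss1
        = ∫ x in openInterval (-a) a, (z x ^ 2 + (-(2 * k) * z x + k ^ 2)) ∂gauss1 :=
      integral_congr_ae <| by
        filter_upwards [hk'] with x hx
        rw [hx]; ring
    have i1 : Integrable (fun x => -(2 * k) * z x + k ^ 2)
        (gauss1.restrict (openInterval (-a) a)) := (hi.const_mul _).add (integrable_const _)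
    rw [this, integral_add h.memLp.integrable_sq i1, integral_add (hi.const_mul _)
      (integrable_const _), integral_const_mul, hmean, mul_zero, zero_add]
    exact le_add_of_nonneg_right (integral_nonneg fun _ => sq_nonneg k)
  calc m * ∫ x in openInterval (-a) a, z x ^ 2 ∂gauss1
      ≤ m * ∫ x in openInterval (-a) a, (∫ t in (0 : ℝ)..x, g t) ^ 2 ∂gauss1 := by gcongr
    _ ≤ _ := key.trans_eq e1

theorem rayleighQuotients_nonempty (ha : 0 < a) : (rayleighQuotients (-a) a).Nonempty := by
  have hIo := isOpen_openInterval (-a) a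
  have h0 := zero_mem_openInterval ha
  refine ⟨_, _, _, memH1Line_id hIo (ordConnected_openInterval a) h0, fun hz => ?_,
    integral_eq_zero_of_odd fun x _ => rfl, rfl⟩
  rw [EventuallyEq, ae_restrict_iff' hIo.measurableSet] at hz
  have hae : ∀ᵐ x : ℝ, x ∉ openInterval (-a) a := by
    filter_upwards [hz, compl_mem_ae_iff.2 (measure_singleton (0 : ℝ))] with x hx hx0 hxI
    exact hx0 (hx hxI)
  have : volume (openInterval (-a) a) = 0 :=
    measure_mono_null (fun q hq => by simpa using hq) hae
  exact (hIo.measure_pos volume ⟨0, h0⟩).ne' this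

/-- Slicing gives μ₁ ≤ m for the lowest odd eigenvalue m, and testing with functions of x alone
gives m ≤ every Rayleigh quotient, hence m ≤ μ₁. -/
theorem isLeast_oddNeumannEigenvalues_halfStrip (ha : 0 < a) (b : ℝ) :
    IsLeast (oddNeumannEigenvalues (halfStrip a b)) (mu1 (-a) a) := by
  have hp := isRegionProfile_const ha b
  obtain ⟨m, hm, hle⟩ := hp.exists_isLeast_oddNeumannEigenvalues
  have h1 : mu1 (-a) a ≤ m := hp.mu1_le hm.1
  have h2 : m ≤ mu1 (-a) a := le_csInf (rayleighQuotients_nonempty ha) fun R hR =>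
    le_rayleighQuotient ha ((mu1_nonneg _ _).trans h1) hle hR
  rwa [h1.antisymm h2]

/-- The minimiser is a horizontal slice of an odd eigenfunction for μ₁ on the half-strip y < 0,
where every slice with y < 0 is the whole interval (-a, a). -/
theorem isLeast_rayleighQuotients (ha : 0 < a) :
    IsLeast (rayleighQuotients (-a) a) (mu1 (-a) a) := by
  refine ⟨?_, fun R hR => csInf_le ⟨0, fun _ hR => nonneg_of_mem_rayleighQuotients _ _ hR⟩ hR⟩
  have hp := isRegionProfile_const ha 0
  have hm := hp.isOpen.measurableSet
  obtain ⟨u, ux, uy, h, hodd, hpos, heq⟩ :=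
    hp.exists_measurable_of_mem (isLeast_oddNeumannEigenvalues_halfStrip ha 0).1
  have hum := h.measurable
  have hmx := h.measurable_dx
  set Ω := regionBelow a fun _ => 0 with hΩdef
  set A : ℝ → ENNReal := fun y => ∫⁻ x in {x | (x, y) ∈ Ω}, ‖u (x, y)‖ₑ ^ 2 ∂gauss1 with hA
  set B : ℝ → ENNReal := fun y => ∫⁻ x in {x | (x, y) ∈ Ω}, ‖ux (x, y)‖ₑ ^ 2 ∂gauss1 with hB
  have hAm : Measurable A :=
    measurable_slice_lintegral hm (F := fun q => ‖u q‖ₑ ^ 2) (by fun_prop)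
  have hBm : Measurable B :=
    measurable_slice_lintegral hm (F := fun q => ‖ux q‖ₑ ^ 2) (by fun_prop)
  have hAint : ∫⁻ y, A y ∂gauss1 = ENNReal.ofReal (∫ q in Ω, u q ^ 2 ∂gauss2) := by
    rw [ofReal_integral_sq h.memH1.memLp, setLIntegral_gauss2_horizontal hm (by fun_prop)]
  have hBint : ∫⁻ y, B y ∂gauss1 = ENNReal.ofReal (∫ q in Ω, ux q ^ 2 ∂gauss2) := by
    rw [ofReal_integral_sq h.memH1.memLp_dx, setLIntegral_gauss2_horizontal hm (by fun_prop)]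
  have hle := gauss1_absolutelyContinuous.ae_le (hp.ae_mu1_mul_slice_le h hodd)
  -- The slice inequality μ₁ A ≤ B holds almost everywhere, while the energy identity gives ∫ B ≤ μ₁
  -- ∫ A < ∞; so equality holds almost everywhere.
  have hAB : (fun y => ENNReal.ofReal (mu1 (-a) a) * A y) =ᵐ[gauss1] B := by
    refine ae_eq_of_ae_le_of_lintegral_le hle ?_ hBm.aemeasurable ?_
    · rw [lintegral_const_mul _ hAm, hAint]
      exact ENNReal.mul_ne_top ENNReal.ofReal_ne_top ENNReal.ofReal_ne_top
    · rw [lintegral_const_mul _ hAm, hAint, hBint, ← ENNReal.ofReal_mul (mu1_nonneg _ _)]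
      refine ENNReal.ofReal_le_ofReal ?_
      have hy : 0 ≤ ∫ q in Ω, uy q ^ 2 ∂gauss2 := integral_nonneg fun q => sq_nonneg _
      linarith
  -- The eigenfunction is nonzero on a set of heights y of positive measure, so a nonzero slice can
  -- be chosen among those with equality.
  have hfreq : ∃ᵐ y ∂gauss1, A y ≠ 0 := by
    intro hcon
    have hz : ∫⁻ y, A y ∂gauss1 = 0 := by
      rw [lintegral_eq_zero_iff hAm]
      exact hcon.mono fun y hy => by simpa using hy
    rw [hAint, ENNReal.ofReal_eq_zero] at hz
    exact absurd hz (not_le.2 hpos)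
  obtain ⟨y, hAy, hABy, hfacts⟩ := (hfreq.and_eventually
    (hAB.and (gauss1_absolutelyContinuous.ae_le (hp.ae_slice_facts h hodd)))).exists
  have hy0 : y < 0 := by
    by_contra hcon
    refine hAy ?_
    have : {x | (x, y) ∈ Ω} = ∅ := by
      ext x
      simp only [mem_ofPred_eq, mem_empty_iff_false, iff_false]
      exact fun hx => hcon hx.2
    simp only [hA, this, Measure.restrict_empty, lintegral_zero_measure]
  have hSI : {x | (x, y) ∈ Ω} = openInterval (-a) a := by
    ext x
    exact ⟨fun hx => hx.1, fun hx => ⟨hx, hy0⟩⟩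
  obtain ⟨f1, f2, f3, f4⟩ := hfacts ⟨zero_mem_openInterval ha, hy0⟩
  simp only [hA, hB] at hAy hABy
  rw [← f4] at f3 hAy hABy
  rw [hSI] at f1 f2 f3 hAy hABy
  set I := openInterval (-a) a
  have hIo : IsOpen I := isOpen_openInterval (-a) a
  have hgm : Measurable fun x => ux (x, y) := by fun_prop
  have hg : MemLp (fun x => ux (x, y)) 2 (gauss1.restrict I) := memLp_two_of_lintegral hgm f2
  have hL : MemLp (fun x => ∫ t in (0 : ℝ)..x, ux (t, y)) 2 (gauss1.restrict I) := by
    refine ⟨(continuousOn_primitive_of_lintegral hIo (ordConnected_openInterval a) hgm f2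
      (zero_mem_openInterval ha)).aestronglyMeasurable hIo.measurableSet, ?_⟩
    rw [eLpNorm_lt_top_iff_lintegral_rpow_enorm_lt_top (by norm_num) (by norm_num)]
    simpa using lt_top_iff_ne_top.2 f3
  rw [← ofReal_integral_sq hL] at hAy hABy
  rw [← ofReal_integral_sq hg, ← ENNReal.ofReal_mul (mu1_nonneg _ _),
    ENNReal.ofReal_eq_ofReal_iff (mul_nonneg (mu1_nonneg _ _) (integral_nonneg fun x => sq_nonneg _))
      (integral_nonneg fun x => sq_nonneg _)] at hABy
  have hFpos : 0 < ∫ x in I, (∫ t in (0 : ℝ)..x, ux (t, y)) ^ 2 ∂gauss1 := by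
    by_contra hcon
    exact hAy (ENNReal.ofReal_eq_zero.2 (not_lt.1 hcon))
  refine ⟨_, _, memH1Line_primitive ha hg hL, fun hz => ?_,
    integral_eq_zero_of_odd fun x hx => odd_primitive_of_even f1 hx, ?_⟩
  · refine hFpos.ne' (integral_eq_zero_of_ae ?_)
    filter_upwards [gauss1_ae_restrict_iff.2 hz] with x hx
    rw [hx]; simp
  · rw [eq_div_iff hFpos.ne']
    exact hABy

end HalfStrip

/-! ### From concave even profiles to the theorem. -/

section Conclusion

/-- A point t with |t| ≤ |x| lies on the segment from -x to x, on which a concave function is at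
least the minimum of its end values; by evenness both equal p(x). -/
theorem isRegionProfile_of_concaveOn {a : EReal} {p : ℝ → ℝ} (ha : 0 < a)
    (hc : ConcaveOn ℝ (openInterval (-a) a) p)
    (heven : ∀ x ∈ openInterval (-a) a, p (-x) = p x)
    (hcont : ContinuousOn p (openInterval (-a) a)) : IsRegionProfile a p := by
  refine ⟨ha, hcont, fun x hx t ht => ?_⟩
  wlog h : 0 ≤ x generalizing x
  · have := this (-x) (mem_openInterval_of_abs_le hx (by simp)) (by simpa using ht)
      (by linarith)
    rwa [heven x hx] at this
  have hnx : -x ∈ openInterval (-a) a := mem_openInterval_of_abs_le hx (by simp)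
  rw [abs_of_nonneg h] at ht
  have hseg : t ∈ segment ℝ (-x) x := by
    rw [segment_eq_Icc (by linarith)]
    exact abs_le.1 ht
  have := hc.min_le_of_mem_segment hnx hx hseg
  rwa [heven x hx, min_self] at this

end Conclusion

theorem theorem2 :
    (∀ (Ω : Set (ℝ × ℝ)) (a : EReal) (p : ℝ → ℝ),
      IsDomainSet Ω → HasC2Boundary Ω → Convex ℝ Ω → ¬ Bornology.IsBounded Ω → SymmYAxis Ω →
      0 < a →
      ConcaveOn ℝ (openInterval (-a) a) p →
      (∀ x ∈ openInterval (-a) a, p (-x) = p x) →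
      ContDiffOn ℝ 2 p (openInterval (-a) a) →
      Ω = regionBelow a p →
      UniformInteriorSphere Ω →
      -- both extremal values are attained, and the estimate holds
      IsLeast (rayleighQuotients (-a) a) (mu1 (-a) a) ∧
      IsLeast (oddNeumannEigenvalues Ω) (mu1Odd Ω) ∧
      mu1 (-a) a ≤ mu1Odd Ω) ∧
    (∀ (a : EReal) (b : ℝ), 0 < a →
      -- equality for half-strips, again between attained values
      IsLeast (rayleighQuotients (-a) a) (mu1 (-a) a) ∧
      IsLeast (oddNeumannEigenvalues (halfStrip a b)) (mu1Odd (halfStrip a b)) ∧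
      mu1Odd (halfStrip a b) = mu1 (-a) a) := by
  refine ⟨?_, fun a b ha => ?_⟩
  · rintro Ω a p - - - - - ha hc heven hp2 rfl -
    have hp := isRegionProfile_of_concaveOn ha hc heven hp2.continuousOn
    obtain ⟨m, hm, -⟩ := hp.exists_isLeast_oddNeumannEigenvalues
    have e : mu1Odd (regionBelow a p) = m := hm.csInf_eq
    rw [e]
    exact ⟨isLeast_rayleighQuotients ha, hm, hp.mu1_le hm.1⟩
  · have hm := isLeast_oddNeumannEigenvalues_halfStrip ha b
    have e : mu1Odd (halfStrip a b) = mu1 (-a) a := hm.csInf_eq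
    rw [e]
    exact ⟨isLeast_rayleighQuotients ha, hm, rfl⟩
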